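/- **Concentration of the overlap matrix around its expectation.** Let $K\ge 0$ and $p\ge 1$ be integers and let $P_X$ be a Borel probability measure on $\mathbb{R}^K$ with bounded support. For $n\ge 1$ let $\mathcal I=\{i\in[n]^p: i_1\le\dots\le i_p\}$. Let $\mathbf X$ be the $n\times K$ random matrix whose rows $X_1,\dots,X_n$ are i.i.d. with law $P_X$, and let $(Z_i)_{i\in\mathcal I}$ be i.i.d. $\mathcal N(0,1)$ and $\widetilde Z_1,\dots,\widetilde Z_n$ be i.i.d. $\mathcal N(0,I_K)$, all independent. For $t\in[0,1]$ and a $K\times K$ real symmetric positive semidefinite matrix $R$ consider the observations $$Y^{(t)}_i=\sqrt{\tfrac{(1-t)(p-1)!}{n^{p-1}}}\sum_{k=1}^K\prod_{a=1}^pX_{i_ak}+Z_i\quad(i\in\mathcal I),\qquad \widetilde Y^{(t,R)}_j=\sqrt R\,X_j+\widetilde Z_j\quad(1\le j\le n),$$ and for $\mathbf x\in\mathbb R^{n\times K}$ with rows $x_1,\dots,x_n$ the Hamiltonian $$\mathcal H_{t,R}(\mathbf x)=\sum_{i\in\mathcal I}\Big[\tfrac{(1-t)(p-1)!}{2n^{p-1}}\Big(\sum_{k}\prod_{a}x_{i_ak}\Big)^2-\sqrt{\tfrac{(1-t)(p-1)!}{n^{p-1}}}\,Y^{(t)}_i\sum_k\prod_a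 x_{i_ak}\Big]+\sum_{j=1}^n\Big[\tfrac12x_j^{\top}Rx_j-(\widetilde Y^{(t,R)}_j)^{\top}\sqrt R\,x_j\Big].$$ Let $\langle g(\mathbf x)\rangle_{t,R}=\int g(\mathbf x)e^{-\mathcal H_{t,R}(\mathbf x)}\prod_jdP_X(x_j)\big/\int e^{-\mathcal H_{t,R}(\mathbf x)}\prod_jdP_X(x_j)$ be the expectation under the posterior distribution of $\mathbf X$ given the observations, let $\mathbb E$ be the expectation over $(\mathbf X,Z,\widetilde Z)$, let $\mathbf Q=\frac1n\mathbf x^{\top}\mathbf X\in\mathbb R^{K\times K}$ be the overlap matrix, and let $\|\cdot\|$ be the Frobenius norm. Let $(s_n)_{n\ge1}$ be a decreasing sequence in $(0,1)$, and let $\mathcal E_n$ be the set of real symmetric $K\times K$ matrices $\epsilon$ with $\epsilon_{\ell\ell'}\in[s_n,2s_n]$ for $\ell\ne\ell'$ and $\epsilon_{\ell\ell}\in[2Ks_n,(2K+1)s_n]$ for all $\ell$. For $\epsilon\in\mathcal E_n$ let $R(\cdot,\epsilon)$ be the solution on $[0,1]$, with values in the positive semidefinite matrices, of $$\tfrac{d}{dt}R(t,\epsilon)_{\ell\ell'}=\big(\mathbb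 E\langle Q_{\ell\ell'}\rangle_{t,R(t,\epsilon)}\big)^{p-1}\quad(1\le\ell,\ell'\le K),\qquad R(0,\epsilon)=\epsilon,$$ let $\mathcal R_{n,t}=\{R(t,\epsilon):\epsilon\in\mathcal E_n\}$ and let $\mathrm C(\mathcal R_{n,t})$ be its convex hull. Then there is a constant $C>0$ depending only on $P_X$, $K$ and $p$ (in particular not on $n$, $t$ or the sequence $(s_n)$) such that for all $n\ge1$ and $t\in[0,1]$ the function $R\mapsto\mathbb E\big\langle\|\mathbf Q-\mathbb E\langle\mathbf Q\rangle_{t,R}\|^2\big\rangle_{t,R}$ is integrable on $\mathrm C(\mathcal R_{n,t})$ and $$\int_{\mathrm C(\mathcal R_{n,t})}\mathbb E\big\langle\|\mathbf Q-\mathbb E\langle\mathbf Q\rangle_{t,R}\|^2\big\rangle_{t,R}\,dR\;\le\;\frac{C}{s_n^{3/2}\,n^{1/6}},$$ where $dR=\prod_{\ell\le\ell'}dR_{\ell\ell'}$ is Lebesgue measure on the $K(K+1)/2$-dimensional space of symmetric matrices. -/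

import Mathlib

open MeasureTheory ProbabilityTheory

noncomputable section

namespace TensorOverlap

/-- The set `𝓘 = {i ∈ [n]^p : i₁ ≤ i₂ ≤ ⋯ ≤ i_p}` indexing the entries of the symmetric tensor. -/
abbrev TensorIndex (n p : ℕ) : Type := {i : Fin p → Fin n // Monotone i}

instance (n p : ℕ) : Fintype (TensorIndex n p) := Fintype.ofFinite _

/-- `n × K` real matrices, row `j` being the vector `x_j ∈ ℝ^K`. -/
abbrev Config (n K : ℕ) : Type := Fin n → Fin K → ℝ

/-- The randomness `(X, Z, Z̃)` of the inference problem: the hidden matrix `X`, the noise `Z` on the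
tensor entries and the noise `Z̃` on the decoupled channels. -/
abbrev Disorder (n K p : ℕ) : Type := Config n K × (TensorIndex n p → ℝ) × Config n K

/-- The law of `(X, Z, Z̃)`: the three components are independent, the rows of `X` are i.i.d. with
distribution `P`, all entries of `Z` and `Z̃` are i.i.d. standard Gaussians. -/
def disorderLaw {K : ℕ} (P : Measure (Fin K → ℝ)) (n p : ℕ) : Measure (Disorder n K p) :=
  (Measure.pi fun _ : Fin n => P).prod
    ((Measure.pi fun _ : TensorIndex n p => gaussianReal 0 1).prod
      (Measure.pi fun _ : Fin n => Measure.pi fun _ : Fin K => gaussianReal 0 1))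

/-- The tensor entry `∑_k ∏_a x_{i_a k}`. -/
def tensorEntry {n K p : ℕ} (x : Config n K) (i : TensorIndex n p) : ℝ :=
  ∑ k, ∏ a, x (i.1 a) k

/-- The square of the gain of the tensor channel at time `t`, that is `(1 - t) (p - 1)! / n^(p - 1)`. -/
def tensorSnr (n p : ℕ) (t : ℝ) : ℝ := (1 - t) * (p - 1).factorial / (n : ℝ) ^ (p - 1)

/-- The symmetric square root `√R` of a matrix (for positive semidefinite `R`, the positive
semidefinite square root), by the continuous functional calculus. -/
def matSqrt {K : ℕ} (R : Matrix (Fin K) (Fin K) ℝ) : Matrix (Fin K) (Fin K) ℝ := cfc Real.sqrt R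

/-- The observations `Y^{(t)}_i` of the tensor channel. -/
def obsTensor {n K p : ℕ} (t : ℝ) (ω : Disorder n K p) (i : TensorIndex n p) : ℝ :=
  Real.sqrt (tensorSnr n p t) * tensorEntry ω.1 i + ω.2.1 i

/-- The observations `Ỹ^{(t,R)}_j = √R X_j + Z̃_j` of the decoupled channels. -/
def obsVector {n K p : ℕ} (R : Matrix (Fin K) (Fin K) ℝ) (ω : Disorder n K p) (j : Fin n) :
    Fin K → ℝ :=
  (matSqrt R).mulVec (ω.1 j) + ω.2.2 j

/-- The Hamiltonian `H_{t,R}(x; Y, Ỹ)`. -/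
def hamiltonian {n K p : ℕ} (t : ℝ) (R : Matrix (Fin K) (Fin K) ℝ)
    (Y : TensorIndex n p → ℝ) (Yt : Fin n → Fin K → ℝ) (x : Config n K) : ℝ :=
  (∑ i : TensorIndex n p, (tensorSnr n p t / 2 * tensorEntry x i ^ 2
      - Real.sqrt (tensorSnr n p t) * Y i * tensorEntry x i))
  + ∑ j, (1 / 2 * (x j ⬝ᵥ R.mulVec (x j)) - Yt j ⬝ᵥ (matSqrt R).mulVec (x j))

/-- The weight `exp (-H_{t,R}(x; Y^{(t)}, Ỹ^{(t,R)}))`. -/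
def gibbsWeight {n K p : ℕ} (t : ℝ) (R : Matrix (Fin K) (Fin K) ℝ) (ω : Disorder n K p)
    (x : Config n K) : ℝ :=
  Real.exp (-hamiltonian t R (obsTensor t ω) (obsVector R ω) x)

/-- The Gibbs bracket `⟨g⟩_{t,R}`: the expectation of `g` under the posterior distribution of `X`
given the observations `Y^{(t)}, Ỹ^{(t,R)}`. -/
def gibbs {n K p : ℕ} (P : Measure (Fin K → ℝ)) (t : ℝ) (R : Matrix (Fin K) (Fin K) ℝ)
    (ω : Disorder n K p) (g : Config n K → ℝ) : ℝ :=
  (∫ x, g x * gibbsWeight t R ω x ∂(Measure.pi fun _ : Fin n => P)) /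
    ∫ x, gibbsWeight t R ω x ∂(Measure.pi fun _ : Fin n => P)

/-- The overlap matrix `Q = (1/n) xᵀ X`. -/
def overlap {n K : ℕ} (x X : Config n K) : Matrix (Fin K) (Fin K) ℝ :=
  Matrix.of fun l l' => (1 / (n : ℝ)) * ∑ j, x j l * X j l'

/-- The expected overlap matrix `𝔼⟨Q⟩_{t,R}`. -/
def meanOverlap {K : ℕ} (P : Measure (Fin K → ℝ)) (n p : ℕ) (t : ℝ)
    (R : Matrix (Fin K) (Fin K) ℝ) : Matrix (Fin K) (Fin K) ℝ :=
  Matrix.of fun l l' => ∫ ω, gibbs P t R ω (fun x => overlap x ω.1 l l') ∂(disorderLaw P n p)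

/-- The square of the Frobenius norm. -/
def frobSq {K : ℕ} (A : Matrix (Fin K) (Fin K) ℝ) : ℝ := ∑ l, ∑ l', A l l' ^ 2

/-- `𝔼⟨‖Q - 𝔼⟨Q⟩_{t,R}‖²⟩_{t,R}`. -/
def overlapFluctuation {K : ℕ} (P : Measure (Fin K → ℝ)) (n p : ℕ) (t : ℝ)
    (R : Matrix (Fin K) (Fin K) ℝ) : ℝ :=
  ∫ ω, gibbs P t R ω (fun x => frobSq (overlap x ω.1 - meanOverlap P n p t R)) ∂(disorderLaw P n p)

/-- The set `𝓔_n` of perturbations, for `s = s_n`. -/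
def perturbations (K : ℕ) (s : ℝ) : Set (Matrix (Fin K) (Fin K) ℝ) :=
  {ε | (∀ l l', l ≠ l' → ε l l' = ε l' l ∧ ε l l' ∈ Set.Icc s (2 * s)) ∧
    ∀ l, ε l l ∈ Set.Icc (2 * K * s) ((2 * K + 1) * s)}

/-- `ρ` restricted to `[0,1]` is a path of positive semidefinite matrices that solves
`R'(t) = (𝔼⟨Q⟩_{t,R(t)})^{∘(p-1)}` (Hadamard power) with `R(0) = ε`. -/
def IsInterpolationPath {K : ℕ} (P : Measure (Fin K → ℝ)) (n p : ℕ)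
    (ε : Matrix (Fin K) (Fin K) ℝ) (ρ : ℝ → Matrix (Fin K) (Fin K) ℝ) : Prop :=
  ρ 0 = ε ∧ ∀ t ∈ Set.Icc (0 : ℝ) 1, (ρ t).PosSemidef ∧
    ∀ l l', HasDerivWithinAt (fun u => ρ u l l') (meanOverlap P n p t (ρ t) l l' ^ (p - 1))
      (Set.Icc 0 1) t

/-- The image `𝓡_{n,t} = R(t, 𝓔_n)`: the values at time `t` of the interpolation paths that start
in `𝓔_n`. -/
def pathValues {K : ℕ} (P : Measure (Fin K → ℝ)) (n p : ℕ) (s t : ℝ) :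
    Set (Matrix (Fin K) (Fin K) ℝ) :=
  {R | ∃ ε ∈ perturbations K s, ∃ ρ, IsInterpolationPath P n p ε ρ ∧ ρ t = R}

/-- The index set of the `K (K + 1) / 2` coordinates `(R_{ℓℓ'})_{ℓ ≤ ℓ'}` of a symmetric matrix. -/
abbrev UpperIndex (K : ℕ) : Type := {q : Fin K × Fin K // q.1 ≤ q.2}

/-- The symmetric matrix with the given coordinates on and above the diagonal. -/
def symOfUpper {K : ℕ} (v : UpperIndex K → ℝ) : Matrix (Fin K) (Fin K) ℝ :=
  Matrix.of fun l l' => v ⟨(min l l', max l l'), min_le_max⟩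

end TensorOverlap

end

/-! The model is treated as an abstract Gaussian channel: a signal `X`, an observation `Φ X + Z`, a
posterior mean `post`. The two tools are the Nishimori identity (on average the signal may be
exchanged for a sample of the posterior) and Gaussian integration by parts.

Adding x u uᵀ to the matrix R amounts, in law, to one more scalar observation r⟨u, X_j⟩ + noise per
row, with r² = x. Indeed the Hamiltonian sees the noise on the rows only through the field √R Z̃,
whose law depends on R alone (`neg_hamiltonian_eq`, `map_lineField_eq`). On each line of direction u
uᵀ it therefore suffices to study a scalar gain r. Let m_j be the posterior mean of ⟨u, X_j⟩.

(1) The free energy has variance O(n) by Efron–Stein (`variance_freeEnergy_line_le`), and it is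
convex in r up to a deterministic quadratic. A convex function that fluctuates little has slopes
that fluctuate little, on average over r (`lintegral_variance_slope_le`). A window δ costs n/δ² +
n²δ, which is balanced at δ = n^(-1/3).

(2) The slope controls the self-overlap of the posterior means. For S the sum of the squared channel
means and N the sum of the scores, E N = E S and E[S N] ≥ E[S²], whence Var S ≤ Var N
(`variance_sum_sq_post_le`).

(3) The quantity E Σ_j ⟨u, X_j⟩ m_j is O(n), and its derivative in r is 2r times the sum of all mean
squared posterior covariances between rows. On average over x these n² terms thus add up to O(n)
only (`lintegral_lineCov_sq_le`).

(4) By Nishimori an entry of Q has the mean of an overlap of posterior means, and its second moment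
exceeds the second moment of that overlap only through posterior covariances
(`integral_post_overlap_sub_sq_le`). Polarisation over the directions e_l, e_l' and e_l + e_l'
reaches all entries (`overlapFluctuation_le`).

It remains to pass from lines to the hull. E⟨Q⟩ is an averaged Gram matrix, so its Hadamard powers
are positive semidefinite, and every path satisfies R(t, ε) ≥ ε ≥ 2s·I with entries bounded
uniformly in n. Such matrices form a convex set, which contains the hull (`pathValues_subset`). Each
of them stays positive semidefinite after subtraction of (s/2) u uᵀ, so the line estimates apply
with gains at least √(s/2), and Tonelli in the direction u uᵀ integrates them over the set
(`lintegral_region_le`). No change of variables from ε to R(t, ε) is involved. The outcome is of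
order δ/√s = n^(-1/3) s^(-1/2), which is stronger than the claim. -/

namespace TensorOverlap

/-! ### Gaussian integration by parts, resampling and shifts. -/

/-- Gaussian integration by parts on the real line. -/
theorem integral_id_mul_gaussianReal {f f' : ℝ → ℝ} {A A' : ℝ}
    (hf : ∀ x, HasDerivAt f (f' x) x) (hf' : Measurable f')
    (hA : ∀ x, |f x| ≤ A) (hA' : ∀ x, |f' x| ≤ A') :
    ∫ x, x * f x ∂(gaussianReal 0 1) = ∫ x, f' x ∂(gaussianReal 0 1) := by
  -- The density φ solves φ' = -xφ; the rest is integration by parts on the line against φ.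
  have hp : ∀ x, HasDerivAt (gaussianPDFReal 0 1) (-(x * gaussianPDFReal 0 1 x)) x := by
    intro x
    have h1 : HasDerivAt (fun x : ℝ => -(x - 0) ^ 2 / (2 * ((1 : NNReal) : ℝ))) (-x) x := by
      have := ((((hasDerivAt_id x).sub_const (0:ℝ)).pow 2).neg).div_const (2 * ((1 : NNReal) : ℝ))
      refine this.congr_deriv ?_
      simp; ring
    have h2 := (h1.exp).const_mul (√(2 * Real.pi * ((1 : NNReal) : ℝ)))⁻¹
    rw [gaussianPDFReal_def]
    refine h2.congr_deriv ?_
    simp only []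
    ring
  have hfm : Measurable f :=
    (continuous_iff_continuousAt.2 fun x => (hf x).continuousAt).measurable
  have hint : Integrable (fun x => x) (gaussianReal 0 1) :=
    (memLp_id_gaussianReal' 1 (by simp)).integrable le_rfl
  have hid : Integrable (fun x : ℝ => gaussianPDFReal 0 1 x * x) := by
    rw [gaussianReal_of_var_ne_zero _ one_ne_zero,
      integrable_withDensity_iff_integrable_smul' (measurable_gaussianPDF _ _)
        (Filter.Eventually.of_forall fun _ => gaussianPDF_lt_top)] at hint
    simpa [toReal_gaussianPDF] using hint
  have key := integral_mul_deriv_eq_deriv_mul_of_integrable (u := f) (u' := f')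
    (v := gaussianPDFReal 0 1) (v' := fun x => -(x * gaussianPDFReal 0 1 x))
    (fun x _ => hf x) (fun x _ => hp x)
    (by
      have := (hid.neg).bdd_mul (c := A) hfm.aestronglyMeasurable
        (Filter.Eventually.of_forall hA)
      refine this.congr (Filter.Eventually.of_forall fun x => ?_)
      simp only [Pi.mul_apply, Pi.neg_apply]; ring)
    ((integrable_gaussianPDFReal 0 1).bdd_mul (c := A') hf'.aestronglyMeasurable
      (Filter.Eventually.of_forall hA'))
    ((integrable_gaussianPDFReal 0 1).bdd_mul (c := A) hfm.aestronglyMeasurable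
      (Filter.Eventually.of_forall hA))
  rw [integral_gaussianReal_eq_integral_smul one_ne_zero,
    integral_gaussianReal_eq_integral_smul one_ne_zero]
  simp only [smul_eq_mul]
  have e1 : ∀ x, gaussianPDFReal 0 1 x * (x * f x) = -(f x * -(x * gaussianPDFReal 0 1 x)) :=
    fun x => by ring
  have e2 : ∀ x, gaussianPDFReal 0 1 x * f' x = f' x * gaussianPDFReal 0 1 x :=
    fun x => by ring
  simp_rw [e1, e2]
  rw [integral_neg, key, neg_neg]

section Resample

variable {κ S : Type*} [DecidableEq κ] [MeasurableSpace S]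

theorem measurable_update_prod (i : κ) :
    Measurable fun p : (κ → S) × S => Function.update p.1 i p.2 := by
  refine measurable_pi_iff.2 fun k => ?_
  by_cases h : k = i
  · subst h; simpa using measurable_snd
  · simp only [Function.update_of_ne h]
    exact (measurable_pi_apply k).comp measurable_fst

variable [Fintype κ]

/-- Resampling one coordinate of a product of probability measures does not change the law. -/
theorem pi_map_update (ν : κ → Measure S) [∀ i, IsProbabilityMeasure (ν i)] (i : κ) :
    ((Measure.pi ν).prod (ν i)).map (fun p => Function.update p.1 i p.2) = Measure.pi ν := by
  symm
  refine Measure.pi_eq fun s hs => ?_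
  rw [Measure.map_apply (measurable_update_prod i) (MeasurableSet.univ_pi hs)]
  have : (fun p : (κ → S) × S => Function.update p.1 i p.2) ⁻¹' (Set.univ.pi s) =
      (Set.univ.pi (Function.update s i Set.univ)) ×ˢ s i := by
    ext p
    simp only [Set.mem_preimage, Set.mem_pi, Set.mem_univ, true_implies, Set.mem_prod]
    constructor
    · intro h
      refine ⟨fun k => ?_, by simpa using h i⟩
      by_cases hk : k = i
      · subst hk; simp
      · simpa [Function.update_of_ne hk] using h k
    · rintro ⟨h, hi⟩ k
      by_cases hk : k = i
      · subst hk; simpa using hi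
      · simpa [Function.update_of_ne hk] using h k
  rw [this, Measure.prod_prod, Measure.pi_pi, ← Finset.mul_prod_erase _ _ (Finset.mem_univ i),
    ← Finset.mul_prod_erase (a := i) (f := fun i => ν i (s i)) _ (Finset.mem_univ i)]
  simp only [Function.update_self, measure_univ, one_mul]
  rw [mul_comm]
  congr 1
  refine Finset.prod_congr rfl fun k hk => ?_
  rw [Function.update_of_ne (Finset.ne_of_mem_erase hk)]

/-- Reduces a statement about one coordinate to a one-dimensional one, in the form `Function.update
z i a` in which partial derivatives are expressed. -/
theorem integral_pi_update (ν : κ → Measure S) [∀ i, IsProbabilityMeasure (ν i)] (i : κ)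
    {f : (κ → S) → ℝ} (hf : Integrable f (Measure.pi ν)) :
    ∫ z, f z ∂(Measure.pi ν) =
      ∫ z, ∫ a, f (Function.update z i a) ∂(ν i) ∂(Measure.pi ν) := by
  have hf' := hf
  rw [← pi_map_update ν i] at hf'
  conv_lhs => rw [← pi_map_update ν i]
  rw [integral_map (measurable_update_prod i).aemeasurable hf'.aestronglyMeasurable,
    integral_prod]
  exact hf'.comp_measurable (measurable_update_prod i)

end Resample

/-- The law of a family of independent standard Gaussian variables. -/
noncomputable abbrev stdGauss (κ : Type*) [Fintype κ] : Measure (κ → ℝ) :=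
  Measure.pi fun _ : κ => gaussianReal 0 1

section Gauss

variable {κ : Type*} [Fintype κ]

theorem memLp_coord_stdGauss (i : κ) : MemLp (fun z : κ → ℝ => z i) 2 (stdGauss κ) := by
  have := (memLp_id_gaussianReal (μ := 0) (v := 1) 2).comp_measurePreserving
    (measurePreserving_eval (fun _ : κ => gaussianReal 0 1) i)
  exact this

theorem integrable_coord_stdGauss (i : κ) : Integrable (fun z : κ → ℝ => z i) (stdGauss κ) :=
  (memLp_coord_stdGauss i).integrable one_le_two

/-- Gaussian integration by parts in one coordinate. -/
theorem integral_coord_mul_stdGauss [DecidableEq κ] (i : κ) {F F' : (κ → ℝ) → ℝ} {A A' : ℝ}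
    (hF : ∀ z, HasDerivAt (fun a => F (Function.update z i a)) (F' z) (z i))
    (hFm : Measurable F) (hF'm : Measurable F') (hA : ∀ z, |F z| ≤ A) (hA' : ∀ z, |F' z| ≤ A') :
    ∫ z, z i * F z ∂(stdGauss κ) = ∫ z, F' z ∂(stdGauss κ) := by
  have i1 : Integrable (fun z : κ → ℝ => z i * F z) (stdGauss κ) := by
    have := (integrable_coord_stdGauss i).bdd_mul (c := A) hFm.aestronglyMeasurable
      (Filter.Eventually.of_forall hA)
    simpa only [mul_comm] using this
  have i2 : Integrable F' (stdGauss κ) :=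
    (integrable_const A').mono' hF'm.aestronglyMeasurable (Filter.Eventually.of_forall hA')
  rw [integral_pi_update _ i i1, integral_pi_update _ i i2]
  refine integral_congr_ae (Filter.Eventually.of_forall fun z => ?_)
  have hu : Measurable fun a : ℝ => Function.update z i a :=
    (measurable_update_prod i).comp (measurable_const.prodMk measurable_id)
  simp only [Function.update_self]
  refine integral_id_mul_gaussianReal (f := fun a => F (Function.update z i a)) (fun a => ?_)
    (hF'm.comp hu) (fun a => hA _) (fun a => hA' _)
  simpa using hF (Function.update z i a)

/-- The density of a shifted standard Gaussian vector. -/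
theorem pi_gaussianReal_eq_withDensity (a : κ → ℝ) :
    Measure.pi (fun i => gaussianReal (a i) 1) =
      (stdGauss κ).withDensity fun y => ENNReal.ofReal (Real.exp (∑ i, (y i * a i - a i ^ 2 / 2))) := by
  refine Measure.pi_eq fun s hs => ?_
  have hexp : ∀ b : ℝ, Integrable (fun y : ℝ => Real.exp (y * b - b ^ 2 / 2)) (gaussianReal 0 1) := by
    intro b
    have := (integrable_exp_mul_gaussianReal (μ := 0) (v := 1) b).mul_const (Real.exp (-(b ^ 2 / 2)))
    refine this.congr (Filter.Eventually.of_forall fun y => ?_)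
    simp only [← Real.exp_add]; congr 1; ring
  have hint : Integrable (fun y : κ → ℝ => ∏ i, Real.exp (y i * a i - a i ^ 2 / 2)) (stdGauss κ) :=
    Integrable.fintype_prod (f := fun i y => Real.exp (y * a i - a i ^ 2 / 2)) fun i => hexp (a i)
  rw [withDensity_apply _ (MeasurableSet.univ_pi hs)]
  simp_rw [Real.exp_sum]
  rw [← ofReal_integral_eq_lintegral_ofReal hint.integrableOn
    (Filter.Eventually.of_forall fun y => Finset.prod_nonneg fun i _ => (Real.exp_pos _).le),
    stdGauss, Measure.restrict_pi_pi,
    integral_fintype_prod_eq_prod (fun i y => Real.exp (y * a i - a i ^ 2 / 2)),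
    ENNReal.ofReal_prod_of_nonneg fun i _ => integral_nonneg fun _ => (Real.exp_pos _).le]
  refine Finset.prod_congr rfl fun i _ => ?_
  rw [gaussianReal_apply_eq_integral _ one_ne_zero]
  congr 1
  rw [← integral_indicator (hs i), ← integral_indicator (hs i),
    integral_gaussianReal_eq_integral_smul one_ne_zero]
  refine integral_congr_ae (Filter.Eventually.of_forall fun y => ?_)
  by_cases hy : y ∈ s i
  · simp only [Set.indicator_of_mem hy, smul_eq_mul, gaussianPDFReal_def]
    rw [mul_assoc, ← Real.exp_add]
    congr 2
    simp; ring
  · simp [Set.indicator_of_notMem hy]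

/-- The density of the shifted noise is the likelihood ratio of the observation y given the signal
value a. This is the source of Bayes' rule in the Nishimori identity. -/
theorem integral_add_stdGauss (a : κ → ℝ) (h : (κ → ℝ) → ℝ) (hm : Measurable h) :
    ∫ z, h (a + z) ∂(stdGauss κ) =
      ∫ y, Real.exp (∑ i, (y i * a i - a i ^ 2 / 2)) * h y ∂(stdGauss κ) := by
  have hmap : (stdGauss κ).map (fun z => a + z) = Measure.pi (fun i => gaussianReal (a i) 1) := by
    have := Measure.pi_map_pi (μ := fun _ : κ => gaussianReal 0 1) (f := fun i x => a i + x)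
      (fun i => by fun_prop)
    simp only [gaussianReal_map_const_add, zero_add] at this
    exact this
  rw [← integral_map (f := h) (by fun_prop : Measurable fun z : κ → ℝ => a + z).aemeasurable
    hm.aestronglyMeasurable, hmap, pi_gaussianReal_eq_withDensity,
    integral_withDensity_eq_integral_toReal_smul (by fun_prop)
      (Filter.Eventually.of_forall fun _ => ENNReal.ofReal_lt_top)]
  simp [ENNReal.toReal_ofReal, (Real.exp_pos _).le]

end Gauss

end TensorOverlap

namespace TensorOverlap

/-! ### Total variance and the Efron–Stein inequality. -/

section EfronStein

variable {α β : Type*} [MeasurableSpace α] [MeasurableSpace β]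

/-- The law of total variance, as an upper bound. -/
theorem variance_prod_le (μ : Measure α) (ν : Measure β) [IsProbabilityMeasure μ]
    [IsProbabilityMeasure ν] {F : α × β → ℝ} (hF : MemLp F 2 (μ.prod ν)) {V W : ℝ}
    (hV : ∀ x, Var[fun y => F (x, y); ν] ≤ V) (hW : Var[fun x => ∫ y, F (x, y) ∂ν; μ] ≤ W) :
    Var[F; μ.prod ν] ≤ V + W := by
  have hFi : Integrable F (μ.prod ν) := hF.integrable one_le_two
  have hF2 : Integrable (fun p => F p ^ 2) (μ.prod ν) := hF.integrable_sq
  have hae : ∀ᵐ x ∂μ, MemLp (fun y => F (x, y)) 2 ν := by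
    have h1 := hF.1.prodMk_left
    filter_upwards [h1, hF2.prod_right_ae] with x hx hx2
    exact (memLp_two_iff_integrable_sq hx).2 hx2
  have hm : AEStronglyMeasurable (fun x => ∫ y, F (x, y) ∂ν) μ := hF.1.integral_prod_right'
  have hsq : ∀ᵐ x ∂μ, (∫ y, F (x, y) ∂ν) ^ 2 ≤ ∫ y, F (x, y) ^ 2 ∂ν := by
    filter_upwards [hae] with x hx
    have h := variance_nonneg (fun y => F (x, y)) ν
    rw [variance_eq_sub hx] at h
    simpa using h
  have hG2 : Integrable (fun x => (∫ y, F (x, y) ∂ν) ^ 2) μ :=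
    hF2.integral_prod_left.mono' (hm.pow 2) (hsq.mono fun x hx => by
      rwa [Real.norm_eq_abs, abs_of_nonneg (sq_nonneg _)])
  have hG : MemLp (fun x => ∫ y, F (x, y) ∂ν) 2 μ := (memLp_two_iff_integrable_sq hm).2 hG2
  rw [variance_eq_sub hF]
  rw [variance_eq_sub hG] at hW
  simp only [Pi.pow_apply] at hW ⊢
  rw [integral_prod _ hF2, integral_prod _ hFi]
  have h3 : ∫ x, ∫ y, F (x, y) ^ 2 ∂ν ∂μ ≤ ∫ x, (V + (∫ y, F (x, y) ∂ν) ^ 2) ∂μ := by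
    refine integral_mono_ae hF2.integral_prod_left ((integrable_const V).add hG2) ?_
    filter_upwards [hae] with x hx
    have h := hV x
    rw [variance_eq_sub hx] at h
    simp only [Pi.pow_apply] at h
    linarith
  rw [integral_add (integrable_const V) hG2] at h3
  simp at h3
  linarith

theorem integrable_sq_fst_add_snd (ν : Measure β) [IsProbabilityMeasure ν] {f : β → ℝ}
    (hf : MemLp f 2 ν) :
    Integrable (fun p : β × β => f p.1 ^ 2 + f p.2 ^ 2) (ν.prod ν) :=
  (hf.integrable_sq.comp_fst ν).add (hf.integrable_sq.comp_snd ν)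

theorem integrable_sub_sq_prod (ν : Measure β) [IsProbabilityMeasure ν] {f : β → ℝ}
    (hf : MemLp f 2 ν) : Integrable (fun p : β × β => (f p.1 - f p.2) ^ 2) (ν.prod ν) := by
  have h3 : Integrable (fun p : β × β => f p.1 * f p.2) (ν.prod ν) :=
    (hf.integrable one_le_two).mul_prod (hf.integrable one_le_two)
  refine ((integrable_sq_fst_add_snd ν hf).sub (h3.const_mul 2)).congr
    (Filter.Eventually.of_forall fun p => ?_)
  simp only [Pi.sub_apply]
  ring

theorem integral_sub_sq_prod (ν : Measure β) [IsProbabilityMeasure ν] {f : β → ℝ}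
    (hf : MemLp f 2 ν) : ∫ p, (f p.1 - f p.2) ^ 2 ∂(ν.prod ν) = 2 * Var[f; ν] := by
  have h1 : Integrable (fun p : β × β => f p.1 ^ 2) (ν.prod ν) := hf.integrable_sq.comp_fst ν
  have h2 : Integrable (fun p : β × β => f p.2 ^ 2) (ν.prod ν) := hf.integrable_sq.comp_snd ν
  have h3 : Integrable (fun p : β × β => f p.1 * f p.2) (ν.prod ν) :=
    (hf.integrable one_le_two).mul_prod (hf.integrable one_le_two)
  have : ∀ p : β × β, (f p.1 - f p.2) ^ 2 = f p.1 ^ 2 + f p.2 ^ 2 - 2 * (f p.1 * f p.2) :=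
    fun p => by ring
  simp_rw [this]
  rw [integral_sub (integrable_sq_fst_add_snd ν hf) (h3.const_mul 2), integral_add h1 h2,
    integral_const_mul, integral_prod_mul, integral_fun_fst (fun x => f x ^ 2),
    integral_fun_snd (fun x => f x ^ 2), variance_eq_sub hf]
  simp
  ring

/-- Twice the variance is the mean square of the difference of two independent copies. -/
theorem variance_le_of_abs_sub_le (ν : Measure β) [IsProbabilityMeasure ν] {f : β → ℝ}
    (hf : MemLp f 2 ν) {D : β → β → ℝ} (hD : ∀ a b, |f a - f b| ≤ D a b)
    (hDi : Integrable (fun p : β × β => D p.1 p.2 ^ 2) (ν.prod ν)) :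
    Var[f; ν] ≤ 1 / 2 * ∫ p, D p.1 p.2 ^ 2 ∂(ν.prod ν) := by
  have : ∫ p, (f p.1 - f p.2) ^ 2 ∂(ν.prod ν) ≤ ∫ p, D p.1 p.2 ^ 2 ∂(ν.prod ν) :=
    integral_mono (integrable_sub_sq_prod ν hf) hDi fun p =>
      sq_le_sq' (abs_le.1 (hD _ _)).1 (abs_le.1 (hD _ _)).2
  rw [integral_sub_sq_prod ν hf] at this
  linarith

/-- The **Efron–Stein inequality** for functions whose oscillation in each coordinate is
controlled. -/
theorem variance_pi_fin_le (ν : Measure β) [IsProbabilityMeasure ν] (n : ℕ)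
    {F : (Fin n → β) → ℝ} (hFm : Measurable F) (hF : MemLp F 2 (Measure.pi fun _ => ν))
    {D : Fin n → β → β → ℝ}
    (hD : ∀ i x a b, |F (Function.update x i a) - F (Function.update x i b)| ≤ D i a b)
    (hDi : ∀ i, Integrable (fun p : β × β => D i p.1 p.2 ^ 2) (ν.prod ν)) :
    Var[F; Measure.pi fun _ => ν] ≤ ∑ i, 1 / 2 * ∫ p, D i p.1 p.2 ^ 2 ∂(ν.prod ν) := by
  induction n with
  | zero =>
    have : F = fun _ => F Fin.elim0 := by ext x; rw [Subsingleton.elim x Fin.elim0]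
    rw [this, Finset.univ_eq_empty, Finset.sum_empty]
    simp [variance_eq_integral aemeasurable_const]
  | succ n ih =>
    let e := MeasurableEquiv.piFinSuccAbove (fun _ : Fin (n + 1) => β) 0
    have hmp := (measurePreserving_piFinSuccAbove (fun _ : Fin (n + 1) => ν) 0).symm
    let G : β × (Fin n → β) → ℝ := fun p => F (Fin.cons p.1 p.2)
    have hGe : G = F ∘ e.symm := by
      ext p
      simp [G, e, MeasurableEquiv.piFinSuccAbove]
      rfl
    have hGm : Measurable G := by rw [hGe]; exact hFm.comp e.symm.measurable
    have hG : MemLp G 2 (ν.prod (Measure.pi fun _ => ν)) := by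
      rw [hGe]; exact hF.comp_measurePreserving hmp
    have hVar : Var[F; Measure.pi fun _ => ν] = Var[G; ν.prod (Measure.pi fun _ => ν)] := by
      rw [hGe]
      exact (hmp.variance_fun_comp hFm.aemeasurable).symm
    have hG0 : ∀ a b x, |G (a, x) - G (b, x)| ≤ D 0 a b := by
      intro a b x
      have := hD 0 (Fin.cons a x) a b
      simpa [G, Fin.update_cons_zero] using this
    have hG1 : ∀ a i x b c, |G (a, Function.update x i b) - G (a, Function.update x i c)|
        ≤ D i.succ b c := by
      intro a i x b c
      have := hD i.succ (Fin.cons a x) b c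
      simpa [G, ← Fin.cons_update] using this
    -- every slice is square integrable because two slices differ by a bounded function
    have hslice : ∀ a, MemLp (fun x => G (a, x)) 2 (Measure.pi fun _ : Fin n => ν) := by
      have hae : ∀ᵐ a ∂ν, MemLp (fun x => G (a, x)) 2 (Measure.pi fun _ : Fin n => ν) := by
        filter_upwards [hG.1.prodMk_left, hG.integrable_sq.prod_right_ae] with x hx hx2
        exact (memLp_two_iff_integrable_sq hx).2 hx2
      obtain ⟨a₀, ha₀⟩ := hae.exists
      intro a
      have hd : MemLp (fun x => G (a, x) - G (a₀, x)) 2 (Measure.pi fun _ : Fin n => ν) :=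
        MemLp.of_bound (C := D 0 a a₀)
          ((hGm.comp measurable_prodMk_left).sub
            (hGm.comp measurable_prodMk_left)).aestronglyMeasurable
          (Filter.Eventually.of_forall fun x => hG0 a a₀ x)
      have := hd.add ha₀
      refine this.congr_norm
        (hGm.comp measurable_prodMk_left).aestronglyMeasurable (Filter.Eventually.of_forall fun x => ?_)
      simp
    have hmean : MemLp (fun a => ∫ x, G (a, x) ∂(Measure.pi fun _ : Fin n => ν)) 2 ν := by
      have hm : AEStronglyMeasurable
          (fun a => ∫ x, G (a, x) ∂(Measure.pi fun _ : Fin n => ν)) ν := hG.1.integral_prod_right'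
      refine (memLp_two_iff_integrable_sq hm).2 ?_
      refine hG.integrable_sq.integral_prod_left.mono' (hm.pow 2)
        (Filter.Eventually.of_forall fun a => ?_)
      rw [Real.norm_eq_abs, abs_of_nonneg (sq_nonneg _)]
      have h := variance_nonneg (fun x => G (a, x)) (Measure.pi fun _ : Fin n => ν)
      rw [variance_eq_sub (hslice a)] at h
      simpa using h
    rw [hVar, Fin.sum_univ_succ, add_comm]
    -- Coordinate 0 is split off. The slices are covered by the induction hypothesis, and averaging
    -- over the other coordinates does not increase the oscillation `D 0`.
    refine variance_prod_le _ _ hG (fun a => ?_) ?_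
    · exact ih (hGm.comp measurable_prodMk_left) (hslice a) (fun i x b c => hG1 a i x b c)
        (fun i => hDi i.succ)
    · refine variance_le_of_abs_sub_le ν hmean (fun a b => ?_) (hDi 0)
      rw [← integral_sub ((hslice a).integrable one_le_two) ((hslice b).integrable one_le_two)]
      have := norm_integral_le_of_norm_le_const (μ := Measure.pi fun _ : Fin n => ν)
        (f := fun x => G (a, x) - G (b, x)) (Filter.Eventually.of_forall fun x => hG0 a b x)
      simpa using this

theorem variance_pi_le {κ : Type*} [Fintype κ] [DecidableEq κ] (ν : Measure β)
    [IsProbabilityMeasure ν]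
    {F : (κ → β) → ℝ} (hFm : Measurable F) (hF : MemLp F 2 (Measure.pi fun _ => ν))
    {D : κ → β → β → ℝ}
    (hD : ∀ i x a b, |F (Function.update x i a) - F (Function.update x i b)| ≤ D i a b)
    (hDi : ∀ i, Integrable (fun p : β × β => D i p.1 p.2 ^ 2) (ν.prod ν)) :
    Var[F; Measure.pi fun _ => ν] ≤ ∑ i, 1 / 2 * ∫ p, D i p.1 p.2 ^ 2 ∂(ν.prod ν) := by
  let e := Fintype.equivFin κ
  have hmp := measurePreserving_piCongrLeft (fun _ : κ => ν) e.symm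
  let E := MeasurableEquiv.piCongrLeft (fun _ : κ => β) e.symm
  have hE : ∀ (x : Fin (Fintype.card κ) → β) i a, E (Function.update x i a) =
      Function.update (E x) (e.symm i) a := by
    intro x i a
    ext k
    obtain ⟨j, rfl⟩ := e.symm.surjective k
    simp only [E, MeasurableEquiv.coe_piCongrLeft, Equiv.piCongrLeft_apply_apply]
    by_cases h : j = i
    · subst h; simp
    · rw [Function.update_of_ne h, Function.update_of_ne (by simpa using h),
        Equiv.piCongrLeft_apply_apply]
  have := variance_pi_fin_le ν (Fintype.card κ) (F := F ∘ E) (hFm.comp E.measurable)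
    (hF.comp_measurePreserving hmp) (D := fun i => D (e.symm i))
    (fun i x a b => by simpa [hE] using hD (e.symm i) (E x) a b) (fun i => hDi _)
  rw [← e.symm.sum_comp]
  refine le_trans (le_of_eq ?_) this
  exact (hmp.variance_fun_comp hFm.aemeasurable).symm

end EfronStein

end TensorOverlap

namespace TensorOverlap

/-! ### Fluctuations of convex functions and of their slopes. -/

section Convexity

variable {Ω : Type*} [MeasurableSpace Ω]

/-- By convexity the slope at r lies between the difference quotients over [r - δ, r] and [r, r +
δ]. Hence δ times its deviation from the mean slope is at most the deviations of H at three points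
plus δ times the increment of the mean slope over [r - δ, r + δ]. Squaring yields the constants 18 =
3 · 6 and 2. -/
theorem variance_slope_le (μ : Measure Ω) [IsProbabilityMeasure μ] {H H' : ℝ → Ω → ℝ}
    (htan : ∀ r r' ω, H r ω + H' r ω * (r' - r) ≤ H r' ω)
    (hH : ∀ r, MemLp (H r) 2 μ) (hH' : ∀ r, MemLp (H' r) 2 μ) {r δ V : ℝ} (hδ : 0 < δ)
    (h0 : Var[H r; μ] ≤ V) (h1 : Var[H (r + δ); μ] ≤ V) (h2 : Var[H (r - δ); μ] ≤ V) :
    Var[H' r; μ] ≤ 18 * V / δ ^ 2 +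
      2 * (∫ ω, H' (r + δ) ω ∂μ - ∫ ω, H' (r - δ) ω ∂μ) ^ 2 := by
  set d : ℝ → ℝ := fun r => ∫ ω, H' r ω ∂μ with hd
  set g : ℝ → ℝ := fun r => ∫ ω, H r ω ∂μ with hg
  have hI : ∀ r, Integrable (H r) μ := fun r => (hH r).integrable one_le_two
  have hI' : ∀ r, Integrable (H' r) μ := fun r => (hH' r).integrable one_le_two
  have htg : ∀ r r', g r + d r * (r' - r) ≤ g r' := by
    intro r r'
    have := integral_mono ((hI r).add ((hI' r).mul_const (r' - r))) (hI r') (htan r r')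
    rwa [integral_add' (hI r) ((hI' r).mul_const _), integral_mul_const] at this
  have hpt : ∀ ω, (H' r ω - d r) ^ 2 ≤ 6 / δ ^ 2 * ((H r ω - g r) ^ 2 +
      (H (r + δ) ω - g (r + δ)) ^ 2 + (H (r - δ) ω - g (r - δ)) ^ 2) +
      2 * (d (r + δ) - d (r - δ)) ^ 2 := by
    intro ω
    have a1 := htan r (r + δ) ω
    have a2 := htan r (r - δ) ω
    have b1 := htg (r + δ) r
    have b2 := htg (r - δ) r
    have b3 := htg r (r + δ)
    have b4 := htg r (r - δ)
    set x := H r ω - g r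
    set y := H (r + δ) ω - g (r + δ)
    set z := H (r - δ) ω - g (r - δ)
    set Δ := d (r + δ) - d (r - δ)
    have c1 : δ * (H' r ω - d r) ≤ y - x + δ * Δ := by
      simp only [x, y, Δ]; nlinarith
    have c2 : -(z - x + δ * Δ) ≤ δ * (H' r ω - d r) := by
      simp only [x, z, Δ]; nlinarith
    have c3 : |δ * (H' r ω - d r)| ≤ |x| + |y| + |z| + δ * Δ := by
      rw [abs_le]
      constructor
      · have := neg_abs_le x; have := le_abs_self z; have := abs_nonneg y; have := le_abs_self x
        linarith
      · have := neg_abs_le x; have := le_abs_self y; have := abs_nonneg z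
        linarith
    have c4 : (δ * (H' r ω - d r)) ^ 2 ≤ 6 * (x ^ 2 + y ^ 2 + z ^ 2) + 2 * (δ * Δ) ^ 2 := by
      rw [← sq_abs (δ * _)]
      refine (pow_le_pow_left₀ (abs_nonneg _) c3 2).trans ?_
      nlinarith [sq_nonneg (|x| - |y|), sq_nonneg (|x| - |z|), sq_nonneg (|y| - |z|),
        sq_nonneg (|x| + |y| + |z| - δ * Δ), sq_abs x, sq_abs y, sq_abs z]
    have hδ2 : 0 < δ ^ 2 := by positivity
    rw [← mul_le_mul_iff_right₀ hδ2]
    have : δ ^ 2 * (6 / δ ^ 2 * (x ^ 2 + y ^ 2 + z ^ 2) + 2 * Δ ^ 2) =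
        6 * (x ^ 2 + y ^ 2 + z ^ 2) + 2 * (δ * Δ) ^ 2 := by
      field_simp
    rw [this]
    linarith [mul_pow δ (H' r ω - d r) 2]
  have hsq : ∀ r, Integrable (fun ω => (H r ω - g r) ^ 2) μ := fun r =>
    ((hH r).sub (memLp_const (g r))).integrable_sq
  have hsq' : Integrable (fun ω => (H' r ω - d r) ^ 2) μ :=
    ((hH' r).sub (memLp_const (d r))).integrable_sq
  have hs2 : Integrable (fun ω => (H r ω - g r) ^ 2 +
      (H (r + δ) ω - g (r + δ)) ^ 2) μ := (hsq r).add (hsq (r + δ))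
  have hs3 : Integrable (fun ω => (H r ω - g r) ^ 2 +
      (H (r + δ) ω - g (r + δ)) ^ 2 + (H (r - δ) ω - g (r - δ)) ^ 2) μ := hs2.add (hsq (r - δ))
  have hint := integral_mono hsq' ((hs3.const_mul (6 / δ ^ 2)).add
    (integrable_const (2 * (d (r + δ) - d (r - δ)) ^ 2))) hpt
  rw [integral_add' (hs3.const_mul _) (integrable_const _), integral_const_mul,
    integral_add hs2 (hsq _), integral_add (hsq _) (hsq _)] at hint
  rw [variance_eq_integral (hH _).1.aemeasurable] at h0 h1 h2
  rw [variance_eq_integral (hH' _).1.aemeasurable]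
  simp only [integral_const, probReal_univ, smul_eq_mul, one_mul] at hint
  refine hint.trans ?_
  have h6 : 0 ≤ 6 / δ ^ 2 := by positivity
  have := mul_le_mul_of_nonneg_left (add_le_add (add_le_add h0 h1) h2) h6
  have e : 6 / δ ^ 2 * (V + V + V) = 18 * V / δ ^ 2 := by ring
  linarith

/-- If a random function has slopes `H'` in the sense of tangent lines from below, then small
fluctuations of the function force small fluctuations of the slopes, on average. -/
theorem lintegral_variance_slope_le (μ : Measure Ω) [IsProbabilityMeasure μ]
    {H H' : ℝ → Ω → ℝ} (htan : ∀ r r' ω, H r ω + H' r ω * (r' - r) ≤ H r' ω)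
    (hH : ∀ r, MemLp (H r) 2 μ) (hH' : ∀ r, MemLp (H' r) 2 μ) {a b δ V D : ℝ} (hab : a ≤ b)
    (hδ : 0 < δ) (hV : ∀ r ∈ Set.Icc (a - δ) (b + δ), Var[H r; μ] ≤ V)
    (hD : ∀ r ∈ Set.Icc (a - δ) (b + δ), |∫ ω, H' r ω ∂μ| ≤ D) :
    ∫⁻ r in Set.Icc a b, ENNReal.ofReal (Var[H' r; μ]) ≤
      ENNReal.ofReal (18 * V / δ ^ 2 * (b - a) + 16 * D ^ 2 * δ) := by
  set d : ℝ → ℝ := fun r => ∫ ω, H' r ω ∂μ with hd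
  have hI' : ∀ r, Integrable (H' r) μ := fun r => (hH' r).integrable one_le_two
  have hmono : Monotone d := by
    intro r r' hrr
    rcases hrr.eq_or_lt with rfl | hlt
    · exact le_rfl
    refine integral_mono (hI' r) (hI' r') fun ω => ?_
    have h1 := htan r r' ω
    have h2 := htan r' r ω
    have : (H' r ω - H' r' ω) * (r' - r) ≤ 0 := by linarith
    have h3 := nonpos_of_mul_nonpos_left this (sub_pos.2 hlt)
    linarith
  have hD0 : 0 ≤ D := (abs_nonneg _).trans (hD a ⟨by linarith, by linarith⟩)
  -- One of the two factors in the squared increment of the mean slope is replaced by its bound 2D,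
  -- so that the increment enters linearly and its integral telescopes.
  have hpt : ∀ r ∈ Set.Icc a b, Var[H' r; μ] ≤
      18 * V / δ ^ 2 + 4 * D * (d (r + δ) - d (r - δ)) := by
    intro r hr
    refine (variance_slope_le μ htan hH hH' hδ (hV r ⟨by linarith [hr.1], by linarith [hr.2]⟩)
      (hV _ ⟨by linarith [hr.1], by linarith [hr.2]⟩)
      (hV _ ⟨by linarith [hr.1], by linarith [hr.2]⟩)).trans ?_
    have h0 : 0 ≤ d (r + δ) - d (r - δ) := sub_nonneg.2 (hmono (by linarith))
    have h1 := (abs_le.1 (hD (r + δ) ⟨by linarith [hr.1], by linarith [hr.2]⟩)).2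
    have h2 := (abs_le.1 (hD (r - δ) ⟨by linarith [hr.1], by linarith [hr.2]⟩)).1
    have h3 : d (r + δ) - d (r - δ) ≤ 2 * D := by simp only [hd]; linarith
    have := mul_le_mul_of_nonneg_right h3 h0
    simp only [hd] at this ⊢
    nlinarith
  have hii : ∀ c, IntervalIntegrable (fun r => d (r + c)) volume a b := fun c =>
    Monotone.intervalIntegrable fun x y hxy => hmono (by linarith)
  have hii' : ∀ x y, IntervalIntegrable d volume x y := fun x y => hmono.intervalIntegrable
  have hiF : IntervalIntegrable (fun r => 18 * V / δ ^ 2 + 4 * D * (d (r + δ) - d (r - δ)))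
      volume a b := by
    refine intervalIntegrable_const.add ((IntervalIntegrable.sub (hii δ) ?_).const_mul _)
    simpa [sub_eq_add_neg] using hii (-δ)
  have hF0 : ∀ r ∈ Set.Icc a b, 0 ≤ 18 * V / δ ^ 2 + 4 * D * (d (r + δ) - d (r - δ)) :=
    fun r hr => (variance_nonneg _ _).trans (hpt r hr)
  -- With the integral in `ENNReal`, no measurability of the variance as a function of r is needed:
  -- it is dominated by an expression built from monotone functions.
  calc ∫⁻ r in Set.Icc a b, ENNReal.ofReal (Var[H' r; μ])
      ≤ ∫⁻ r in Set.Icc a b, ENNReal.ofReal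
          (18 * V / δ ^ 2 + 4 * D * (d (r + δ) - d (r - δ))) :=
        setLIntegral_mono' measurableSet_Icc fun r hr => ENNReal.ofReal_le_ofReal (hpt r hr)
    _ = ENNReal.ofReal (∫ r in Set.Icc a b,
          (18 * V / δ ^ 2 + 4 * D * (d (r + δ) - d (r - δ)))) := by
        rw [ofReal_integral_eq_lintegral_ofReal]
        · exact (intervalIntegrable_iff_integrableOn_Icc_of_le hab).1 hiF
        · exact (ae_restrict_iff' measurableSet_Icc).2 (Filter.Eventually.of_forall hF0)
    _ ≤ _ := by
        refine ENNReal.ofReal_le_ofReal ?_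
        rw [integral_Icc_eq_integral_Ioc, ← intervalIntegral.integral_of_le hab,
          intervalIntegral.integral_add intervalIntegrable_const
            ((IntervalIntegrable.sub (hii δ) (by simpa [sub_eq_add_neg] using hii (-δ))).const_mul _),
          intervalIntegral.integral_const_mul, intervalIntegral.integral_sub (hii δ)
            (by simpa [sub_eq_add_neg] using hii (-δ)),
          intervalIntegral.integral_comp_add_right, intervalIntegral.integral_comp_sub_right,
          intervalIntegral.integral_interval_sub_interval_comm' (hii' _ _) (hii' _ _) (hii' _ _),
          intervalIntegral.integral_const]
        -- After telescoping, only windows of length 2δ around the two endpoints remain. They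
        -- contribute 4Dδ, and the prefactor 4D turns this into 16 D²δ.
        have hloc : ∀ c ∈ Set.Icc a b, |∫ x in (c - δ)..(c + δ), d x| ≤ D * |c + δ - (c - δ)| := by
          intro c hc
          refine intervalIntegral.norm_integral_le_of_norm_le_const (f := d) (fun x hx => ?_)
          rw [Set.uIoc_of_le (by linarith)] at hx
          exact hD x ⟨by linarith [hx.1, hc.1], by linarith [hx.2, hc.2]⟩
        have e1 := hloc b ⟨hab, le_rfl⟩
        have e2 := hloc a ⟨le_rfl, hab⟩
        rw [abs_of_nonneg (a := b + δ - (b - δ)) (by linarith)] at e1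
        rw [abs_of_nonneg (a := a + δ - (a - δ)) (by linarith)] at e2
        have e3 : (∫ x in (b - δ)..(b + δ), d x) - ∫ x in (a - δ)..(a + δ), d x ≤ 4 * D * δ := by
          have := (abs_le.1 e1).2
          have := (abs_le.1 e2).1
          nlinarith
        have e4 := mul_le_mul_of_nonneg_left e3 (by positivity : 0 ≤ 4 * D)
        have e5 : ∫ x in (b + δ)..(b - δ), d x = - ∫ x in (b - δ)..(b + δ), d x :=
          intervalIntegral.integral_symm _ _
        have e6 : ∫ x in (a + δ)..(a - δ), d x = - ∫ x in (a - δ)..(a + δ), d x :=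
          intervalIntegral.integral_symm _ _
        simp only [e5, e6, smul_eq_mul] at *
        nlinarith

end Convexity

/-! ### The law of the noise field depends only on its covariance. -/

section Law

theorem integral_exp_sum_stdGauss {κ : Type*} [Fintype κ] (c : κ → ℝ) :
    ∫ z, Complex.exp (((∑ k, c k * z k : ℝ) : ℂ) * Complex.I) ∂(stdGauss κ) =
      Complex.exp (-(∑ k, (c k : ℂ) ^ 2) / 2) := by
  have : ∀ z : κ → ℝ, Complex.exp (((∑ k, c k * z k : ℝ) : ℂ) * Complex.I) =
      ∏ k, Complex.exp ((c k : ℂ) * (z k : ℂ) * Complex.I) := by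
    intro z
    rw [← Complex.exp_sum]
    push_cast
    rw [Finset.sum_mul]
  simp_rw [this]
  rw [integral_fintype_prod_eq_prod (fun k (x : ℝ) => Complex.exp ((c k : ℂ) * (x : ℂ) * Complex.I)),
    ← Finset.sum_neg_distrib, Finset.sum_div, Complex.exp_sum]
  refine Finset.prod_congr rfl fun k _ => ?_
  rw [← charFun_apply_real, charFun_gaussianReal]
  congr 1
  push_cast
  ring

theorem strongDual_prod_pi_apply {ι J L : Type*} [Fintype ι] [Fintype J] [Fintype L]
    [DecidableEq ι] [DecidableEq J] [DecidableEq L]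
    (ℓ : StrongDual ℝ ((ι → ℝ) × (J → L → ℝ))) (z : ι → ℝ) (w : J → L → ℝ) :
    ℓ (z, w) = ∑ i, ℓ (Pi.single i 1, 0) * z i +
      ∑ j, ∑ l, ℓ (0, Pi.single j (Pi.single l 1)) * w j l := by
  have h1 : z = ∑ i, z i • (Pi.single i (1 : ℝ) : ι → ℝ) := by
    ext; simp [Pi.single_apply]
  have h2 : w = ∑ j, ∑ l, w j l • (Pi.single j (Pi.single l (1 : ℝ)) : J → L → ℝ) := by
    ext j l
    simp [Finset.sum_apply, Pi.single_apply, ite_apply]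
  have h3 : (z, w) = ∑ i, z i • ((Pi.single i (1 : ℝ) : ι → ℝ), (0 : J → L → ℝ)) +
      ∑ j, ∑ l, w j l • ((0 : ι → ℝ), (Pi.single j (Pi.single l (1 : ℝ)) : J → L → ℝ)) := by
    refine Prod.ext ?_ ?_
    · simp only [Prod.fst_add, Prod.fst_sum, Prod.smul_fst, smul_zero, Finset.sum_const_zero,
        add_zero]
      exact h1
    · simp only [Prod.snd_add, Prod.snd_sum, Prod.smul_snd, smul_zero, Finset.sum_const_zero,
        zero_add]
      exact h2
  rw [h3]
  simp only [map_add, map_sum, map_smul, smul_eq_mul]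
  simp [mul_comm]

/-- The noise of a block of channels, seen only through the linear field that it induces, depends
on the gains only through the covariance of the field. -/
theorem map_noise_eq {ι J L : Type*} [Fintype ι] [Fintype J] [Fintype L]
    (A S : Matrix L L ℝ) (v : L → ℝ)
    (h : ∀ y : L → ℝ, (∑ k, (∑ l, A l k * y l) ^ 2) + (∑ l, v l * y l) ^ 2 =
      ∑ k, (∑ l, S l k * y l) ^ 2) :
    (stdGauss ((ι ⊕ J × L) ⊕ J)).map (fun z => ((fun i => z (.inl (.inl i)),
        fun j l => (∑ k, A l k * z (.inl (.inr (j, k)))) + v l * z (.inr j)) :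
          (ι → ℝ) × (J → L → ℝ))) =
      ((stdGauss ι).prod (Measure.pi fun _ : J => stdGauss L)).map
        (fun q => (q.1, fun j l => ∑ k, S l k * q.2 j k)) := by
  classical
  have hm1 : Measurable (fun z : (ι ⊕ J × L) ⊕ J → ℝ => ((fun i => z (.inl (.inl i)),
        fun j l => (∑ k, A l k * z (.inl (.inr (j, k)))) + v l * z (.inr j)) :
          (ι → ℝ) × (J → L → ℝ))) := by fun_prop
  have hm2 : Measurable (fun q : (ι → ℝ) × (J → L → ℝ) =>
      ((q.1, fun j l => ∑ k, S l k * q.2 j k) : (ι → ℝ) × (J → L → ℝ))) := by fun_prop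
  have := Measure.isProbabilityMeasure_map (μ := stdGauss ((ι ⊕ J × L) ⊕ J)) hm1.aemeasurable
  have := Measure.isProbabilityMeasure_map
    (μ := (stdGauss ι).prod (Measure.pi fun _ : J => stdGauss L)) hm2.aemeasurable
  -- Both measures are linear images of standard Gaussians, so their characteristic functions
  -- involve only the variance of each linear functional; `h` equates these variances.
  refine Measure.ext_of_charFunDual ?_
  ext ℓ
  rw [charFunDual_apply, charFunDual_apply, integral_map hm1.aemeasurable (by fun_prop),
    integral_map hm2.aemeasurable (by fun_prop)]
  obtain ⟨a, b, hab⟩ : ∃ (a : ι → ℝ) (b : J → L → ℝ), ∀ z w,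
      ℓ (z, w) = ∑ i, a i * z i + ∑ j, ∑ l, b j l * w j l :=
    ⟨_, _, strongDual_prod_pi_apply ℓ⟩
  -- The functional ℓ pulled back to the independent coordinates of the left-hand noise.
  let c : (ι ⊕ J × L) ⊕ J → ℝ := Sum.elim (Sum.elim a fun p => ∑ l, A l p.2 * b p.1 l)
    fun j => ∑ l, v l * b j l
  have hc : ∀ z : (ι ⊕ J × L) ⊕ J → ℝ, ∑ i, a i * z (.inl (.inl i)) + ∑ j, ∑ l, b j l *
      ((∑ k, A l k * z (.inl (.inr (j, k)))) + v l * z (.inr j)) = ∑ k, c k * z k := by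
    intro z
    simp only [Fintype.sum_sum_type, Fintype.sum_prod_type, c, Sum.elim_inl, Sum.elim_inr, mul_add,
      Finset.sum_add_distrib, add_assoc]
    congr 2
    · refine Finset.sum_congr rfl fun j _ => ?_
      simp only [Finset.mul_sum, Finset.sum_mul]
      rw [Finset.sum_comm]
      refine Finset.sum_congr rfl fun k _ => Finset.sum_congr rfl fun l _ => by ring
    · refine Finset.sum_congr rfl fun j _ => ?_
      rw [Finset.sum_mul]
      refine Finset.sum_congr rfl fun l _ => by ring
  have hd : ∀ q : (ι → ℝ) × (J → L → ℝ), Complex.exp (((∑ i, a i * q.1 i + ∑ j, ∑ l, b j l *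
      (∑ k, S l k * q.2 j k) : ℝ) : ℂ) * Complex.I) =
      Complex.exp (((∑ i, a i * q.1 i : ℝ) : ℂ) * Complex.I) * ∏ j,
        Complex.exp (((∑ k, (∑ l, S l k * b j l) * q.2 j k : ℝ) : ℂ) * Complex.I) := by
    intro q
    rw [← Complex.exp_sum, ← Complex.exp_add, ← Finset.sum_mul, ← add_mul, ← Complex.ofReal_sum,
      ← Complex.ofReal_add]
    congr 4
    refine Finset.sum_congr rfl fun j _ => ?_
    simp only [Finset.mul_sum, Finset.sum_mul]
    rw [Finset.sum_comm]
    refine Finset.sum_congr rfl fun k _ => Finset.sum_congr rfl fun l _ => by ring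
  simp_rw [hab, hc, hd]
  rw [integral_exp_sum_stdGauss, integral_prod_mul
      (fun z : ι → ℝ => Complex.exp (((∑ i, a i * z i : ℝ) : ℂ) * Complex.I))
      (fun w : J → L → ℝ => ∏ j,
        Complex.exp (((∑ k, (∑ l, S l k * b j l) * w j k : ℝ) : ℂ) * Complex.I)),
    integral_exp_sum_stdGauss,
    integral_fintype_prod_eq_prod (fun j (w : L → ℝ) =>
      Complex.exp (((∑ k, (∑ l, S l k * b j l) * w k : ℝ) : ℂ) * Complex.I))]
  simp_rw [integral_exp_sum_stdGauss]
  rw [← Complex.exp_sum, ← Complex.exp_add]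
  congr 1
  have key : ∑ k, c k ^ 2 = ∑ i, a i ^ 2 + ∑ j, ∑ k, (∑ l, S l k * b j l) ^ 2 := by
    simp only [Fintype.sum_sum_type, Fintype.sum_prod_type, c, Sum.elim_inl, Sum.elim_inr,
      ← h, Finset.sum_add_distrib, add_assoc]
  have key' : ∑ k, (c k : ℂ) ^ 2 = ∑ i, (a i : ℂ) ^ 2 +
      ∑ j, ∑ k, ((∑ l, S l k * b j l : ℝ) : ℂ) ^ 2 := by exact_mod_cast key
  rw [key', ← Finset.sum_div, Finset.sum_neg_distrib]
  ring

end Law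

end TensorOverlap

namespace TensorOverlap

/-! ### Calculus of bounded measurable functions. -/

section BddMeas

variable {α β : Type*} [MeasurableSpace α] [MeasurableSpace β]

/-- Bounded measurable real functions. -/
def BddMeas (g : α → ℝ) : Prop := Measurable g ∧ ∃ C, ∀ x, |g x| ≤ C

theorem BddMeas.const (c : ℝ) : BddMeas fun _ : α => c := ⟨measurable_const, |c|, fun _ => le_rfl⟩

theorem BddMeas.add {f g : α → ℝ} (hf : BddMeas f) (hg : BddMeas g) :
    BddMeas fun x => f x + g x := by
  obtain ⟨hf, C, hC⟩ := hf
  obtain ⟨hg, D, hD⟩ := hg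
  exact ⟨hf.add hg, C + D, fun x => (abs_add_le _ _).trans (add_le_add (hC x) (hD x))⟩

theorem BddMeas.mul {f g : α → ℝ} (hf : BddMeas f) (hg : BddMeas g) :
    BddMeas fun x => f x * g x := by
  obtain ⟨hf, C, hC⟩ := hf
  obtain ⟨hg, D, hD⟩ := hg
  refine ⟨hf.mul hg, C * D, fun x => ?_⟩
  rw [abs_mul]
  exact mul_le_mul (hC x) (hD x) (abs_nonneg _) ((abs_nonneg _).trans (hC x))

theorem BddMeas.const_mul {f : α → ℝ} (hf : BddMeas f) (c : ℝ) : BddMeas fun x => c * f x :=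
  (BddMeas.const c).mul hf

theorem BddMeas.neg {f : α → ℝ} (hf : BddMeas f) : BddMeas fun x => -f x := by
  simpa using hf.const_mul (-1)

theorem BddMeas.sub {f g : α → ℝ} (hf : BddMeas f) (hg : BddMeas g) :
    BddMeas fun x => f x - g x := by
  simpa [sub_eq_add_neg] using hf.add hg.neg

theorem BddMeas.pow {f : α → ℝ} (hf : BddMeas f) (n : ℕ) : BddMeas fun x => f x ^ n := by
  obtain ⟨hf, C, hC⟩ := hf
  refine ⟨hf.pow_const n, C ^ n, fun x => ?_⟩
  rw [abs_pow]
  exact pow_le_pow_left₀ (abs_nonneg _) (hC x) n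

theorem BddMeas.div_const {f : α → ℝ} (hf : BddMeas f) (c : ℝ) : BddMeas fun x => f x / c := by
  simpa [div_eq_mul_inv] using hf.mul (BddMeas.const c⁻¹)

theorem BddMeas.sum {ι : Type*} {s : Finset ι} {f : ι → α → ℝ} (hf : ∀ i, BddMeas (f i)) :
    BddMeas fun x => ∑ i ∈ s, f i x := by
  classical
  induction s using Finset.induction_on with
  | empty => simpa using BddMeas.const 0
  | insert a s ha ih => simpa [Finset.sum_insert ha] using (hf a).add ih

theorem BddMeas.comp {f : β → ℝ} (hf : BddMeas f) {g : α → β} (hg : Measurable g) :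
    BddMeas fun x => f (g x) := by
  obtain ⟨hf, C, hC⟩ := hf
  exact ⟨hf.comp hg, C, fun x => hC _⟩

theorem BddMeas.exp {f : α → ℝ} (hf : BddMeas f) : BddMeas fun x => Real.exp (f x) := by
  obtain ⟨hf, C, hC⟩ := hf
  refine ⟨hf.exp, Real.exp C, fun x => ?_⟩
  rw [abs_of_pos (Real.exp_pos _)]
  exact Real.exp_le_exp.2 ((le_abs_self _).trans (hC x))

theorem BddMeas.integrable {f : α → ℝ} (hf : BddMeas f) (μ : Measure α) [IsFiniteMeasure μ] :
    Integrable f μ := by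
  obtain ⟨hf, C, hC⟩ := hf
  exact (integrable_const C).mono' hf.aestronglyMeasurable (Filter.Eventually.of_forall hC)

theorem BddMeas.memLp {f : α → ℝ} (hf : BddMeas f) (μ : Measure α) [IsFiniteMeasure μ] :
    MemLp f 2 μ := by
  obtain ⟨hf, C, hC⟩ := hf
  exact MemLp.of_bound hf.aestronglyMeasurable C (Filter.Eventually.of_forall hC)

theorem BddMeas.mul_integrable {f g : α → ℝ} (hf : BddMeas f) {μ : Measure α}
    (hg : Integrable g μ) : Integrable (fun x => f x * g x) μ := by
  obtain ⟨hf, C, hC⟩ := hf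
  exact hg.bdd_mul (c := C) hf.aestronglyMeasurable (Filter.Eventually.of_forall hC)

theorem BddMeas.mul_memLp {f g : α → ℝ} (hf : BddMeas f) {μ : Measure α}
    (hg : MemLp g 2 μ) : MemLp (fun x => f x * g x) 2 μ := by
  obtain ⟨hf, C, hC⟩ := hf
  refine hg.of_le_mul (c := C) (hf.aestronglyMeasurable.mul hg.1)
    (Filter.Eventually.of_forall fun x => ?_)
  rw [norm_mul]
  exact mul_le_mul_of_nonneg_right (hC x) (norm_nonneg _)

end BddMeas

/-! ### Gibbs means as integrals against tilted measures. -/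

section GibbsMean

variable {α β : Type*} [MeasurableSpace α] [MeasurableSpace β] (μ : Measure α)

/-- The mean of `g` under the probability measure with density proportional to `exp E`. -/
noncomputable def gibbsMean (E g : α → ℝ) : ℝ :=
  (∫ x, g x * Real.exp (E x) ∂μ) / ∫ x, Real.exp (E x) ∂μ

variable {μ} {E : α → ℝ}

/-- Linearity, Jensen and nonnegativity of variances carry over to the quotient once it is an
integral against a probability measure. -/
theorem gibbsMean_eq_integral_tilted (g : α → ℝ) :
    gibbsMean μ E g = ∫ x, g x ∂(μ.tilted E) := by
  rw [integral_tilted, gibbsMean, ← integral_div]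
  refine integral_congr_ae (Filter.Eventually.of_forall fun x => ?_)
  simp only [smul_eq_mul]
  ring

variable [IsProbabilityMeasure μ]

theorem integral_exp_pos (hE : BddMeas E) : 0 < ∫ x, Real.exp (E x) ∂μ :=
  _root_.MeasureTheory.integral_exp_pos (hE.exp.integrable μ)

theorem isProbabilityMeasure_tilted_of_bddMeas (hE : BddMeas E) :
    IsProbabilityMeasure (μ.tilted E) := isProbabilityMeasure_tilted (hE.exp.integrable μ)

theorem gibbsMean_add (hE : BddMeas E) {f g : α → ℝ} (hf : BddMeas f) (hg : BddMeas g) :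
    gibbsMean μ E (fun x => f x + g x) = gibbsMean μ E f + gibbsMean μ E g := by
  have := isProbabilityMeasure_tilted_of_bddMeas (μ := μ) hE
  simp only [gibbsMean_eq_integral_tilted]
  exact integral_add (hf.integrable _) (hg.integrable _)

theorem gibbsMean_sub (hE : BddMeas E) {f g : α → ℝ} (hf : BddMeas f) (hg : BddMeas g) :
    gibbsMean μ E (fun x => f x - g x) = gibbsMean μ E f - gibbsMean μ E g := by
  have := isProbabilityMeasure_tilted_of_bddMeas (μ := μ) hE
  simp only [gibbsMean_eq_integral_tilted]
  exact integral_sub (hf.integrable _) (hg.integrable _)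

omit [IsProbabilityMeasure μ] in
theorem gibbsMean_const_mul (c : ℝ) (g : α → ℝ) :
    gibbsMean μ E (fun x => c * g x) = c * gibbsMean μ E g := by
  simp only [gibbsMean_eq_integral_tilted]
  exact integral_const_mul c _

theorem gibbsMean_sum (hE : BddMeas E) {ι : Type*} (s : Finset ι) {f : ι → α → ℝ}
    (hf : ∀ i, BddMeas (f i)) :
    gibbsMean μ E (fun x => ∑ i ∈ s, f i x) = ∑ i ∈ s, gibbsMean μ E (f i) := by
  have := isProbabilityMeasure_tilted_of_bddMeas (μ := μ) hE
  simp only [gibbsMean_eq_integral_tilted]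
  exact integral_finsetSum _ fun i _ => (hf i).integrable _

theorem gibbsMean_const (hE : BddMeas E) (c : ℝ) : gibbsMean μ E (fun _ => c) = c := by
  have := isProbabilityMeasure_tilted_of_bddMeas (μ := μ) hE
  simp [gibbsMean_eq_integral_tilted]

theorem abs_gibbsMean_le (hE : BddMeas E) {g : α → ℝ} {C : ℝ} (hC : ∀ x, |g x| ≤ C) :
    |gibbsMean μ E g| ≤ C := by
  have := isProbabilityMeasure_tilted_of_bddMeas (μ := μ) hE
  rw [gibbsMean_eq_integral_tilted]
  have := norm_integral_le_of_norm_le_const (μ := μ.tilted E) (f := g) (C := C)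
    (Filter.Eventually.of_forall hC)
  simpa using this

theorem gibbsMean_mono (hE : BddMeas E) {f g : α → ℝ} (hf : BddMeas f) (hg : BddMeas g)
    (h : ∀ x, f x ≤ g x) : gibbsMean μ E f ≤ gibbsMean μ E g := by
  have := isProbabilityMeasure_tilted_of_bddMeas (μ := μ) hE
  simp only [gibbsMean_eq_integral_tilted]
  exact integral_mono (hf.integrable _) (hg.integrable _) h

theorem sq_gibbsMean_le (hE : BddMeas E) {g : α → ℝ} (hg : BddMeas g) :
    gibbsMean μ E g ^ 2 ≤ gibbsMean μ E fun x => g x ^ 2 := by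
  have := isProbabilityMeasure_tilted_of_bddMeas (μ := μ) hE
  have h := variance_nonneg g (μ.tilted E)
  rw [variance_eq_sub (hg.memLp _)] at h
  simp only [gibbsMean_eq_integral_tilted]
  simpa using h

/-- Tangent line inequality for the logarithm of an exponential integral. -/
theorem log_integral_exp_add_gibbsMean_le {E' g : α → ℝ} (hE : BddMeas E) (hE' : BddMeas E')
    (hg : BddMeas g) (h : ∀ x, E x + g x ≤ E' x) :
    Real.log (∫ x, Real.exp (E x) ∂μ) + gibbsMean μ E g ≤ Real.log (∫ x, Real.exp (E' x) ∂μ) := by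
  have hZ := integral_exp_pos (μ := μ) hE
  -- Jensen under the Gibbs measure. Multiplied by the partition function, the Gibbs mean of exp g
  -- is the integral of exp (E + g), hence at most that of exp E'.
  have h1 : Real.exp (gibbsMean μ E g) ≤ gibbsMean μ E (fun x => Real.exp (g x)) := by
    have := isProbabilityMeasure_tilted_of_bddMeas (μ := μ) hE
    simp only [gibbsMean_eq_integral_tilted]
    exact convexOn_exp.map_integral_le (g := Real.exp) (s := Set.univ)
      Real.continuous_exp.continuousOn isClosed_univ (Filter.Eventually.of_forall fun _ => trivial)
      (hg.integrable _) (hg.exp.integrable _)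
  have h2 : gibbsMean μ E (fun x => Real.exp (g x)) * ∫ x, Real.exp (E x) ∂μ ≤
      ∫ x, Real.exp (E' x) ∂μ := by
    rw [gibbsMean, div_mul_cancel₀ _ hZ.ne']
    refine integral_mono ((hg.exp.mul hE.exp).integrable μ) (hE'.exp.integrable μ) fun x => ?_
    simp only []
    rw [← Real.exp_add]
    exact Real.exp_le_exp.2 (by linarith [h x])
  rw [← Real.log_exp (gibbsMean μ E g), ← Real.log_mul hZ.ne' (Real.exp_pos _).ne']
  refine Real.log_le_log (mul_pos hZ (Real.exp_pos _)) (le_trans ?_ h2)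
  rw [mul_comm]
  exact mul_le_mul_of_nonneg_right h1 hZ.le

/-- Derivative of a Gibbs mean along a quadratic family of exponents. -/
theorem hasDerivAt_gibbsMean {A b c g : α → ℝ} (hA : BddMeas A) (hb : BddMeas b) (hc : BddMeas c)
    (hg : BddMeas g) (s : ℝ) :
    HasDerivAt (fun s => gibbsMean μ (fun x => A x + s * b x + s ^ 2 * c x) g)
      (gibbsMean μ (fun x => A x + s * b x + s ^ 2 * c x) (fun x => g x * (b x + 2 * s * c x)) -
        gibbsMean μ (fun x => A x + s * b x + s ^ 2 * c x) g *
        gibbsMean μ (fun x => A x + s * b x + s ^ 2 * c x) (fun x => b x + 2 * s * c x)) s := by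
  have hE : ∀ s : ℝ, BddMeas fun x => A x + s * b x + s ^ 2 * c x := fun s =>
    (hA.add (hb.const_mul s)).add (hc.const_mul _)
  -- Numerator and denominator are differentiated together, the denominator being the case f = 1.
  -- Domination is uniform on the unit ball around s.
  have main : ∀ f : α → ℝ, BddMeas f →
      HasDerivAt (fun s => ∫ x, f x * Real.exp (A x + s * b x + s ^ 2 * c x) ∂μ)
        (∫ x, f x * (b x + 2 * s * c x) * Real.exp (A x + s * b x + s ^ 2 * c x) ∂μ) s := by
    intro f hf
    obtain ⟨Ca, hCa⟩ := hA.2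
    obtain ⟨Cb, hCb⟩ := hb.2
    obtain ⟨Cc, hCc⟩ := hc.2
    obtain ⟨Cf, hCf⟩ := hf.2
    have hd : ∀ x r, HasDerivAt (fun s => f x * Real.exp (A x + s * b x + s ^ 2 * c x))
        (f x * (b x + 2 * r * c x) * Real.exp (A x + r * b x + r ^ 2 * c x)) r := by
      intro x r
      have h1 : HasDerivAt (fun s : ℝ => A x + s * b x + s ^ 2 * c x) (b x + 2 * r * c x) r := by
        have := (((hasDerivAt_id r).mul_const (b x)).const_add (A x)).add
          (((hasDerivAt_id r).pow 2).mul_const (c x))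
        refine this.congr_deriv ?_
        simp
      refine (h1.exp.const_mul (f x)).congr_deriv ?_
      ring
    refine (hasDerivAt_integral_of_dominated_loc_of_deriv_le
      (bound := fun _ => Cf * (Cb + 2 * (|s| + 1) * Cc) *
        Real.exp (Ca + (|s| + 1) * Cb + (|s| + 1) ^ 2 * Cc))
      (Metric.ball_mem_nhds s one_pos) (Filter.Eventually.of_forall fun r =>
        (hf.mul (hE r).exp).1.aestronglyMeasurable) ((hf.mul (hE s).exp).integrable μ)
      ((hf.mul (hb.add (hc.const_mul (2 * s)))).mul (hE s).exp).1.aestronglyMeasurable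
      (Filter.Eventually.of_forall fun x r hr => ?_) (integrable_const _)
      (Filter.Eventually.of_forall fun x r _ => hd x r)).2
    have hr' : |r| ≤ |s| + 1 := by
      have : |r - s| < 1 := by simpa [Real.dist_eq] using hr
      have h2 := abs_sub_abs_le_abs_sub r s
      linarith
    have hCb0 : 0 ≤ Cb := (abs_nonneg _).trans (hCb x)
    have hCc0 : 0 ≤ Cc := (abs_nonneg _).trans (hCc x)
    have hCf0 : 0 ≤ Cf := (abs_nonneg _).trans (hCf x)
    rw [Real.norm_eq_abs, abs_mul, abs_mul, abs_of_pos (Real.exp_pos _)]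
    have e1 : |b x + 2 * r * c x| ≤ Cb + 2 * (|s| + 1) * Cc := by
      refine (abs_add_le _ _).trans (add_le_add (hCb x) ?_)
      rw [abs_mul, abs_mul, abs_two]
      gcongr
      exact hCc x
    have e2 : A x + r * b x + r ^ 2 * c x ≤ Ca + (|s| + 1) * Cb + (|s| + 1) ^ 2 * Cc := by
      refine add_le_add (add_le_add ((le_abs_self _).trans (hCa x)) ?_) ?_
      · refine (le_abs_self _).trans ?_
        rw [abs_mul]
        exact mul_le_mul hr' (hCb x) (abs_nonneg _) (by positivity)
      · refine (le_abs_self _).trans ?_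
        rw [abs_mul, abs_pow]
        exact mul_le_mul (pow_le_pow_left₀ (abs_nonneg _) hr' 2) (hCc x) (abs_nonneg _)
          (by positivity)
    exact mul_le_mul (mul_le_mul (hCf x) e1 (abs_nonneg _) hCf0) (Real.exp_le_exp.2 e2)
      (Real.exp_pos _).le (by positivity)
  have hn := main g hg
  have hdn := main (fun _ => 1) (BddMeas.const 1)
  simp only [one_mul] at hdn
  have hZ := integral_exp_pos (μ := μ) (hE s)
  have quot : ∀ a b c d : ℝ, d ≠ 0 → (a * d - b * c) / d ^ 2 = a / d - b / d * (c / d) := by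
    intro a b c d hd
    field_simp
  exact (hn.fun_div hdn hZ.ne').congr_deriv (quot _ _ _ _ hZ.ne')

theorem measurable_gibbsMean {E g : β → α → ℝ} (hE : Measurable (Function.uncurry E))
    (hg : Measurable (Function.uncurry g)) : Measurable fun y => gibbsMean μ (E y) (g y) := by
  refine Measurable.div ?_ ?_
  · exact ((hg.mul hE.exp).stronglyMeasurable.integral_prod_right (ν := μ)).measurable
  · exact (hE.exp.stronglyMeasurable.integral_prod_right (ν := μ)).measurable

theorem bddMeas_gibbsMean {E g : β → α → ℝ} (hE : Measurable (Function.uncurry E))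
    (hEb : ∀ y, BddMeas (E y)) (hg : BddMeas (Function.uncurry g)) :
    BddMeas fun y => gibbsMean μ (E y) (g y) := by
  obtain ⟨hg, C, hC⟩ := hg
  exact ⟨measurable_gibbsMean hE hg, C, fun y => abs_gibbsMean_le (hEb y) fun x => hC (y, x)⟩

end GibbsMean

end TensorOverlap

namespace TensorOverlap

/-! ### Gaussian channels: posterior means, Nishimori identity, integration by parts. -/

section Channel

variable {α κ : Type*} [MeasurableSpace α] [Fintype κ]

/-- Log-likelihood ratio of the observation `y` of a Gaussian channel `x ↦ Φ x + noise`. -/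
noncomputable def logLik (Φ : α → κ → ℝ) (y : κ → ℝ) (x : α) : ℝ := ∑ i, (y i * Φ x i - Φ x i ^ 2 / 2)

/-- Posterior mean of `g` given the observation `y`. -/
noncomputable def post (μ : Measure α) (Φ : α → κ → ℝ) (y : κ → ℝ) (g : α → ℝ) : ℝ :=
  gibbsMean μ (logLik Φ y) g

/-- Posterior covariance. -/
noncomputable def postCov (μ : Measure α) (Φ : α → κ → ℝ) (y : κ → ℝ) (f g : α → ℝ) : ℝ :=
  post μ Φ y (fun x => f x * g x) - post μ Φ y f * post μ Φ y g

variable {μ : Measure α} {Φ : α → κ → ℝ}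

theorem bddMeas_logLik (hΦ : ∀ i, BddMeas fun x => Φ x i) (y : κ → ℝ) : BddMeas (logLik Φ y) :=
  BddMeas.sum fun i => ((hΦ i).const_mul (y i)).sub (((hΦ i).pow 2).div_const 2)

theorem measurable_logLik (hΦ : ∀ i, BddMeas fun x => Φ x i) :
    Measurable (Function.uncurry (logLik Φ)) := by
  refine Finset.measurable_fun_sum _ fun i _ => ?_
  have h : Measurable fun p : (κ → ℝ) × α => Φ p.2 i := (hΦ i).1.comp measurable_snd
  have h2 : Measurable fun p : (κ → ℝ) × α => p.1 i := (measurable_pi_apply i).comp measurable_fst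
  exact (h2.mul h).sub ((h.pow_const 2).div_const 2)

variable [IsProbabilityMeasure μ]

theorem bddMeas_post (hΦ : ∀ i, BddMeas fun x => Φ x i) {g : α → ℝ} (hg : BddMeas g) :
    BddMeas fun y => post μ Φ y g :=
  bddMeas_gibbsMean (measurable_logLik hΦ) (bddMeas_logLik hΦ)
    (hg.comp (measurable_snd (α := κ → ℝ) (β := α)))

theorem bddMeas_postCov (hΦ : ∀ i, BddMeas fun x => Φ x i) {f g : α → ℝ} (hf : BddMeas f)
    (hg : BddMeas g) : BddMeas fun y => postCov μ Φ y f g :=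
  (bddMeas_post hΦ (hf.mul hg)).sub ((bddMeas_post hΦ hf).mul (bddMeas_post hΦ hg))

/-- The exponent is affine in `y i` with coefficient `Φ x i`, so differentiation produces a
posterior covariance. It is a quadratic family without quadratic term. -/
theorem hasDerivAt_post [DecidableEq κ] (hΦ : ∀ i, BddMeas fun x => Φ x i) {g : α → ℝ} (hg : BddMeas g) (y : κ → ℝ)
    (i : κ) :
    HasDerivAt (fun a => post μ Φ (Function.update y i a) g)
      (postCov μ Φ y g fun x => Φ x i) (y i) := by
  have key : ∀ a : ℝ, logLik Φ (Function.update y i a) =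
      fun x => (logLik Φ y x - y i * Φ x i) + a * Φ x i + a ^ 2 * 0 := by
    intro a
    ext x
    have : logLik Φ (Function.update y i a) x - logLik Φ y x = (a - y i) * Φ x i := by
      rw [logLik, logLik, ← Finset.sum_sub_distrib, Finset.sum_eq_single i]
      · simp; ring
      · intro j _ hj
        simp [Function.update_of_ne hj]
      · simp
    linarith
  have h := hasDerivAt_gibbsMean (μ := μ) ((bddMeas_logLik hΦ y).sub ((hΦ i).const_mul (y i))) (hΦ i)
    (BddMeas.const 0) hg (y i)
  have key' := key (y i)
  rw [Function.update_eq_self] at key'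
  refine (h.congr_deriv ?_).congr_of_eventuallyEq (Filter.Eventually.of_forall fun a => ?_)
  · rw [← key']
    simp [post, postCov]
  · simp only [post, key]

/-- The joint law of the signal and the noise. -/
noncomputable abbrev chanLaw (μ : Measure α) (κ : Type*) [Fintype κ] : Measure (α × (κ → ℝ)) :=
  μ.prod (stdGauss κ)

/-- The observation. -/
def obs (Φ : α → κ → ℝ) (p : α × (κ → ℝ)) : κ → ℝ := Φ p.1 + p.2

omit [Fintype κ] in
theorem measurable_obs (hΦ : ∀ i, BddMeas fun x => Φ x i) : Measurable (obs Φ) :=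
  measurable_pi_iff.2 fun i => ((hΦ i).1.comp measurable_fst).add
    ((measurable_pi_apply i).comp measurable_snd)

omit [Fintype κ] in
theorem BddMeas.obs {F : (κ → ℝ) → ℝ} (hF : BddMeas F) (hΦ : ∀ i, BddMeas fun x => Φ x i) :
    BddMeas fun p => F (obs Φ p) := hF.comp (measurable_obs hΦ)

omit [Fintype κ] in
theorem BddMeas.signal {f : α → ℝ} (hf : BddMeas f) :
    BddMeas fun p : α × (κ → ℝ) => f p.1 := hf.comp measurable_fst

theorem memLp_noise (j : κ) : MemLp (fun p : α × (κ → ℝ) => p.2 j) 2 (chanLaw μ κ) :=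
  (memLp_coord_stdGauss j).comp_snd μ

theorem integrable_noise_mul {G : α × (κ → ℝ) → ℝ} (hG : BddMeas G) (j : κ) :
    Integrable (fun p => p.2 j * G p) (chanLaw μ κ) := by
  have := hG.mul_integrable ((memLp_noise (μ := μ) j).integrable one_le_two)
  simpa only [mul_comm] using this

/-- The likelihood ratio is unbounded in y, but for each x it has integral 1 over the noise. -/
theorem integrable_exp_logLik (hΦ : ∀ i, BddMeas fun x => Φ x i) :
    Integrable (fun p : α × (κ → ℝ) => Real.exp (logLik Φ p.2 p.1)) (chanLaw μ κ) := by
  have hm : Measurable (fun p : α × (κ → ℝ) => Real.exp (logLik Φ p.2 p.1)) :=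
    ((measurable_logLik hΦ).comp measurable_swap).exp
  have h1 : ∀ x, ∫ y, Real.exp (logLik Φ y x) ∂(stdGauss κ) = 1 := by
    intro x
    have := integral_add_stdGauss (Φ x) (fun _ => 1) measurable_const
    simp only [mul_one] at this
    simp only [logLik]
    rw [← this]
    simp
  refine (integrable_prod_iff hm.aestronglyMeasurable).2 ⟨Filter.Eventually.of_forall fun x => ?_, ?_⟩
  -- The integral of a nonintegrable function is 0 by convention, so the value 1 already certifies
  -- integrability.
  · refine not_imp_comm.1 integral_undef ?_
    rw [h1]
    exact one_ne_zero
  · simp [Real.norm_eq_abs, h1]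

/-- **Nishimori identity**: the signal may be replaced by a sample of the posterior. -/
theorem nishimori (hΦ : ∀ i, BddMeas fun x => Φ x i) {φ : α → ℝ} (hφ : BddMeas φ)
    {ψ : (κ → ℝ) → ℝ} (hψ : BddMeas ψ) :
    ∫ p, φ p.1 * ψ (obs Φ p) ∂(chanLaw μ κ) =
      ∫ p, post μ Φ (obs Φ p) φ * ψ (obs Φ p) ∂(chanLaw μ κ) := by
  have hpost : BddMeas fun y => post μ Φ y φ := bddMeas_post hΦ hφ
  have hint : ∀ G : α × (κ → ℝ) → ℝ, BddMeas G →
      Integrable (fun p : α × (κ → ℝ) => G p * Real.exp (logLik Φ p.2 p.1)) (chanLaw μ κ) :=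
    fun G hG => hG.mul_integrable (integrable_exp_logLik hΦ)
  -- The observation becomes the integration variable, with the likelihood ratio as density. For
  -- fixed y, replacing φ by its posterior mean does not change the integral over x: this is the
  -- definition of the posterior.
  have shift : ∀ G : α → (κ → ℝ) → ℝ, BddMeas (Function.uncurry G) →
      ∫ p, G p.1 (obs Φ p) ∂(chanLaw μ κ) =
        ∫ y, ∫ x, G x y * Real.exp (logLik Φ y x) ∂μ ∂(stdGauss κ) := by
    intro G hG
    have hGo : BddMeas fun p : α × (κ → ℝ) => G p.1 (obs Φ p) :=
      hG.comp (measurable_fst.prodMk (measurable_obs hΦ))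
    rw [integral_prod _ (hGo.integrable _)]
    have h1 : ∀ x, ∫ z, G x (obs Φ (x, z)) ∂(stdGauss κ) =
        ∫ y, G x y * Real.exp (logLik Φ y x) ∂(stdGauss κ) := by
      intro x
      have := integral_add_stdGauss (Φ x) (G x) (hG.1.comp measurable_prodMk_left)
      simp only [obs, logLik]
      rw [this]
      simp only [mul_comm]
    simp_rw [h1]
    exact integral_integral_swap (hint _ hG)
  rw [shift (fun x y => φ x * ψ y) (hφ.signal.mul (hψ.comp measurable_snd)),
    shift (fun _ y => post μ Φ y φ * ψ y)
      ((hpost.comp measurable_snd).mul (hψ.comp measurable_snd))]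
  refine integral_congr_ae (Filter.Eventually.of_forall fun y => ?_)
  simp only []
  rw [integral_const_mul]
  have hZ := integral_exp_pos (μ := μ) (bddMeas_logLik hΦ y)
  have e : ∀ x, φ x * ψ y * Real.exp (logLik Φ y x) = ψ y * (φ x * Real.exp (logLik Φ y x)) :=
    fun x => by ring
  simp_rw [e]
  rw [integral_const_mul, post, gibbsMean]
  field_simp

/-- Given the signal x, the observation is a translate of the noise by `Φ x`, so this is the
Gaussian formula for the translated function, averaged against φ. -/
theorem integral_signal_mul_noise_mul [DecidableEq κ] (hΦ : ∀ i, BddMeas fun x => Φ x i)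
    {φ : α → ℝ} (hφ : BddMeas φ) (j : κ) {F F' : (κ → ℝ) → ℝ} (hF : BddMeas F) (hF' : BddMeas F')
    (hd : ∀ y, HasDerivAt (fun a => F (Function.update y j a)) (F' y) (y j)) :
    ∫ p, φ p.1 * (p.2 j * F (obs Φ p)) ∂(chanLaw μ κ) =
      ∫ p, φ p.1 * F' (obs Φ p) ∂(chanLaw μ κ) := by
  rw [integral_prod _ (hφ.signal.mul_integrable (integrable_noise_mul (hF.obs hΦ) j)),
    integral_prod _ ((hφ.signal.mul (hF'.obs hΦ)).integrable _)]
  refine integral_congr_ae (Filter.Eventually.of_forall fun x => ?_)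
  simp only []
  rw [integral_const_mul, integral_const_mul]
  congr 1
  obtain ⟨A, hA⟩ := hF.2
  obtain ⟨A', hA'⟩ := hF'.2
  have hm : Measurable fun z : κ → ℝ => Φ x + z := by fun_prop
  refine integral_coord_mul_stdGauss j (F := fun z => F (Φ x + z)) (F' := fun z => F' (Φ x + z))
    (fun z => ?_) (hF.1.comp hm) (hF'.1.comp hm) (fun z => hA _) (fun z => hA' _)
  have h := hd (Φ x + z)
  have e : ∀ a, Φ x + Function.update z j a = Function.update (Φ x + z) j (Φ x j + a) := by
    intro a
    ext k
    by_cases hk : k = j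
    · subst hk; simp
    · simp [Function.update_of_ne hk]
  simp_rw [e]
  exact HasDerivAt.comp_const_add (Φ x j) (z j) h

end Channel

end TensorOverlap

namespace TensorOverlap

/-! ### The score and the self-overlap of the posterior mean. -/

section Score

variable {α κ : Type*} [MeasurableSpace α] [Fintype κ] {μ : Measure α} [IsProbabilityMeasure μ]
  {Φ : α → κ → ℝ}

/-- Posterior mean of the derivative of the log-likelihood in the gain of channel `j`. -/
noncomputable def score (μ : Measure α) (Φ : α → κ → ℝ) (j : κ) (p : α × (κ → ℝ)) : ℝ :=
  2 * Φ p.1 j * post μ Φ (obs Φ p) (fun x => Φ x j) + p.2 j * post μ Φ (obs Φ p) (fun x => Φ x j)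
    - post μ Φ (obs Φ p) (fun x => Φ x j ^ 2)

theorem memLp_score (hΦ : ∀ i, BddMeas fun x => Φ x i) (j : κ) :
    MemLp (score μ Φ j) 2 (chanLaw μ κ) := by
  have hM := (bddMeas_post (μ := μ) hΦ (hΦ j)).obs hΦ
  have h1 := ((((hΦ j).signal (κ := κ)).const_mul 2).mul hM).memLp (chanLaw μ κ)
  have h2 := hM.mul_memLp (memLp_noise (μ := μ) j)
  have h3 := ((bddMeas_post (μ := μ) hΦ ((hΦ j).pow 2)).obs hΦ).memLp (chanLaw μ κ)
  refine ((h1.add h2).sub h3).ae_eq (Filter.Eventually.of_forall fun p => ?_)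
  simp only [score, Pi.add_apply, Pi.sub_apply]
  ring

/-- Let M and M2 be the posterior means of Φ_j and Φ_j². Nishimori turns the term 2Φ_jM into 2M²,
and integration by parts turns the noise term into F'M + F(M2 - M²). The subtracted M2 cancels. -/
theorem integral_mul_score [DecidableEq κ] (hΦ : ∀ i, BddMeas fun x => Φ x i) (j : κ)
    {F F' : (κ → ℝ) → ℝ} (hF : BddMeas F) (hF' : BddMeas F')
    (hd : ∀ y, HasDerivAt (fun a => F (Function.update y j a)) (F' y) (y j)) :
    ∫ p, F (obs Φ p) * score μ Φ j p ∂(chanLaw μ κ) =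
      ∫ p, (F (obs Φ p) * post μ Φ (obs Φ p) (fun x => Φ x j) ^ 2 +
        F' (obs Φ p) * post μ Φ (obs Φ p) (fun x => Φ x j)) ∂(chanLaw μ κ) := by
  have hM := bddMeas_post (μ := μ) hΦ (hΦ j)
  have hM2 := bddMeas_post (μ := μ) hΦ ((hΦ j).pow 2)
  have hC := bddMeas_postCov (μ := μ) hΦ (hΦ j) (hΦ j)
  set M : (κ → ℝ) → ℝ := fun y => post μ Φ y (fun x => Φ x j) with hMdef
  set M2 : (κ → ℝ) → ℝ := fun y => post μ Φ y (fun x => Φ x j ^ 2) with hM2def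
  have hG : BddMeas fun y => F y * M y := hF.mul hM
  have hG' : BddMeas fun y => F' y * M y + F y * (M2 y - M y ^ 2) :=
    (hF'.mul hM).add (hF.mul (hM2.sub (hM.pow 2)))
  have ibp := integral_signal_mul_noise_mul (μ := μ) hΦ (BddMeas.const 1) j hG hG' (fun y => by
    have h := (hd y).fun_mul (hasDerivAt_post (μ := μ) hΦ (hΦ j) y j)
    simp only [Function.update_eq_self] at h
    refine h.congr_deriv ?_
    simp only [postCov, hMdef, hM2def, ← pow_two])
  have nish := nishimori (μ := μ) hΦ (hΦ j) hG
  simp only [one_mul] at ibp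
  have i1 : Integrable (fun p => Φ p.1 j * (F (obs Φ p) * M (obs Φ p))) (chanLaw μ κ) :=
    ((hΦ j).signal.mul (hG.obs hΦ)).integrable _
  have i2 := integrable_noise_mul (μ := μ) (hG.obs hΦ) j
  have i3 : Integrable (fun p => F (obs Φ p) * M2 (obs Φ p)) (chanLaw μ κ) :=
    ((hF.mul hM2).obs hΦ).integrable _
  have i4 : Integrable (fun p => M (obs Φ p) * (F (obs Φ p) * M (obs Φ p))) (chanLaw μ κ) :=
    ((hM.mul hG).obs hΦ).integrable _
  have i5 : Integrable (fun p => F' (obs Φ p) * M (obs Φ p) +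
      F (obs Φ p) * (M2 (obs Φ p) - M (obs Φ p) ^ 2)) (chanLaw μ κ) := (hG'.obs hΦ).integrable _
  have e1 : ∀ p, F (obs Φ p) * score μ Φ j p = 2 * (Φ p.1 j * (F (obs Φ p) * M (obs Φ p))) +
      p.2 j * (F (obs Φ p) * M (obs Φ p)) - F (obs Φ p) * M2 (obs Φ p) := by
    intro p
    simp only [score, hMdef, hM2def]
    ring
  have e2 : ∀ p, F (obs Φ p) * M (obs Φ p) ^ 2 + F' (obs Φ p) * M (obs Φ p) =
      2 * (M (obs Φ p) * (F (obs Φ p) * M (obs Φ p))) + (F' (obs Φ p) * M (obs Φ p) +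
      F (obs Φ p) * (M2 (obs Φ p) - M (obs Φ p) ^ 2)) - F (obs Φ p) * M2 (obs Φ p) := by
    intro p
    ring
  have i12 : Integrable (fun p => 2 * (Φ p.1 j * (F (obs Φ p) * M (obs Φ p))) +
      p.2 j * (F (obs Φ p) * M (obs Φ p))) (chanLaw μ κ) := (i1.const_mul 2).add i2
  have i45 : Integrable (fun p => 2 * (M (obs Φ p) * (F (obs Φ p) * M (obs Φ p))) +
      (F' (obs Φ p) * M (obs Φ p) + F (obs Φ p) * (M2 (obs Φ p) - M (obs Φ p) ^ 2)))
      (chanLaw μ κ) := (i4.const_mul 2).add i5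
  refine (integral_congr_ae (Filter.Eventually.of_forall e1)).trans
    (Eq.trans ?_ (integral_congr_ae (Filter.Eventually.of_forall e2)).symm)
  rw [integral_sub i12 i3, integral_add (i1.const_mul 2) i2, integral_const_mul, nish, ibp,
    integral_sub i45 i3, integral_add (i4.const_mul 2) i5, integral_const_mul]

/-- The double sum is the posterior variance of Σ a_k Φ_k. -/
theorem sum_mul_postCov_nonneg (hΦ : ∀ i, BddMeas fun x => Φ x i) (J : Finset κ) (y : κ → ℝ)
    (a : κ → ℝ) :
    0 ≤ ∑ j ∈ J, ∑ k ∈ J, a k * a j * postCov μ Φ y (fun x => Φ x k) (fun x => Φ x j) := by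
  have hE := bddMeas_logLik hΦ y
  have hg : ∀ k, BddMeas fun x => a k * Φ x k := fun k => (hΦ k).const_mul _
  have h := sq_gibbsMean_le (μ := μ) hE (BddMeas.sum (s := J) hg)
  have e1 : gibbsMean μ (logLik Φ y) (fun x => ∑ k ∈ J, a k * Φ x k) =
      ∑ k ∈ J, a k * post μ Φ y (fun x => Φ x k) := by
    rw [gibbsMean_sum hE _ hg]
    exact Finset.sum_congr rfl fun k _ => gibbsMean_const_mul _ _
  have e2 : gibbsMean μ (logLik Φ y) (fun x => (∑ k ∈ J, a k * Φ x k) ^ 2) =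
      ∑ j ∈ J, ∑ k ∈ J, a k * a j * post μ Φ y (fun x => Φ x k * Φ x j) := by
    have : (fun x => (∑ k ∈ J, a k * Φ x k) ^ 2) =
        fun x => ∑ j ∈ J, ∑ k ∈ J, (a k * a j) * (Φ x k * Φ x j) := by
      ext x
      rw [pow_two, Finset.sum_mul_sum, Finset.sum_comm]
      exact Finset.sum_congr rfl fun j _ => Finset.sum_congr rfl fun k _ => by ring
    rw [this, gibbsMean_sum hE _ fun j => BddMeas.sum fun k => ((hΦ k).mul (hΦ j)).const_mul _]
    refine Finset.sum_congr rfl fun j _ => ?_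
    rw [gibbsMean_sum hE _ fun k => ((hΦ k).mul (hΦ j)).const_mul _]
    exact Finset.sum_congr rfl fun k _ => gibbsMean_const_mul _ _
  rw [e1, e2] at h
  have e3 : (∑ k ∈ J, a k * post μ Φ y (fun x => Φ x k)) ^ 2 =
      ∑ j ∈ J, ∑ k ∈ J, a k * a j * (post μ Φ y (fun x => Φ x k) * post μ Φ y (fun x => Φ x j)) := by
    rw [pow_two, Finset.sum_mul_sum, Finset.sum_comm]
    exact Finset.sum_congr rfl fun j _ => Finset.sum_congr rfl fun k _ => by ring
  rw [e3] at h
  simp only [postCov, mul_sub, Finset.sum_sub_distrib]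
  linarith

/-- The self-overlap of the posterior mean fluctuates less than the score. -/
theorem variance_sum_sq_post_le (hΦ : ∀ i, BddMeas fun x => Φ x i) (J : Finset κ) :
    Var[fun p => ∑ j ∈ J, post μ Φ (obs Φ p) (fun x => Φ x j) ^ 2; chanLaw μ κ] ≤
      Var[fun p => ∑ j ∈ J, score μ Φ j p; chanLaw μ κ] := by
  classical
  have hM := fun j => bddMeas_post (μ := μ) hΦ (hΦ j)
  set S : (κ → ℝ) → ℝ := fun y => ∑ j ∈ J, post μ Φ y (fun x => Φ x j) ^ 2 with hS
  set N : α × (κ → ℝ) → ℝ := fun p => ∑ j ∈ J, score μ Φ j p with hN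
  have hSb : BddMeas S := BddMeas.sum fun j => (hM j).pow 2
  have hSo : BddMeas fun p => S (obs Φ p) := hSb.obs hΦ
  have hSL : MemLp (fun p => S (obs Φ p)) 2 (chanLaw μ κ) := hSo.memLp _
  have hNL : MemLp N 2 (chanLaw μ κ) := memLp_finsetSum J fun j _ => memLp_score hΦ j
  -- The partial derivative of S in the observation `y j`.
  let S' : κ → (κ → ℝ) → ℝ := fun j y => ∑ k ∈ J, 2 * post μ Φ y (fun x => Φ x k) *
    postCov μ Φ y (fun x => Φ x k) (fun x => Φ x j)
  have hS'b : ∀ j, BddMeas (S' j) := fun j => BddMeas.sum fun k =>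
    ((hM k).const_mul 2).mul (bddMeas_postCov hΦ (hΦ k) (hΦ j))
  have hS'd : ∀ j y, HasDerivAt (fun a => S (Function.update y j a)) (S' j y) (y j) := by
    intro j y
    refine HasDerivAt.fun_sum fun k _ => ?_
    have := (hasDerivAt_post (μ := μ) hΦ (hΦ k) y j).fun_pow 2
    refine this.congr_deriv ?_
    simp
  have hmul : ∀ (F F' : κ → (κ → ℝ) → ℝ), (∀ j, BddMeas (F j)) → (∀ j, BddMeas (F' j)) →
      (∀ j y, HasDerivAt (fun a => F j (Function.update y j a)) (F' j y) (y j)) →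
      ∫ p, ∑ j ∈ J, F j (obs Φ p) * score μ Φ j p ∂(chanLaw μ κ) =
      ∫ p, ∑ j ∈ J, (F j (obs Φ p) * post μ Φ (obs Φ p) (fun x => Φ x j) ^ 2 +
        F' j (obs Φ p) * post μ Φ (obs Φ p) (fun x => Φ x j)) ∂(chanLaw μ κ) := by
    intro F F' hF hF' hd
    rw [integral_finsetSum _ fun j _ => ((hF j).obs hΦ).mul_integrable
        ((memLp_score hΦ j).integrable one_le_two),
      integral_finsetSum _ fun j _ => ((((hF j).mul ((hM j).pow 2)).add
        ((hF' j).mul (hM j))).obs hΦ).integrable _]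
    exact Finset.sum_congr rfl fun j _ => integral_mul_score hΦ j (hF j) (hF' j) (hd j)
  -- The identity for the score with F = 1.
  have hEN : ∫ p, N p ∂(chanLaw μ κ) = ∫ p, S (obs Φ p) ∂(chanLaw μ κ) := by
    have := hmul (fun _ _ => 1) (fun _ _ => 0) (fun _ => BddMeas.const 1) (fun _ => BddMeas.const 0)
      (fun j y => hasDerivAt_const _ _)
    simpa [hN, hS] using this
  -- The identity for the score with F = S. The derivative term is twice the quadratic form of the
  -- posterior covariance matrix at the vector of posterior means, hence nonnegative.
  have hESN : ∫ p, S (obs Φ p) ^ 2 ∂(chanLaw μ κ) ≤ ∫ p, S (obs Φ p) * N p ∂(chanLaw μ κ) := by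
    have := hmul (fun _ => S) S' (fun _ => hSb) hS'b hS'd
    simp only [hN, Finset.mul_sum]
    rw [this]
    refine integral_mono ((hSo.pow 2).integrable _) (BddMeas.integrable
      (BddMeas.sum fun j => (((hSb.mul ((hM j).pow 2)).add ((hS'b j).mul (hM j))).obs hΦ)) _)
      fun p => ?_
    simp only [Finset.sum_add_distrib, ← Finset.mul_sum]
    have hth := sum_mul_postCov_nonneg (μ := μ) hΦ J (obs Φ p)
      (fun k => post μ Φ (obs Φ p) fun x => Φ x k)
    have e : ∑ j ∈ J, S' j (obs Φ p) * post μ Φ (obs Φ p) (fun x => Φ x j) =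
        2 * ∑ j ∈ J, ∑ k ∈ J, post μ Φ (obs Φ p) (fun x => Φ x k) *
          post μ Φ (obs Φ p) (fun x => Φ x j) *
          postCov μ Φ (obs Φ p) (fun x => Φ x k) (fun x => Φ x j) := by
      simp only [S', Finset.mul_sum, Finset.sum_mul]
      exact Finset.sum_congr rfl fun j _ => Finset.sum_congr rfl fun k _ => by ring
    rw [e, pow_two]
    linarith
  have hcov : Var[fun p => S (obs Φ p); chanLaw μ κ] ≤
      cov[fun p => S (obs Φ p), N; chanLaw μ κ] := by
    rw [variance_eq_sub hSL, covariance_eq_sub hSL hNL, hEN]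
    simp only [Pi.pow_apply, Pi.mul_apply]
    linarith [pow_two (∫ p, S (obs Φ p) ∂(chanLaw μ κ))]
  -- 0 ≤ Var(S - N) = Var S - 2 Cov(S, N) + Var N ≤ Var N - Var S.
  have hsub := variance_sub hSL hNL
  have hpos := variance_nonneg ((fun p => S (obs Φ p)) - N) (chanLaw μ κ)
  linarith

/-- The factor multiplying `Φ p.1 k` is the response of the posterior mean of Φ_k to the gain of
channel j. On average the response correlates with the signal as a sum of squares, which makes the
expected overlap increasing in the gain. -/
theorem integral_signal_mul_cov_score (hΦ : ∀ i, BddMeas fun x => Φ x i) (j k : κ) :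
    ∫ p, Φ p.1 k * ((2 * Φ p.1 j + p.2 j) *
        postCov μ Φ (obs Φ p) (fun x => Φ x k) (fun x => Φ x j) -
        postCov μ Φ (obs Φ p) (fun x => Φ x k) (fun x => Φ x j ^ 2)) ∂(chanLaw μ κ) =
      2 * ∫ p, postCov μ Φ (obs Φ p) (fun x => Φ x k) (fun x => Φ x j) ^ 2 ∂(chanLaw μ κ) := by
  classical
  have hMj := bddMeas_post (μ := μ) hΦ (hΦ j)
  have hMk := bddMeas_post (μ := μ) hΦ (hΦ k)
  have hC := bddMeas_postCov (μ := μ) hΦ (hΦ k) (hΦ j)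
  have hCjj := bddMeas_postCov (μ := μ) hΦ (hΦ j) (hΦ j)
  have hCkj2 := bddMeas_postCov (μ := μ) hΦ (hΦ k) ((hΦ j).pow 2)
  have hCkjj := bddMeas_postCov (μ := μ) hΦ ((hΦ k).mul (hΦ j)) (hΦ j)
  set Mj : (κ → ℝ) → ℝ := fun y => post μ Φ y (fun x => Φ x j)
  set Mk : (κ → ℝ) → ℝ := fun y => post μ Φ y (fun x => Φ x k)
  set C : (κ → ℝ) → ℝ := fun y => postCov μ Φ y (fun x => Φ x k) (fun x => Φ x j)
  set Cjj : (κ → ℝ) → ℝ := fun y => postCov μ Φ y (fun x => Φ x j) (fun x => Φ x j)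
  set D : (κ → ℝ) → ℝ := fun y => postCov μ Φ y (fun x => Φ x k) (fun x => Φ x j ^ 2)
  set Ckjj : (κ → ℝ) → ℝ := fun y => postCov μ Φ y (fun x => Φ x k * Φ x j) (fun x => Φ x j)
  have hC' : BddMeas fun y => Ckjj y - (C y * Mj y + Mk y * Cjj y) :=
    hCkjj.sub ((hC.mul hMj).add (hMk.mul hCjj))
  have ibp := integral_signal_mul_noise_mul (μ := μ) hΦ (hΦ k) j hC hC' (fun y => by
    have h1 := hasDerivAt_post (μ := μ) hΦ ((hΦ k).mul (hΦ j)) y j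
    have h2 := hasDerivAt_post (μ := μ) hΦ (hΦ k) y j
    have h3 := hasDerivAt_post (μ := μ) hΦ (hΦ j) y j
    have h := h1.fun_sub (h2.fun_mul h3)
    simp only [Function.update_eq_self] at h
    exact h)
  -- The third moments cancel between the derivative of the covariance and D; what is left reduces
  -- by Nishimori to the square of C.
  have halg : ∀ y, Ckjj y - (C y * Mj y + Mk y * Cjj y) - D y = -2 * (Mj y * C y) := by
    intro y
    have e : (fun x => Φ x k * Φ x j * Φ x j) = fun x => Φ x k * Φ x j ^ 2 := by
      ext x; ring
    have e2 : (fun x => Φ x j * Φ x j) = fun x => Φ x j ^ 2 := by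
      ext x; ring
    simp only [Ckjj, C, Mj, Mk, Cjj, D, postCov, e, e2]
    ring
  have n1 := nishimori (μ := μ) hΦ ((hΦ k).mul (hΦ j)) hC
  have n2 := nishimori (μ := μ) hΦ (hΦ k) (hMj.mul hC)
  have i1 : Integrable (fun p => Φ p.1 k * Φ p.1 j * C (obs Φ p)) (chanLaw μ κ) :=
    (((hΦ k).mul (hΦ j)).signal.mul (hC.obs hΦ)).integrable _
  have i2 : Integrable (fun p => Φ p.1 k * (p.2 j * C (obs Φ p))) (chanLaw μ κ) :=
    (hΦ k).signal.mul_integrable (integrable_noise_mul (hC.obs hΦ) j)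
  have i3 : Integrable (fun p => Φ p.1 k * D (obs Φ p)) (chanLaw μ κ) :=
    ((hΦ k).signal.mul (hCkj2.obs hΦ)).integrable _
  have i4 : Integrable (fun p => Φ p.1 k * (Mj (obs Φ p) * C (obs Φ p))) (chanLaw μ κ) :=
    ((hΦ k).signal.mul ((hMj.mul hC).obs hΦ)).integrable _
  have i5 : Integrable (fun p => post μ Φ (obs Φ p) (fun x => Φ x k * Φ x j) * C (obs Φ p))
      (chanLaw μ κ) := (((bddMeas_post hΦ ((hΦ k).mul (hΦ j))).mul hC).obs hΦ).integrable _
  have i6 : Integrable (fun p => Mk (obs Φ p) * (Mj (obs Φ p) * C (obs Φ p)))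
      (chanLaw μ κ) := ((hMk.mul (hMj.mul hC)).obs hΦ).integrable _
  have i7 : Integrable (fun p => Φ p.1 k * (Ckjj (obs Φ p) - (C (obs Φ p) * Mj (obs Φ p) +
      Mk (obs Φ p) * Cjj (obs Φ p)))) (chanLaw μ κ) :=
    ((hΦ k).signal.mul (hC'.obs hΦ)).integrable _
  have e1 : ∀ p, Φ p.1 k * ((2 * Φ p.1 j + p.2 j) * C (obs Φ p) - D (obs Φ p)) =
      2 * (Φ p.1 k * Φ p.1 j * C (obs Φ p)) + Φ p.1 k * (p.2 j * C (obs Φ p)) -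
        Φ p.1 k * D (obs Φ p) := fun p => by ring
  have i12 : Integrable (fun p => 2 * (Φ p.1 k * Φ p.1 j * C (obs Φ p)) +
      Φ p.1 k * (p.2 j * C (obs Φ p))) (chanLaw μ κ) := (i1.const_mul 2).add i2
  have e2 : ∀ p, C (obs Φ p) ^ 2 = post μ Φ (obs Φ p) (fun x => Φ x k * Φ x j) * C (obs Φ p) -
      Mk (obs Φ p) * (Mj (obs Φ p) * C (obs Φ p)) := by
    intro p
    simp only [C, Mk, Mj, postCov]
    ring
  have e3 : ∀ p, Φ p.1 k * (Ckjj (obs Φ p) - (C (obs Φ p) * Mj (obs Φ p) +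
      Mk (obs Φ p) * Cjj (obs Φ p))) = Φ p.1 k * D (obs Φ p) -
      2 * (Φ p.1 k * (Mj (obs Φ p) * C (obs Φ p))) := by
    intro p
    have := halg (obs Φ p)
    linear_combination (Φ p.1 k) * this
  rw [integral_congr_ae (Filter.Eventually.of_forall e3), integral_sub i3 (i4.const_mul 2),
    integral_const_mul, n2] at ibp
  rw [integral_congr_ae (Filter.Eventually.of_forall e1),
    integral_congr_ae (Filter.Eventually.of_forall e2), integral_sub i12 i3,
    integral_add (i1.const_mul 2) i2, integral_const_mul, n1, ibp, integral_sub i5 i6]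
  ring

end Score

end TensorOverlap

namespace TensorOverlap

/-! ### The free energy of a channel. -/

section FreeEnergy

variable {α κ : Type*} [MeasurableSpace α] [Fintype κ]

/-- The logarithm of the normalization of the posterior. -/
noncomputable def freeEnergy (μ : Measure α) (Φ : α → κ → ℝ) (p : α × (κ → ℝ)) : ℝ :=
  Real.log (∫ x, Real.exp (logLik Φ (obs Φ p) x) ∂μ)

variable {μ : Measure α} [IsProbabilityMeasure μ] {Φ : α → κ → ℝ}

theorem abs_log_integral_exp_le {E : α → ℝ} (hE : BddMeas E) {C : ℝ} (hC : ∀ x, |E x| ≤ C) :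
    |Real.log (∫ x, Real.exp (E x) ∂μ)| ≤ C := by
  have hZ := integral_exp_pos (μ := μ) hE
  have h1 : Real.exp (-C) ≤ ∫ x, Real.exp (E x) ∂μ := by
    have := integral_mono (integrable_const (μ := μ) (Real.exp (-C))) (hE.exp.integrable μ)
      fun x => Real.exp_le_exp.2 (abs_le.1 (hC x)).1
    simpa using this
  have h2 : ∫ x, Real.exp (E x) ∂μ ≤ Real.exp C := by
    have := integral_mono (hE.exp.integrable μ) (integrable_const (μ := μ) (Real.exp C))
      fun x => Real.exp_le_exp.2 (abs_le.1 (hC x)).2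
    simpa using this
  rw [abs_le]
  constructor
  · simpa using Real.log_le_log (Real.exp_pos _) h1
  · simpa using Real.log_le_log hZ h2

/-- The log-partition function is 1-Lipschitz for the supremum norm of the exponent; this is the
source of all the Efron–Stein oscillation bounds. It is the tangent inequality with constant g,
applied both ways. -/
theorem abs_log_integral_exp_sub_le {E E' : α → ℝ} (hE : BddMeas E) (hE' : BddMeas E') {C : ℝ}
    (hC : ∀ x, |E x - E' x| ≤ C) :
    |Real.log (∫ x, Real.exp (E x) ∂μ) - Real.log (∫ x, Real.exp (E' x) ∂μ)| ≤ C := by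
  have h1 := log_integral_exp_add_gibbsMean_le (μ := μ) hE hE' (BddMeas.const (-C))
    fun x => by linarith [(abs_le.1 (hC x)).2]
  have h2 := log_integral_exp_add_gibbsMean_le (μ := μ) hE' hE (BddMeas.const (-C))
    fun x => by linarith [(abs_le.1 (hC x)).1]
  rw [gibbsMean_const hE] at h1
  rw [gibbsMean_const hE'] at h2
  rw [abs_le]
  constructor <;> linarith

theorem measurable_freeEnergy (hΦ : ∀ i, BddMeas fun x => Φ x i) :
    Measurable (freeEnergy μ Φ) := by
  have h : Measurable fun q : (α × (κ → ℝ)) × α => Real.exp (logLik Φ (obs Φ q.1) q.2) :=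
    ((measurable_logLik hΦ).comp
      (((measurable_obs hΦ).comp measurable_fst).prodMk measurable_snd)).exp
  exact (h.stronglyMeasurable.integral_prod_right' (ν := μ)).measurable.log

theorem abs_freeEnergy_le (hΦ : ∀ i, BddMeas fun x => Φ x i) {c : κ → ℝ}
    (hc : ∀ x i, |Φ x i| ≤ c i) (p : α × (κ → ℝ)) :
    |freeEnergy μ Φ p| ≤ ∑ i, ((c i + |p.2 i|) * c i + c i ^ 2) := by
  refine abs_log_integral_exp_le (bddMeas_logLik hΦ _) (fun x => ?_)
  refine (Finset.abs_sum_le_sum_abs _ _).trans (Finset.sum_le_sum fun i _ => ?_)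
  have h0 : 0 ≤ c i := (abs_nonneg _).trans (hc x i)
  refine (abs_sub _ _).trans (add_le_add ?_ ?_)
  · rw [abs_mul]
    refine mul_le_mul ?_ (hc x i) (abs_nonneg _) (by positivity)
    exact (abs_add_le _ _).trans (add_le_add (hc _ i) le_rfl)
  · rw [abs_div, abs_pow, abs_two]
    have := pow_le_pow_left₀ (abs_nonneg _) (hc x i) 2
    linarith [sq_nonneg |Φ x i|]

theorem memLp_freeEnergy (hΦ : ∀ i, BddMeas fun x => Φ x i) :
    MemLp (freeEnergy μ Φ) 2 (chanLaw μ κ) := by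
  choose C hC using fun i => (hΦ i).2
  have hb : MemLp (fun p : α × (κ → ℝ) => ∑ i, ((C i + |p.2 i|) * C i + C i ^ 2)) 2
      (chanLaw μ κ) :=
    memLp_finsetSum _ fun i _ => (((memLp_const (C i)).add
      (memLp_noise (μ := μ) i).abs).mul_const (C i)).add (memLp_const (C i ^ 2))
  exact hb.of_le (measurable_freeEnergy hΦ).aestronglyMeasurable
    (Filter.Eventually.of_forall fun p =>
      (abs_freeEnergy_le hΦ (fun x i => hC i x) p).trans (le_abs_self _))

end FreeEnergy

/-! ### Extra scalar channels with a variable gain. -/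

section Line

variable {α κ J : Type*} [MeasurableSpace α] [Fintype κ] [Fintype J]

/-- The channel `Φ` together with scalar channels of gain `r` for the variables `u j`. -/
def lineChan (Φ : α → κ → ℝ) (u : α → J → ℝ) (r : ℝ) (x : α) : κ ⊕ J → ℝ :=
  Sum.elim (Φ x) fun j => r * u x j

/-- The derivative of the free energy in the gain `r`. -/
noncomputable def lineSlope (μ : Measure α) (Φ : α → κ → ℝ) (u : α → J → ℝ) (r : ℝ)
    (p : α × (κ ⊕ J → ℝ)) : ℝ :=
  ∑ j, ((2 * r * u p.1 j + p.2 (.inr j)) *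
      post μ (lineChan Φ u r) (obs (lineChan Φ u r) p) (fun x => u x j) -
    r * post μ (lineChan Φ u r) (obs (lineChan Φ u r) p) (fun x => u x j ^ 2))

variable {μ : Measure α} {Φ : α → κ → ℝ} {u : α → J → ℝ}

omit [Fintype κ] [Fintype J] in
theorem bddMeas_lineChan (hΦ : ∀ i, BddMeas fun x => Φ x i) (hu : ∀ j, BddMeas fun x => u x j)
    (r : ℝ) (i : κ ⊕ J) : BddMeas fun x => lineChan Φ u r x i := by
  cases i with
  | inl i => exact hΦ i
  | inr j => exact (hu j).const_mul r

omit [MeasurableSpace α] in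
-- For fixed signal and noise the exponent is a quadratic polynomial in r with coefficients
-- independent of r, as `hasDerivAt_gibbsMean` requires.
theorem logLik_lineChan (r : ℝ) (p : α × (κ ⊕ J → ℝ)) :
    logLik (lineChan Φ u r) (obs (lineChan Φ u r) p) = fun x =>
      logLik Φ (fun i => Φ p.1 i + p.2 (.inl i)) x + r * ∑ j, p.2 (.inr j) * u x j +
        r ^ 2 * ∑ j, (u p.1 j * u x j - u x j ^ 2 / 2) := by
  ext x
  simp only [logLik, obs, lineChan, Fintype.sum_sum_type, Sum.elim_inl, Sum.elim_inr, Pi.add_apply,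
    Finset.mul_sum, add_assoc]
  rw [← Finset.sum_add_distrib]
  congr 1
  exact Finset.sum_congr rfl fun j _ => by ring

variable [IsProbabilityMeasure μ]

theorem memLp_lineSlope (hΦ : ∀ i, BddMeas fun x => Φ x i) (hu : ∀ j, BddMeas fun x => u x j)
    (r : ℝ) : MemLp (lineSlope μ Φ u r) 2 (chanLaw μ (κ ⊕ J)) := by
  have hL := bddMeas_lineChan (Φ := Φ) hΦ hu r
  refine memLp_finsetSum _ fun j _ => ?_
  have hM := (bddMeas_post (μ := μ) hL (hu j)).obs hL
  have h1 := ((((hu j).signal (κ := κ ⊕ J)).const_mul (2 * r)).mul hM).memLp (chanLaw μ (κ ⊕ J))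
  have h2 := hM.mul_memLp (memLp_noise (μ := μ) (.inr j))
  have h3 := (((bddMeas_post (μ := μ) hL ((hu j).pow 2)).obs hL).const_mul r).memLp
    (chanLaw μ (κ ⊕ J))
  refine ((h1.add h2).sub h3).ae_eq (Filter.Eventually.of_forall fun p => ?_)
  simp only [Pi.add_apply, Pi.sub_apply]
  ring

theorem abs_integral_lineSlope_le (hΦ : ∀ i, BddMeas fun x => Φ x i)
    (hu : ∀ j, BddMeas fun x => u x j) {B : ℝ} (hB : ∀ x j, |u x j| ≤ B) (hB0 : 0 ≤ B) {r ρ : ℝ}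
    (hr : |r| ≤ ρ) :
    |∫ p, lineSlope μ Φ u r p ∂(chanLaw μ (κ ⊕ J))| ≤ Fintype.card J * (3 * ρ * B ^ 2 + B) := by
  have hL := bddMeas_lineChan (Φ := Φ) hΦ hu r
  have hρ : 0 ≤ ρ := (abs_nonneg _).trans hr
  -- The noise is unbounded, but |z| ≤ (1 + z²)/2 and E z² = 1.
  have hz : ∀ j : J, ∫ p : α × (κ ⊕ J → ℝ), |p.2 (.inr j)| ∂(chanLaw μ (κ ⊕ J)) ≤ 1 := by
    intro j
    have h2 : ∫ p : α × (κ ⊕ J → ℝ), p.2 (.inr j) ^ 2 ∂(chanLaw μ (κ ⊕ J)) = 1 := by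
      rw [integral_fun_snd (fun z : κ ⊕ J → ℝ => z (.inr j) ^ 2)]
      have h4 := integral_map (μ := stdGauss (κ ⊕ J)) (φ := fun z => z (.inr j))
        (f := fun a : ℝ => a ^ 2) (measurable_pi_apply (Sum.inr j)).aemeasurable (by fun_prop)
      rw [(measurePreserving_eval (fun _ : κ ⊕ J => gaussianReal 0 1) (.inr j)).map_eq] at h4
      rw [← h4]
      have h5 := variance_fun_id_gaussianReal (μ := 0) (v := 1)
      rw [variance_eq_integral (by fun_prop)] at h5
      simpa using h5
    have hI := (memLp_noise (μ := μ) (Sum.inr j : κ ⊕ J))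
    have := integral_mono (hI.integrable one_le_two).abs
      (((integrable_const (1:ℝ)).add hI.integrable_sq).div_const 2) (fun p => by
        simp only [Pi.add_apply]
        nlinarith [sq_nonneg (|p.2 (.inr j)| - 1), sq_abs (p.2 (.inr j))])
    refine this.trans ?_
    rw [integral_div, integral_add' (integrable_const _) hI.integrable_sq, h2]
    simp
  have hint1 : ∀ j : J, Integrable (fun p : α × (κ ⊕ J → ℝ) =>
      3 * ρ * B ^ 2 + B * |p.2 (.inr j)|) (chanLaw μ (κ ⊕ J)) := fun j =>
    (integrable_const _).add
      (((memLp_noise (μ := μ) (Sum.inr j : κ ⊕ J)).integrable one_le_two).abs.const_mul B)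
  have hint : Integrable (fun p : α × (κ ⊕ J → ℝ) =>
      ∑ j : J, (3 * ρ * B ^ 2 + B * |p.2 (.inr j)|)) (chanLaw μ (κ ⊕ J)) :=
    integrable_finsetSum _ fun j _ => hint1 j
  rw [← Real.norm_eq_abs]
  refine (norm_integral_le_of_norm_le hint (Filter.Eventually.of_forall fun p => ?_)).trans ?_
  · refine (Finset.abs_sum_le_sum_abs _ _).trans (Finset.sum_le_sum fun j _ => ?_)
    have hm : |post μ (lineChan Φ u r) (obs (lineChan Φ u r) p) (fun x => u x j)| ≤ B :=
      abs_gibbsMean_le (bddMeas_logLik hL _) fun x => hB x j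
    have hm2 : |post μ (lineChan Φ u r) (obs (lineChan Φ u r) p) (fun x => u x j ^ 2)| ≤ B ^ 2 :=
      abs_gibbsMean_le (bddMeas_logLik hL _) fun x => by
        rw [abs_pow]; exact pow_le_pow_left₀ (abs_nonneg _) (hB x j) 2
    have e1 : |2 * r * u p.1 j + p.2 (.inr j)| ≤ 2 * ρ * B + |p.2 (.inr j)| := by
      refine (abs_add_le _ _).trans (add_le_add_left ?_ _)
      rw [abs_mul, abs_mul, abs_two]
      exact mul_le_mul (by linarith) (hB _ _) (abs_nonneg _) (by positivity)
    refine (abs_sub _ _).trans ?_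
    rw [abs_mul, abs_mul]
    have e2 := mul_le_mul e1 hm (abs_nonneg _) (by positivity)
    have e3 := mul_le_mul hr hm2 (abs_nonneg _) hρ
    nlinarith
  · rw [integral_finsetSum _ fun j _ => hint1 j]
    have : ∀ j : J, ∫ p : α × (κ ⊕ J → ℝ), (3 * ρ * B ^ 2 + B * |p.2 (.inr j)|)
        ∂(chanLaw μ (κ ⊕ J)) ≤ 3 * ρ * B ^ 2 + B := by
      intro j
      rw [integral_add (integrable_const _)
        (((memLp_noise (μ := μ) (Sum.inr j : κ ⊕ J)).integrable one_le_two).abs.const_mul B),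
        integral_const, integral_const_mul]
      simp only [probReal_univ, one_smul]
      nlinarith [hz j]
    refine (Finset.sum_le_sum fun j _ => this j).trans (le_of_eq ?_)
    simp [mul_add]

/-- The part of the exponent linear in r only produces convexity. The coefficient of r² may be
negative but is at least -(3/2)|J|B², so a deterministic quadratic restores convexity. -/
theorem freeEnergy_lineChan_tangent (hΦ : ∀ i, BddMeas fun x => Φ x i)
    (hu : ∀ j, BddMeas fun x => u x j) {B : ℝ} (hB : ∀ x j, |u x j| ≤ B) (r r' : ℝ)
    (p : α × (κ ⊕ J → ℝ)) :
    freeEnergy μ (lineChan Φ u r) p + lineSlope μ Φ u r p * (r' - r) -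
      3 / 2 * Fintype.card J * B ^ 2 * (r' - r) ^ 2 ≤ freeEnergy μ (lineChan Φ u r') p := by
  have hL := fun r => bddMeas_lineChan (Φ := Φ) hΦ hu r
  set E := logLik (lineChan Φ u r) (obs (lineChan Φ u r) p) with hE
  have hEb : BddMeas E := bddMeas_logLik (hL r) _
  have hj : ∀ j, BddMeas fun x => (2 * r * u p.1 j + p.2 (.inr j)) * u x j - r * u x j ^ 2 :=
    fun j => ((hu j).const_mul _).sub (((hu j).pow 2).const_mul r)
  have hs : BddMeas fun x => ∑ j, ((2 * r * u p.1 j + p.2 (.inr j)) * u x j - r * u x j ^ 2) :=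
    BddMeas.sum hj
  have hg := (hs.const_mul (r' - r)).sub
    (BddMeas.const (3 / 2 * Fintype.card J * B ^ 2 * (r' - r) ^ 2))
  have hmean : gibbsMean μ E (fun x => (r' - r) *
      ∑ j, ((2 * r * u p.1 j + p.2 (.inr j)) * u x j - r * u x j ^ 2) -
      3 / 2 * Fintype.card J * B ^ 2 * (r' - r) ^ 2) =
      lineSlope μ Φ u r p * (r' - r) - 3 / 2 * Fintype.card J * B ^ 2 * (r' - r) ^ 2 := by
    rw [gibbsMean_sub hEb (hs.const_mul _) (BddMeas.const _), gibbsMean_const hEb,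
      gibbsMean_const_mul, gibbsMean_sum hEb _ hj, mul_comm]
    congr 2
    refine Finset.sum_congr rfl fun j _ => ?_
    rw [gibbsMean_sub hEb ((hu j).const_mul _) (((hu j).pow 2).const_mul r), gibbsMean_const_mul,
      gibbsMean_const_mul]
    rfl
  have := log_integral_exp_add_gibbsMean_le (μ := μ) hEb (bddMeas_logLik (hL r')
    (obs (lineChan Φ u r') p)) hg (fun x => by
      rw [hE, logLik_lineChan, logLik_lineChan]
      have h1 : -(Fintype.card J * (3 / 2 * B ^ 2)) ≤ ∑ j, (u p.1 j * u x j - u x j ^ 2 / 2) := by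
        have : ∀ j ∈ Finset.univ, -(3 / 2 * B ^ 2) ≤ u p.1 j * u x j - u x j ^ 2 / 2 := by
          intro j _
          have a1 := abs_le.1 (hB x j)
          have a2 := abs_le.1 (hB p.1 j)
          nlinarith [mul_nonneg (sub_nonneg.2 a1.2) (sub_nonneg.2 a2.2),
            mul_nonneg (by linarith : 0 ≤ B + u x j) (by linarith : 0 ≤ B + u p.1 j),
            mul_nonneg (sub_nonneg.2 a1.2) (by linarith : 0 ≤ B + u x j)]
        have := Finset.card_nsmul_le_sum _ _ _ this
        simpa using this
      have h2 : ∑ j, ((2 * r * u p.1 j + p.2 (.inr j)) * u x j - r * u x j ^ 2) =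
          ∑ j, p.2 (.inr j) * u x j + 2 * r * ∑ j, (u p.1 j * u x j - u x j ^ 2 / 2) := by
        rw [Finset.mul_sum, ← Finset.sum_add_distrib]
        exact Finset.sum_congr rfl fun j _ => by ring
      rw [h2]
      nlinarith [mul_le_mul_of_nonneg_left h1 (sq_nonneg (r' - r))])
  rw [hmean] at this
  simp only [freeEnergy]
  linarith

/-- The convexity estimate is applied to the free energy plus c r². The added term leaves the
variances unchanged; in the bound on the mean slope it replaces 3ρ by 6ρ. -/
theorem lintegral_variance_lineSlope_le (hΦ : ∀ i, BddMeas fun x => Φ x i)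
    (hu : ∀ j, BddMeas fun x => u x j) {B : ℝ} (hB : ∀ x j, |u x j| ≤ B) (hB0 : 0 ≤ B)
    {a b δ V ρ : ℝ} (hab : a ≤ b) (hδ : 0 < δ) (hρa : -ρ ≤ a - δ) (hρb : b + δ ≤ ρ)
    (hV : ∀ r ∈ Set.Icc (-ρ) ρ, Var[freeEnergy μ (lineChan Φ u r); chanLaw μ (κ ⊕ J)] ≤ V) :
    ∫⁻ r in Set.Icc a b, ENNReal.ofReal (Var[lineSlope μ Φ u r; chanLaw μ (κ ⊕ J)]) ≤
      ENNReal.ofReal (18 * V / δ ^ 2 * (b - a) +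
        16 * (Fintype.card J * (6 * ρ * B ^ 2 + B)) ^ 2 * δ) := by
  have hL := fun r => bddMeas_lineChan (Φ := Φ) hΦ hu r
  set c : ℝ := 3 / 2 * Fintype.card J * B ^ 2 with hc
  have hF := fun r => memLp_freeEnergy (μ := μ) (hL r)
  have hS := fun r => memLp_lineSlope (μ := μ) hΦ hu r
  have hmem : ∀ r ∈ Set.Icc (a - δ) (b + δ), r ∈ Set.Icc (-ρ) ρ := fun r hr =>
    ⟨hρa.trans hr.1, hr.2.trans hρb⟩
  have key := lintegral_variance_slope_le (chanLaw μ (κ ⊕ J))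
    (H := fun r p => freeEnergy μ (lineChan Φ u r) p + c * r ^ 2)
    (H' := fun r p => lineSlope μ Φ u r p + 2 * c * r)
    (fun r r' p => by
      have := freeEnergy_lineChan_tangent (μ := μ) (u := u) hΦ hu hB r r' p
      rw [← hc] at this
      nlinarith)
    (fun r => (hF r).add (memLp_const _)) (fun r => (hS r).add (memLp_const _)) hab hδ (V := V)
    (D := Fintype.card J * (6 * ρ * B ^ 2 + B))
    (fun r hr => by
      rw [variance_add_const (hF r).1]
      exact hV r (hmem r hr))
    (fun r hr => by
      have hr' : |r| ≤ ρ := abs_le.2 (hmem r hr)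
      have h1 := abs_integral_lineSlope_le (μ := μ) (u := u) hΦ hu hB hB0 hr'
      rw [integral_add ((hS r).integrable one_le_two) (integrable_const _)]
      refine (abs_add_le _ _).trans ?_
      have h2 : |∫ _ : α × (κ ⊕ J → ℝ), 2 * c * r ∂(chanLaw μ (κ ⊕ J))| ≤
          Fintype.card J * (3 * ρ * B ^ 2) := by
        simp only [integral_const, probReal_univ, one_smul]
        have hc0 : 0 ≤ 2 * c := by positivity
        rw [abs_mul, abs_of_nonneg hc0]
        have := mul_le_mul_of_nonneg_left hr' hc0
        refine this.trans (le_of_eq ?_)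
        rw [hc]; ring
      refine (add_le_add h1 h2).trans (le_of_eq ?_)
      ring)
  refine le_trans (le_of_eq ?_) key
  refine lintegral_congr fun r => ?_
  rw [variance_add_const (hS r).1]

/-- The self-overlap of the posterior mean in the extra channels concentrates, on average over
the gain. -/
theorem lintegral_variance_overlap_le (hΦ : ∀ i, BddMeas fun x => Φ x i)
    (hu : ∀ j, BddMeas fun x => u x j) {B : ℝ} (hB : ∀ x j, |u x j| ≤ B) (hB0 : 0 ≤ B)
    {a b δ V ρ : ℝ} (ha : 0 < a) (hab : a ≤ b) (hδ : 0 < δ) (hρa : -ρ ≤ a - δ) (hρb : b + δ ≤ ρ)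
    (hV : ∀ r ∈ Set.Icc (-ρ) ρ, Var[freeEnergy μ (lineChan Φ u r); chanLaw μ (κ ⊕ J)] ≤ V) :
    ∫⁻ r in Set.Icc a b, ENNReal.ofReal (2 * r * Var[fun p => ∑ j,
        post μ (lineChan Φ u r) (obs (lineChan Φ u r) p) (fun x => u x j) ^ 2;
        chanLaw μ (κ ⊕ J)]) ≤
      ENNReal.ofReal (2 / a * (18 * V / δ ^ 2 * (b - a) +
        16 * (Fintype.card J * (6 * ρ * B ^ 2 + B)) ^ 2 * δ)) := by
  have hL := fun r => bddMeas_lineChan (Φ := Φ) hΦ hu r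
  -- Channel means carry a factor r and the sum of scores is r times the slope. Comparison of
  -- variances gives r⁴ Var S ≤ r² Var(slope), hence 2r Var S ≤ (2/r) Var(slope) with S formed from
  -- the posterior means of u_j. The weight 2r is the Jacobian of x = r².
  have hpt : ∀ r ∈ Set.Icc a b, 2 * r * Var[fun p => ∑ j,
        post μ (lineChan Φ u r) (obs (lineChan Φ u r) p) (fun x => u x j) ^ 2;
        chanLaw μ (κ ⊕ J)] ≤ 2 / a * Var[lineSlope μ Φ u r; chanLaw μ (κ ⊕ J)] := by
    intro r hr
    have hr0 : 0 < r := ha.trans_le hr.1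
    have h := variance_sum_sq_post_le (μ := μ) (hL r)
      ((Finset.univ : Finset J).map ⟨Sum.inr, Sum.inr_injective⟩)
    simp only [Finset.sum_map, Function.Embedding.coeFn_mk] at h
    have hm : ∀ p (j : J), post μ (lineChan Φ u r) (obs (lineChan Φ u r) p)
        (fun x => lineChan Φ u r x (.inr j)) =
        r * post μ (lineChan Φ u r) (obs (lineChan Φ u r) p) (fun x => u x j) := fun p j =>
      gibbsMean_const_mul r _
    have hm2 : ∀ p (j : J), post μ (lineChan Φ u r) (obs (lineChan Φ u r) p)
        (fun x => lineChan Φ u r x (.inr j) ^ 2) =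
        r ^ 2 * post μ (lineChan Φ u r) (obs (lineChan Φ u r) p) (fun x => u x j ^ 2) := by
      intro p j
      have : (fun x => lineChan Φ u r x (.inr j) ^ 2) = fun x => r ^ 2 * u x j ^ 2 := by
        ext x
        simp [lineChan, mul_pow]
      rw [this]
      exact gibbsMean_const_mul _ _
    have e1 : (fun p => ∑ j : J, post μ (lineChan Φ u r) (obs (lineChan Φ u r) p)
        (fun x => lineChan Φ u r x (.inr j)) ^ 2) = fun p => r ^ 2 * ∑ j,
        post μ (lineChan Φ u r) (obs (lineChan Φ u r) p) (fun x => u x j) ^ 2 := by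
      ext p
      rw [Finset.mul_sum]
      refine Finset.sum_congr rfl fun j _ => ?_
      rw [hm, mul_pow]
    have e2 : (fun p => ∑ j : J, score μ (lineChan Φ u r) (.inr j) p) =
        fun p => r * lineSlope μ Φ u r p := by
      ext p
      rw [lineSlope, Finset.mul_sum]
      refine Finset.sum_congr rfl fun j _ => ?_
      rw [score, hm, hm2]
      simp only [lineChan, Sum.elim_inr]
      ring
    rw [e1, e2, variance_const_mul, variance_const_mul] at h
    set X := Var[fun p => ∑ j, post μ (lineChan Φ u r) (obs (lineChan Φ u r) p)
      (fun x => u x j) ^ 2; chanLaw μ (κ ⊕ J)]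
    set Y := Var[lineSlope μ Φ u r; chanLaw μ (κ ⊕ J)]
    have hY : 0 ≤ Y := variance_nonneg _ _
    have h2 : r * X ≤ Y / r := by
      rw [le_div_iff₀ hr0]
      have : r ^ 2 * (r * X * r) ≤ r ^ 2 * Y := by nlinarith
      exact le_of_mul_le_mul_left this (by positivity)
    have h3 : Y / r ≤ Y / a := div_le_div_of_nonneg_left hY ha hr.1
    have : 2 / a * Y = 2 * (Y / a) := by ring
    linarith
  calc _ ≤ ∫⁻ r in Set.Icc a b, ENNReal.ofReal (2 / a) *
        ENNReal.ofReal (Var[lineSlope μ Φ u r; chanLaw μ (κ ⊕ J)]) := by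
        refine setLIntegral_mono' measurableSet_Icc fun r hr => ?_
        rw [← ENNReal.ofReal_mul (by positivity)]
        exact ENNReal.ofReal_le_ofReal (hpt r hr)
    _ = ENNReal.ofReal (2 / a) * ∫⁻ r in Set.Icc a b,
        ENNReal.ofReal (Var[lineSlope μ Φ u r; chanLaw μ (κ ⊕ J)]) :=
        lintegral_const_mul' _ _ ENNReal.ofReal_ne_top
    _ ≤ _ := by
        rw [ENNReal.ofReal_mul (by positivity)]
        gcongr
        exact lintegral_variance_lineSlope_le hΦ hu hB hB0 hab hδ hρa hρb hV

end Line

end TensorOverlap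

namespace TensorOverlap

/-! ### Posterior covariances are small on average over the gain. -/

section Thermal

variable {α κ J : Type*} [MeasurableSpace α] [Fintype κ] [Fintype J]
  {μ : Measure α} {Φ : α → κ → ℝ} {u : α → J → ℝ}

/-- Posterior covariance of two of the variables `u j`, given the observation of the line channel. -/
noncomputable def lineCov (μ : Measure α) (Φ : α → κ → ℝ) (u : α → J → ℝ) (r : ℝ) (k j : J)
    (p : α × (κ ⊕ J → ℝ)) : ℝ :=
  postCov μ (lineChan Φ u r) (obs (lineChan Φ u r) p) (fun x => u x k) (fun x => u x j)

/-- The derivative of the posterior mean of `u k` in the gain. -/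
noncomputable def linePostDeriv (μ : Measure α) (Φ : α → κ → ℝ) (u : α → J → ℝ) (r : ℝ) (k : J)
    (p : α × (κ ⊕ J → ℝ)) : ℝ :=
  ∑ j, ((2 * r * u p.1 j + p.2 (.inr j)) * lineCov μ Φ u r k j p -
    r * postCov μ (lineChan Φ u r) (obs (lineChan Φ u r) p) (fun x => u x k) (fun x => u x j ^ 2))

variable [IsProbabilityMeasure μ]

theorem abs_postCov_le {Ψ : α → κ → ℝ} (hΨ : ∀ i, BddMeas fun x => Ψ x i) (y : κ → ℝ)
    {f g : α → ℝ} {A B : ℝ} (hf : ∀ x, |f x| ≤ A) (hg : ∀ x, |g x| ≤ B) :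
    |postCov μ Ψ y f g| ≤ 2 * (A * B) := by
  have hE := bddMeas_logLik hΨ y
  have h1 : |post μ Ψ y (fun x => f x * g x)| ≤ A * B := abs_gibbsMean_le hE fun x => by
    rw [abs_mul]
    exact mul_le_mul (hf x) (hg x) (abs_nonneg _) ((abs_nonneg _).trans (hf x))
  have h2 : |post μ Ψ y f| ≤ A := abs_gibbsMean_le hE hf
  have h3 : |post μ Ψ y g| ≤ B := abs_gibbsMean_le hE hg
  refine (abs_sub _ _).trans ?_
  rw [abs_mul]
  have := mul_le_mul h2 h3 (abs_nonneg _) ((abs_nonneg _).trans h2)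
  linarith

theorem hasDerivAt_post_lineChan (hΦ : ∀ i, BddMeas fun x => Φ x i)
    (hu : ∀ j, BddMeas fun x => u x j) (r : ℝ) (k : J) (p : α × (κ ⊕ J → ℝ)) :
    HasDerivAt (fun r => post μ (lineChan Φ u r) (obs (lineChan Φ u r) p) (fun x => u x k))
      (linePostDeriv μ Φ u r k p) r := by
  have hA : BddMeas fun x => logLik Φ (fun i => Φ p.1 i + p.2 (.inl i)) x := bddMeas_logLik hΦ _
  have hb : BddMeas fun x => ∑ j, p.2 (.inr j) * u x j := BddMeas.sum fun j => (hu j).const_mul _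
  have hc : BddMeas fun x => ∑ j, (u p.1 j * u x j - u x j ^ 2 / 2) :=
    BddMeas.sum fun j => ((hu j).const_mul _).sub (((hu j).pow 2).div_const 2)
  have h := hasDerivAt_gibbsMean (μ := μ) hA hb hc (hu k) r
  have hE : BddMeas (logLik (lineChan Φ u r) (obs (lineChan Φ u r) p)) :=
    bddMeas_logLik (bddMeas_lineChan hΦ hu r) _
  refine (h.congr_deriv ?_).congr_of_eventuallyEq (Filter.Eventually.of_forall fun a => ?_)
  · rw [← logLik_lineChan]
    set E := logLik (lineChan Φ u r) (obs (lineChan Φ u r) p)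
    have hj : ∀ j, BddMeas fun x => (2 * r * u p.1 j + p.2 (.inr j)) * u x j - r * u x j ^ 2 :=
      fun j => ((hu j).const_mul _).sub (((hu j).pow 2).const_mul r)
    have e1 : (fun x => ∑ j, p.2 (.inr j) * u x j +
        2 * r * ∑ j, (u p.1 j * u x j - u x j ^ 2 / 2)) =
        fun x => ∑ j, ((2 * r * u p.1 j + p.2 (.inr j)) * u x j - r * u x j ^ 2) := by
      ext x
      rw [Finset.mul_sum, ← Finset.sum_add_distrib]
      exact Finset.sum_congr rfl fun j _ => by ring
    have e2 : (fun x => u x k * (∑ j, p.2 (.inr j) * u x j +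
        2 * r * ∑ j, (u p.1 j * u x j - u x j ^ 2 / 2))) =
        fun x => ∑ j, ((2 * r * u p.1 j + p.2 (.inr j)) * (u x k * u x j) -
          r * (u x k * u x j ^ 2)) := by
      ext x
      rw [congrFun e1 x, Finset.mul_sum]
      exact Finset.sum_congr rfl fun j _ => by ring
    rw [e1, e2, gibbsMean_sum hE _ hj, gibbsMean_sum hE _ fun j =>
      (((hu k).mul (hu j)).const_mul _).sub (((hu k).mul ((hu j).pow 2)).const_mul r),
      Finset.mul_sum, ← Finset.sum_sub_distrib]
    refine Finset.sum_congr rfl fun j _ => ?_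
    rw [gibbsMean_sub hE ((hu j).const_mul _) (((hu j).pow 2).const_mul r),
      gibbsMean_sub hE (((hu k).mul (hu j)).const_mul _) (((hu k).mul ((hu j).pow 2)).const_mul r)]
    simp only [gibbsMean_const_mul, lineCov, postCov, post]
    ring
  · simp only [post, logLik_lineChan]

/-- The general identity concerns the rescaled variables r u_j; both sides carry a factor r³, which
is removed since r > 0. -/
theorem integral_signal_mul_linePostDeriv (hΦ : ∀ i, BddMeas fun x => Φ x i)
    (hu : ∀ j, BddMeas fun x => u x j) {r : ℝ} (hr : 0 < r) (k : J) :
    ∫ p, u p.1 k * linePostDeriv μ Φ u r k p ∂(chanLaw μ (κ ⊕ J)) =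
      ∑ j, 2 * r * ∫ p, lineCov μ Φ u r k j p ^ 2 ∂(chanLaw μ (κ ⊕ J)) := by
  have hL := bddMeas_lineChan (Φ := Φ) hΦ hu r
  have hC := fun j => (bddMeas_postCov (μ := μ) hL (hu k) (hu j)).obs hL
  have hC2 := fun j => (bddMeas_postCov (μ := μ) hL (hu k) ((hu j).pow 2)).obs hL
  have hint : ∀ j, Integrable (fun p : α × (κ ⊕ J → ℝ) => u p.1 k *
      ((2 * r * u p.1 j + p.2 (.inr j)) * lineCov μ Φ u r k j p -
      r * postCov μ (lineChan Φ u r) (obs (lineChan Φ u r) p) (fun x => u x k)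
        (fun x => u x j ^ 2))) (chanLaw μ (κ ⊕ J)) := by
    intro j
    refine (hu k).signal.mul_integrable ?_
    have h1 := (((((hu j).signal (κ := κ ⊕ J)).const_mul (2 * r)).mul (hC j)).sub
      ((hC2 j).const_mul r)).integrable (chanLaw μ (κ ⊕ J))
    have h2 := integrable_noise_mul (μ := μ) (hC j) (Sum.inr j)
    refine (h1.add h2).congr (Filter.Eventually.of_forall fun p => ?_)
    simp only [Pi.add_apply, lineCov]
    ring
  have e : ∀ p, u p.1 k * linePostDeriv μ Φ u r k p = ∑ j, u p.1 k *
      ((2 * r * u p.1 j + p.2 (.inr j)) * lineCov μ Φ u r k j p -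
      r * postCov μ (lineChan Φ u r) (obs (lineChan Φ u r) p) (fun x => u x k)
        (fun x => u x j ^ 2)) := fun p => by rw [linePostDeriv, Finset.mul_sum]
  rw [integral_congr_ae (Filter.Eventually.of_forall e), integral_finsetSum _ fun j _ => hint j]
  refine Finset.sum_congr rfl fun j _ => ?_
  have h := integral_signal_mul_cov_score (μ := μ) hL (.inr j) (.inr k)
  have c1 : ∀ y, postCov μ (lineChan Φ u r) y (fun x => lineChan Φ u r x (.inr k))
      (fun x => lineChan Φ u r x (.inr j)) = r ^ 2 *
        postCov μ (lineChan Φ u r) y (fun x => u x k) (fun x => u x j) := by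
    intro y
    have e1 : (fun x => lineChan Φ u r x (.inr k) * lineChan Φ u r x (.inr j)) =
        fun x => r ^ 2 * (u x k * u x j) := by
      ext x; simp [lineChan]; ring
    simp only [postCov, post, e1]
    simp only [lineChan, Sum.elim_inr, gibbsMean_const_mul]
    ring
  have c2 : ∀ y, postCov μ (lineChan Φ u r) y (fun x => lineChan Φ u r x (.inr k))
      (fun x => lineChan Φ u r x (.inr j) ^ 2) = r ^ 3 *
        postCov μ (lineChan Φ u r) y (fun x => u x k) (fun x => u x j ^ 2) := by
    intro y
    have e1 : (fun x => lineChan Φ u r x (.inr k) * lineChan Φ u r x (.inr j) ^ 2) =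
        fun x => r ^ 3 * (u x k * u x j ^ 2) := by
      ext x; simp [lineChan]; ring
    have e2 : (fun x => lineChan Φ u r x (.inr j) ^ 2) = fun x => r ^ 2 * (u x j ^ 2) := by
      ext x; simp [lineChan]; ring
    simp only [postCov, post, e1, e2]
    simp only [lineChan, Sum.elim_inr, gibbsMean_const_mul]
    ring
  simp only [c1, c2] at h
  have e3 : ∀ p : α × (κ ⊕ J → ℝ), lineChan Φ u r p.1 (.inr k) *
      ((2 * lineChan Φ u r p.1 (.inr j) + p.2 (.inr j)) * (r ^ 2 *
        postCov μ (lineChan Φ u r) (obs (lineChan Φ u r) p) (fun x => u x k) (fun x => u x j)) -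
        r ^ 3 * postCov μ (lineChan Φ u r) (obs (lineChan Φ u r) p) (fun x => u x k)
          (fun x => u x j ^ 2)) = r ^ 3 * (u p.1 k *
      ((2 * r * u p.1 j + p.2 (.inr j)) * lineCov μ Φ u r k j p -
      r * postCov μ (lineChan Φ u r) (obs (lineChan Φ u r) p) (fun x => u x k)
        (fun x => u x j ^ 2))) := by
    intro p
    simp only [lineChan, Sum.elim_inr, lineCov]
    ring
  have e4 : ∀ p : α × (κ ⊕ J → ℝ), (r ^ 2 * postCov μ (lineChan Φ u r) (obs (lineChan Φ u r) p)
      (fun x => u x k) (fun x => u x j)) ^ 2 = r ^ 4 * lineCov μ Φ u r k j p ^ 2 := by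
    intro p
    simp only [lineCov]
    ring
  rw [integral_congr_ae (Filter.Eventually.of_forall e3),
    integral_congr_ae (Filter.Eventually.of_forall e4), integral_const_mul,
    integral_const_mul] at h
  have hr3 : r ^ 3 ≠ 0 := by positivity
  refine mul_left_cancel₀ hr3 (h.trans ?_)
  ring

/-- The expected overlap of signal and posterior mean increases with the gain. Its total increase is
bounded, and this controls the integral of the squared covariances. -/
theorem hasDerivAt_integral_overlap (hΦ : ∀ i, BddMeas fun x => Φ x i)
    (hu : ∀ j, BddMeas fun x => u x j) {B : ℝ} (hB : ∀ x j, |u x j| ≤ B) (hB0 : 0 ≤ B) {r : ℝ}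
    (hr : 0 < r) :
    HasDerivAt (fun r => ∑ k, ∫ p, u p.1 k *
      post μ (lineChan Φ u r) (obs (lineChan Φ u r) p) (fun x => u x k) ∂(chanLaw μ (κ ⊕ J)))
      (2 * r * ∑ k, ∑ j, ∫ p, lineCov μ Φ u r k j p ^ 2 ∂(chanLaw μ (κ ⊕ J))) r := by
  have hL := fun r => bddMeas_lineChan (Φ := Φ) hΦ hu r
  have hsum : 2 * r * ∑ k, ∑ j, ∫ p, lineCov μ Φ u r k j p ^ 2 ∂(chanLaw μ (κ ⊕ J)) =
      ∑ k, ∫ p, u p.1 k * linePostDeriv μ Φ u r k p ∂(chanLaw μ (κ ⊕ J)) := by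
    rw [Finset.mul_sum]
    refine Finset.sum_congr rfl fun k _ => ?_
    rw [integral_signal_mul_linePostDeriv hΦ hu hr, Finset.mul_sum]
  rw [hsum]
  refine HasDerivAt.fun_sum fun k _ => ?_
  have hm : ∀ r, BddMeas fun p : α × (κ ⊕ J → ℝ) => u p.1 k *
      post μ (lineChan Φ u r) (obs (lineChan Φ u r) p) (fun x => u x k) := fun r =>
    (hu k).signal.mul ((bddMeas_post (hL r) (hu k)).obs (hL r))
  refine (hasDerivAt_integral_of_dominated_loc_of_deriv_le
    (bound := fun p => B * ∑ j, ((2 * (r + 1) * B + |p.2 (.inr j)|) * (2 * (B * B)) +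
      (r + 1) * (2 * (B * B ^ 2))))
    (Metric.ball_mem_nhds r one_pos) (Filter.Eventually.of_forall fun s =>
      (hm s).1.aestronglyMeasurable) ((hm r).integrable _) ?_
    (Filter.Eventually.of_forall fun p s hs => ?_) ?_
    (Filter.Eventually.of_forall fun p s _ =>
      (hasDerivAt_post_lineChan hΦ hu s k p).const_mul (u p.1 k))).2
  · refine ((hu k).1.comp measurable_fst).aestronglyMeasurable.mul ?_
    refine (Finset.measurable_fun_sum _ fun j _ => ?_).aestronglyMeasurable
    have h1 := ((bddMeas_postCov (μ := μ) (hL r) (hu k) (hu j)).obs (hL r)).1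
    have h2 := ((bddMeas_postCov (μ := μ) (hL r) (hu k) ((hu j).pow 2)).obs (hL r)).1
    have h3 : Measurable fun p : α × (κ ⊕ J → ℝ) => u p.1 j := (hu j).1.comp measurable_fst
    have h4 : Measurable fun p : α × (κ ⊕ J → ℝ) => p.2 (.inr j) :=
      (measurable_pi_apply _).comp measurable_snd
    exact (((h3.const_mul _).add h4).mul h1).sub (h2.const_mul r)
  · have hs' : |s| ≤ r + 1 := by
      have : |s - r| < 1 := by simpa [Real.dist_eq] using hs
      rw [abs_lt] at this
      rw [abs_le]
      constructor <;> linarith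
    rw [Real.norm_eq_abs, abs_mul]
    refine mul_le_mul (hB _ _) ?_ (abs_nonneg _) hB0
    refine (Finset.abs_sum_le_sum_abs _ _).trans (Finset.sum_le_sum fun j _ => ?_)
    refine (abs_sub _ _).trans (add_le_add ?_ ?_)
    · rw [abs_mul]
      refine mul_le_mul ?_ (abs_postCov_le (hL s) _ (fun x => hB x k) (fun x => hB x j))
        (abs_nonneg _) (by positivity)
      refine (abs_add_le _ _).trans (add_le_add_left ?_ _)
      rw [abs_mul, abs_mul, abs_two]
      exact mul_le_mul (by linarith) (hB _ _) (abs_nonneg _) (by positivity)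
    · rw [abs_mul]
      refine mul_le_mul hs' (abs_postCov_le (hL s) _ (fun x => hB x k) (fun x => ?_))
        (abs_nonneg _) (by positivity)
      rw [abs_pow]
      exact pow_le_pow_left₀ (abs_nonneg _) (hB x j) 2
  · refine (integrable_finsetSum _ fun j _ => ?_).const_mul B
    exact (((integrable_const _).add
      (((memLp_noise (μ := μ) (Sum.inr j : κ ⊕ J)).integrable one_le_two).abs)).mul_const _).add
      (integrable_const _)

/-- The posterior correlations between the variables `u j` are small on average over the gain. -/
theorem lintegral_lineCov_sq_le (hΦ : ∀ i, BddMeas fun x => Φ x i)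
    (hu : ∀ j, BddMeas fun x => u x j) {B : ℝ} (hB : ∀ x j, |u x j| ≤ B) (hB0 : 0 ≤ B) {a b : ℝ}
    (ha : 0 < a) (hab : a ≤ b) :
    ∫⁻ r in Set.Icc a b, ENNReal.ofReal
      (2 * r * ∑ k, ∑ j, ∫ p, lineCov μ Φ u r k j p ^ 2 ∂(chanLaw μ (κ ⊕ J))) ≤
      ENNReal.ofReal (2 * (Fintype.card J * B ^ 2)) := by
  have hL := fun r => bddMeas_lineChan (Φ := Φ) hΦ hu r
  set e : ℝ → ℝ := fun r => ∑ k, ∫ p, u p.1 k *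
      post μ (lineChan Φ u r) (obs (lineChan Φ u r) p) (fun x => u x k) ∂(chanLaw μ (κ ⊕ J)) with he
  set e' : ℝ → ℝ := fun r =>
    2 * r * ∑ k, ∑ j, ∫ p, lineCov μ Φ u r k j p ^ 2 ∂(chanLaw μ (κ ⊕ J)) with he'
  have hd : ∀ r ∈ Set.Icc a b, HasDerivAt e (e' r) r := fun r hr =>
    hasDerivAt_integral_overlap hΦ hu hB hB0 (ha.trans_le hr.1)
  have hpos : ∀ r ∈ Set.Icc a b, 0 ≤ e' r := fun r hr =>
    mul_nonneg (by linarith [hr.1]) (Finset.sum_nonneg fun k _ => Finset.sum_nonneg fun j _ =>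
      integral_nonneg fun p => sq_nonneg _)
  have hcont : ContinuousOn e (Set.Icc a b) := fun r hr => (hd r hr).continuousAt.continuousWithinAt
  -- A nonnegative derivative is automatically integrable, so the fundamental theorem needs no
  -- continuity of the squared covariances in r.
  have hio : IntegrableOn e' (Set.Ioc a b) := intervalIntegral.integrableOn_deriv_of_nonneg hcont
    (fun r hr => hd r ⟨hr.1.le, hr.2.le⟩) (fun r hr => hpos r ⟨hr.1.le, hr.2.le⟩)
  have hii : IntervalIntegrable e' volume a b :=
    (intervalIntegrable_iff_integrableOn_Ioc_of_le hab).2 hio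
  have hftc := intervalIntegral.integral_eq_sub_of_hasDerivAt
    (fun r hr => hd r (by rwa [Set.uIcc_of_le hab] at hr)) hii
  have hbound : ∀ r, |e r| ≤ Fintype.card J * B ^ 2 := by
    intro r
    have : ∀ k ∈ (Finset.univ : Finset J), |∫ p, u p.1 k *
        post μ (lineChan Φ u r) (obs (lineChan Φ u r) p) (fun x => u x k) ∂(chanLaw μ (κ ⊕ J))| ≤
        B ^ 2 := by
      intro k _
      have := norm_integral_le_of_norm_le_const (μ := chanLaw μ (κ ⊕ J)) (C := B ^ 2)
        (f := fun p => u p.1 k *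
          post μ (lineChan Φ u r) (obs (lineChan Φ u r) p) (fun x => u x k))
        (Filter.Eventually.of_forall fun p => by
          rw [Real.norm_eq_abs, abs_mul, pow_two]
          exact mul_le_mul (hB _ _) (abs_gibbsMean_le (bddMeas_logLik (hL r) _) fun x => hB x k)
            (abs_nonneg _) hB0)
      simpa using this
    refine (Finset.abs_sum_le_sum_abs _ _).trans ((Finset.sum_le_sum this).trans ?_)
    simp
  rw [← ofReal_integral_eq_lintegral_ofReal
    ((intervalIntegrable_iff_integrableOn_Icc_of_le hab).1 hii)
    ((ae_restrict_iff' measurableSet_Icc).2 (Filter.Eventually.of_forall hpos)),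
    integral_Icc_eq_integral_Ioc, ← intervalIntegral.integral_of_le hab, hftc]
  refine ENNReal.ofReal_le_ofReal ?_
  have h1 := (abs_le.1 (hbound b)).2
  have h2 := (abs_le.1 (hbound a)).1
  linarith

end Thermal

end TensorOverlap

namespace TensorOverlap

/-! ### The matrix square root. -/

section MatSqrt

open scoped MatrixOrder in
theorem matSqrt_mul_self {K : ℕ} {R : Matrix (Fin K) (Fin K) ℝ} (hR : R.PosSemidef) :
    matSqrt R * matSqrt R = R := by
  have hsa : IsSelfAdjoint R := hR.1
  unfold matSqrt
  rw [← cfc_mul Real.sqrt Real.sqrt R]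
  conv_rhs => rw [← cfc_id ℝ R]
  refine cfc_congr fun x hx => ?_
  exact Real.mul_self_sqrt (spectrum_nonneg_of_nonneg hR.nonneg hx)

theorem transpose_matSqrt {K : ℕ} (R : Matrix (Fin K) (Fin K) ℝ) :
    (matSqrt R).transpose = matSqrt R := by
  have h : IsSelfAdjoint (matSqrt R) := cfc_predicate Real.sqrt R
  ext i j
  exact congrFun (congrFun h.star_eq i) j

-- The operator norm supplies the C*-algebra for which the functional calculus is continuous; its
-- topology is the entrywise one. Continuity of all brackets in R rests on this.
open scoped Matrix.Norms.L2Operator in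
theorem continuousOn_matSqrt (K : ℕ) :
    ContinuousOn (matSqrt (K := K)) {R | R.PosSemidef} :=
  ContinuousOn.cfc_of_mem_nhdsSet (A := Matrix (Fin K) (Fin K) ℝ) (p := IsSelfAdjoint)
    (s := Set.univ) Real.sqrt (a := id) (t := {R : Matrix (Fin K) (Fin K) ℝ | R.PosSemidef})
    Filter.univ_mem continuousOn_id (fun _ hR => hR.1) Real.continuous_sqrt.continuousOn

theorem sum_matSqrt_mul {K : ℕ} {R : Matrix (Fin K) (Fin K) ℝ} (hR : R.PosSemidef) (l l' : Fin K) :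
    ∑ k, matSqrt R l k * matSqrt R l' k = R l l' := by
  have h := congrFun (congrFun (matSqrt_mul_self hR) l) l'
  rw [Matrix.mul_apply] at h
  rw [← h]
  refine Finset.sum_congr rfl fun k _ => ?_
  have hsym : matSqrt R k l' = matSqrt R l' k := congrFun (congrFun (transpose_matSqrt R) l') k
  rw [hsym]

theorem abs_matSqrt_le {K : ℕ} {R : Matrix (Fin K) (Fin K) ℝ} (hR : R.PosSemidef) {M : ℝ}
    (hM : ∀ l, R l l ≤ M) (l k : Fin K) : |matSqrt R l k| ≤ √M := by
  refine Real.abs_le_sqrt ((le_trans ?_ (sum_matSqrt_mul hR l l).le).trans (hM l))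
  rw [pow_two]
  exact Finset.single_le_sum (f := fun k => matSqrt R l k * matSqrt R l k)
    (fun k _ => mul_self_nonneg _) (Finset.mem_univ k)

end MatSqrt

/-! ### The tensor model as a Gaussian field, and its line channels. -/

section Field

variable {n K p : ℕ}

/-- The space of Gaussian fields: noise on the tensor entries and a field on the rows. -/
abbrev Field (n K p : ℕ) : Type := (TensorIndex n p → ℝ) × (Fin n → Fin K → ℝ)

/-- The field induced by the noise through the gains `S`. -/
def rowField (S : Matrix (Fin K) (Fin K) ℝ) (q : Field n K p) : Field n K p :=
  (q.1, fun j l => ∑ k, S l k * q.2 j k)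

/-- Minus the Hamiltonian, in terms of the signal `X` and the field `q`. -/
noncomputable def fieldExp (t : ℝ) (R : Matrix (Fin K) (Fin K) ℝ) (X : Config n K) (q : Field n K p)
    (x : Config n K) : ℝ :=
  (∑ i : TensorIndex n p, ((√(tensorSnr n p t) * tensorEntry X i + q.1 i) *
      (√(tensorSnr n p t) * tensorEntry x i) - (√(tensorSnr n p t) * tensorEntry x i) ^ 2 / 2)) +
  ∑ j, ((∑ l, ∑ l', R l l' * (x j l * X j l' - x j l * x j l' / 2)) + ∑ l, q.2 j l * x j l)

theorem tensorSnr_nonneg {t : ℝ} (ht : t ≤ 1) : 0 ≤ tensorSnr n p t := by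
  unfold tensorSnr
  have : 0 ≤ 1 - t := by linarith
  positivity

/-- The square root occurs only in the combination √R √R = R and in the field √R Z̃. Any
factorisation of R that gives the field the same covariance therefore gives the same model. -/
theorem neg_hamiltonian_eq {t : ℝ} (ht : t ≤ 1) {R : Matrix (Fin K) (Fin K) ℝ} (hR : R.PosSemidef)
    (ω : Disorder n K p) (x : Config n K) :
    -hamiltonian t R (obsTensor t ω) (obsVector R ω) x =
      fieldExp t R ω.1 (rowField (matSqrt R) ω.2) x := by
  have hs := Real.sq_sqrt (tensorSnr_nonneg (n := n) (p := p) ht)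
  unfold hamiltonian fieldExp
  rw [neg_add, ← Finset.sum_neg_distrib, ← Finset.sum_neg_distrib]
  congr 1
  · refine Finset.sum_congr rfl fun i _ => ?_
    simp only [obsTensor, rowField]
    linear_combination ((tensorEntry x i) ^ 2 / 2) * hs
  · refine Finset.sum_congr rfl fun j _ => ?_
    have e1 : obsVector R ω j ⬝ᵥ (matSqrt R).mulVec (x j) =
        x j ⬝ᵥ R.mulVec (ω.1 j) + ∑ l, (rowField (matSqrt R) ω.2).2 j l * x j l := by
      have a1 : (matSqrt R).mulVec (ω.1 j) ⬝ᵥ (matSqrt R).mulVec (x j) =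
          x j ⬝ᵥ R.mulVec (ω.1 j) := by
        conv_rhs => rw [← matSqrt_mul_self hR]
        rw [← Matrix.mulVec_mulVec, Matrix.dotProduct_mulVec (x j), ← Matrix.mulVec_transpose,
          transpose_matSqrt, dotProduct_comm]
      rw [obsVector, add_dotProduct, a1]
      congr 1
      rw [Matrix.dotProduct_mulVec, ← Matrix.mulVec_transpose, transpose_matSqrt]
      rfl
    rw [e1]
    have e2 : ∀ y : Fin K → ℝ, x j ⬝ᵥ R.mulVec y = ∑ l, ∑ l', R l l' * (x j l * y l') := by
      intro y
      simp only [dotProduct, Matrix.mulVec, Finset.mul_sum]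
      exact Finset.sum_congr rfl fun l _ => Finset.sum_congr rfl fun l' _ => by ring
    rw [e2, e2]
    have e3 : ∑ l, ∑ l', R l l' * (x j l * ω.1 j l' - x j l * x j l' / 2) =
        ∑ l, ∑ l', R l l' * (x j l * ω.1 j l') -
          1 / 2 * ∑ l, ∑ l', R l l' * (x j l * x j l') := by
      simp only [Finset.mul_sum, ← Finset.sum_sub_distrib]
      exact Finset.sum_congr rfl fun l _ => Finset.sum_congr rfl fun l' _ => by ring
    rw [e3]
    ring

/-- Coordinatewise truncation of the rows at level `B`. -/
def truncRows (B : ℝ) (x : Config n K) : Config n K := fun j k => max (-B) (min B (x j k))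

theorem abs_truncRows_le {B : ℝ} (hB : 0 ≤ B) (x : Config n K) (j : Fin n) (k : Fin K) :
    |truncRows B x j k| ≤ B :=
  abs_le.2 ⟨le_max_left _ _, max_le (by linarith) (min_le_left _ _)⟩

theorem measurable_truncRows (B : ℝ) : Measurable (truncRows B : Config n K → Config n K) := by
  unfold truncRows
  fun_prop

theorem truncRows_eq {B : ℝ} {x : Config n K} (h : ∀ j, ‖x j‖ ≤ B) : truncRows B x = x := by
  ext j k
  have := abs_le.1 ((norm_le_pi_norm (x j) k).trans (h j))
  simp only [truncRows]
  rw [min_eq_right this.2, max_eq_right this.1]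

theorem truncRows_update (B : ℝ) (x : Config n K) (j : Fin n) (a : Fin K → ℝ) {j' : Fin n}
    (h : j' ≠ j) : truncRows B (Function.update x j a) j' = truncRows B x j' := by
  ext k
  simp [truncRows, Function.update_of_ne h]

/-- The support is bounded only almost surely, whereas `BddMeas` asks for bounds everywhere.
Truncation supplies them without changing any average. -/
theorem ae_truncRows_eq {P : Measure (Fin K → ℝ)} [IsProbabilityMeasure P] {B : ℝ}
    (hP : ∀ᵐ x ∂P, ‖x‖ ≤ B) (n : ℕ) :
    ∀ᵐ x ∂(Measure.pi fun _ : Fin n => P), truncRows B x = x := by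
  have : ∀ᵐ x ∂(Measure.pi fun _ : Fin n => P), ∀ j, ‖x j‖ ≤ B :=
    ae_all_iff.2 fun j => (measurePreserving_eval (fun _ : Fin n => P) j).quasiMeasurePreserving.ae hP
  exact this.mono fun x hx => truncRows_eq hx

/-- The channel of the tensor entries and of the rows with gains `S`, for truncated signals. -/
noncomputable def baseChan (B t : ℝ) (S : Matrix (Fin K) (Fin K) ℝ) (x : Config n K) :
    TensorIndex n p ⊕ Fin n × Fin K → ℝ :=
  Sum.elim (fun i => √(tensorSnr n p t) * tensorEntry (truncRows B x) i)
    fun q => ∑ l, S l q.2 * truncRows B x q.1 l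

/-- Linear form of the truncated rows. -/
def rowForm (B : ℝ) (v : Fin K → ℝ) (x : Config n K) (j : Fin n) : ℝ :=
  ∑ l, v l * truncRows B x j l

theorem bddMeas_truncRows {B : ℝ} (hB : 0 ≤ B) (j : Fin n) (k : Fin K) :
    BddMeas fun x : Config n K => truncRows B x j k :=
  ⟨(measurable_pi_apply k).comp ((measurable_pi_apply j).comp (measurable_truncRows B)), B,
    fun x => abs_truncRows_le hB x j k⟩

theorem BddMeas.prod {α ι : Type*} [MeasurableSpace α] {s : Finset ι} {f : ι → α → ℝ}
    (hf : ∀ i, BddMeas (f i)) : BddMeas fun x => ∏ i ∈ s, f i x := by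
  classical
  induction s using Finset.induction_on with
  | empty => simpa using BddMeas.const 1
  | insert a s ha ih => simpa [Finset.prod_insert ha] using (hf a).mul ih

theorem bddMeas_tensorEntry {B : ℝ} (hB : 0 ≤ B) (i : TensorIndex n p) :
    BddMeas fun x : Config n K => tensorEntry (truncRows B x) i :=
  BddMeas.sum fun k => BddMeas.prod fun a => bddMeas_truncRows hB (i.1 a) k

theorem abs_tensorEntry_le {B : ℝ} (hB : 0 ≤ B) (x : Config n K) (i : TensorIndex n p) :
    |tensorEntry (truncRows B x) i| ≤ K * B ^ p := by
  refine (Finset.abs_sum_le_sum_abs _ _).trans ?_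
  have : ∀ k ∈ (Finset.univ : Finset (Fin K)), |∏ a, truncRows B x (i.1 a) k| ≤ B ^ p := by
    intro k _
    rw [Finset.abs_prod]
    refine (Finset.prod_le_prod (fun _ _ => abs_nonneg _)
      fun a _ => abs_truncRows_le hB x (i.1 a) k).trans ?_
    simp
  refine (Finset.sum_le_sum this).trans ?_
  simp

theorem bddMeas_baseChan {B : ℝ} (hB : 0 ≤ B) (t : ℝ) (S : Matrix (Fin K) (Fin K) ℝ)
    (i : TensorIndex n p ⊕ Fin n × Fin K) :
    BddMeas fun x : Config n K => baseChan B t S x i := by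
  cases i with
  | inl i => exact (bddMeas_tensorEntry hB i).const_mul _
  | inr q =>
    simp only [baseChan, Sum.elim_inr]
    exact BddMeas.sum fun l => (bddMeas_truncRows hB q.1 l).const_mul _

theorem bddMeas_rowForm {B : ℝ} (hB : 0 ≤ B) (v : Fin K → ℝ) (j : Fin n) :
    BddMeas fun x : Config n K => rowForm B v x j :=
  BddMeas.sum fun l => (bddMeas_truncRows hB j l).const_mul _

/-- The noise of the line channel, seen as a field. -/
def lineField (S : Matrix (Fin K) (Fin K) ℝ) (v : Fin K → ℝ)
    (z : (TensorIndex n p ⊕ Fin n × Fin K) ⊕ Fin n → ℝ) : Field n K p :=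
  (fun i => z (.inl (.inl i)),
    fun j l => (∑ k, S l k * z (.inl (.inr (j, k)))) + v l * z (.inr j))

theorem sq_sum_eq (S : Matrix (Fin K) (Fin K) ℝ) (x X : Fin K → ℝ) :
    ∑ k, (∑ l, S l k * x l) * (∑ l, S l k * X l) =
      ∑ l, ∑ l', (∑ k, S l k * S l' k) * (x l * X l') := by
  simp only [Finset.sum_mul_sum]
  rw [Finset.sum_comm]
  refine Finset.sum_congr rfl fun l _ => ?_
  rw [Finset.sum_comm]
  refine Finset.sum_congr rfl fun l' _ => ?_
  rw [Finset.sum_mul]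
  exact Finset.sum_congr rfl fun k _ => by ring

/-- Compares quadratic forms: the gains S and the extra direction r v together have the
signal-to-noise matrix S Sᵀ + r² v vᵀ. Here S need not be the square root of R. -/
theorem logLik_baseChan_line {B t : ℝ} {S R : Matrix (Fin K) (Fin K) ℝ} {v : Fin K → ℝ} {r : ℝ}
    (hR : ∀ l l', (∑ k, S l k * S l' k) + r ^ 2 * (v l * v l') = R l l')
    (p' : Config n K × ((TensorIndex n p ⊕ Fin n × Fin K) ⊕ Fin n → ℝ)) :
    logLik (lineChan (baseChan B t S) (rowForm B v) r)
      (obs (lineChan (baseChan B t S) (rowForm B v) r) p') =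
      fun x => fieldExp t R (truncRows B p'.1) (lineField S (fun l => r * v l) p'.2)
        (truncRows B x) := by
  ext x
  simp only [logLik, obs, lineChan, Fintype.sum_sum_type, Sum.elim_inl, Sum.elim_inr, Pi.add_apply,
    baseChan, fieldExp, lineField, Fintype.sum_prod_type, add_assoc, ← Finset.sum_add_distrib]
  congr 1
  refine Finset.sum_congr rfl fun j _ => ?_
  set y := truncRows B x j
  set Y := truncRows B p'.1 j
  have h1 := sq_sum_eq S y Y
  have h2 := sq_sum_eq S y y
  have e1 : ∑ k, (((∑ l, S l k * Y l) + p'.2 (.inl (.inr (j, k)))) * (∑ l, S l k * y l) -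
      (∑ l, S l k * y l) ^ 2 / 2) = ∑ k, (∑ l, S l k * y l) * (∑ l, S l k * Y l) -
      1 / 2 * ∑ k, (∑ l, S l k * y l) * (∑ l, S l k * y l) +
      ∑ l, (∑ k, S l k * p'.2 (.inl (.inr (j, k)))) * y l := by
    have : ∑ l, (∑ k, S l k * p'.2 (.inl (.inr (j, k)))) * y l =
        ∑ k, p'.2 (.inl (.inr (j, k))) * (∑ l, S l k * y l) := by
      simp only [Finset.sum_mul, Finset.mul_sum]
      rw [Finset.sum_comm]
      exact Finset.sum_congr rfl fun k _ => Finset.sum_congr rfl fun l _ => by ring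
    rw [this, Finset.mul_sum, ← Finset.sum_sub_distrib, ← Finset.sum_add_distrib]
    exact Finset.sum_congr rfl fun k _ => by ring
  have e2 : ∀ w w' : Fin K → ℝ, (∑ l, v l * w l) * (∑ l, v l * w' l) =
      ∑ l, ∑ l', (v l * v l') * (w l * w' l') := by
    intro w w'
    rw [Finset.sum_mul_sum]
    exact Finset.sum_congr rfl fun l _ => Finset.sum_congr rfl fun l' _ => by ring
  have e3 : (r * rowForm B v p'.1 j + p'.2 (.inr j)) * (r * rowForm B v x j) -
      (r * rowForm B v x j) ^ 2 / 2 = r ^ 2 * ∑ l, ∑ l', (v l * v l') * (y l * Y l') -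
      1 / 2 * (r ^ 2 * ∑ l, ∑ l', (v l * v l') * (y l * y l')) +
      ∑ l, r * v l * p'.2 (.inr j) * y l := by
    rw [← e2, ← e2]
    have : ∑ l, r * v l * p'.2 (.inr j) * y l = r * p'.2 (.inr j) * ∑ l, v l * y l := by
      rw [Finset.mul_sum]
      exact Finset.sum_congr rfl fun l _ => by ring
    rw [this]
    simp only [rowForm, y, Y]
    ring
  have e4 : ∀ w w' : Fin K → ℝ, ∑ l, ∑ l', R l l' * (w l * w' l') =
      ∑ l, ∑ l', (∑ k, S l k * S l' k) * (w l * w' l') +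
      r ^ 2 * ∑ l, ∑ l', (v l * v l') * (w l * w' l') := by
    intro w w'
    simp only [Finset.mul_sum, ← Finset.sum_add_distrib]
    refine Finset.sum_congr rfl fun l _ => Finset.sum_congr rfl fun l' _ => ?_
    rw [← hR]; ring
  have e5 : ∑ l, ∑ l', R l l' * (y l * Y l' - y l * y l' / 2) =
      ∑ l, ∑ l', R l l' * (y l * Y l') - 1 / 2 * ∑ l, ∑ l', R l l' * (y l * y l') := by
    simp only [Finset.mul_sum, ← Finset.sum_sub_distrib]
    exact Finset.sum_congr rfl fun l _ => Finset.sum_congr rfl fun l' _ => by ring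
  have e6 : ∑ l, ((∑ k, S l k * p'.2 (.inl (.inr (j, k)))) + r * v l * p'.2 (.inr j)) * y l =
      ∑ l, (∑ k, S l k * p'.2 (.inl (.inr (j, k)))) * y l + ∑ l, r * v l * p'.2 (.inr j) * y l := by
    rw [← Finset.sum_add_distrib]
    exact Finset.sum_congr rfl fun l _ => by ring
  rw [e1, e3, Finset.sum_add_distrib, e5, e4, e4, e6, h1, h2]
  ring

theorem measurable_lineField (S : Matrix (Fin K) (Fin K) ℝ) (v : Fin K → ℝ) :
    Measurable (lineField (n := n) (p := p) S v) := by
  unfold lineField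
  fun_prop

theorem measurable_rowField (S : Matrix (Fin K) (Fin K) ℝ) :
    Measurable (rowField (n := n) (p := p) S) := by
  unfold rowField
  fun_prop

instance (P : Measure (Fin K → ℝ)) [IsProbabilityMeasure P] :
    IsProbabilityMeasure (disorderLaw P n p) := by
  unfold disorderLaw
  infer_instance

/-- The joint law of signal and field is the same for the line channel and for the model with
signal-to-noise matrix `R`. -/
theorem map_lineField_eq (P : Measure (Fin K → ℝ)) [IsProbabilityMeasure P]
    {S R : Matrix (Fin K) (Fin K) ℝ} (hRp : R.PosSemidef) {v : Fin K → ℝ} {r : ℝ}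
    (hR : ∀ l l', (∑ k, S l k * S l' k) + r ^ 2 * (v l * v l') = R l l') :
    (chanLaw (Measure.pi fun _ : Fin n => P) ((TensorIndex n p ⊕ Fin n × Fin K) ⊕ Fin n)).map
        (Prod.map id (lineField S fun l => r * v l)) =
      (disorderLaw P n p).map (Prod.map id (rowField (matSqrt R))) := by
  have h := map_noise_eq (ι := TensorIndex n p) (J := Fin n) S (matSqrt R) (fun l => r * v l)
    (fun y => by
      simp only [pow_two]
      rw [sq_sum_eq, sq_sum_eq, Finset.sum_mul_sum, ← Finset.sum_add_distrib]
      refine Finset.sum_congr rfl fun l _ => ?_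
      rw [← Finset.sum_add_distrib]
      refine Finset.sum_congr rfl fun l' _ => ?_
      rw [sum_matSqrt_mul hRp, ← hR]
      ring)
  have h1 := Measure.map_prod_map (f := id) (Measure.pi fun _ : Fin n => P)
    (stdGauss ((TensorIndex n p ⊕ Fin n × Fin K) ⊕ Fin n)) measurable_id
    (measurable_lineField (n := n) (p := p) S fun l => r * v l)
  have h2 := Measure.map_prod_map (f := id) (Measure.pi fun _ : Fin n => P)
    ((stdGauss (TensorIndex n p)).prod (Measure.pi fun _ : Fin n => stdGauss (Fin K)))
    measurable_id (measurable_rowField (n := n) (p := p) (matSqrt R))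
  unfold disorderLaw
  refine h1.symm.trans (Eq.trans ?_ h2)
  congr 1

end Field

end TensorOverlap

namespace TensorOverlap

/-! ### Variance of the free energy. -/

section FreeEnergyVariance

variable {S κ : Type*} [MeasurableSpace S] [Fintype κ] {n : ℕ}

/-- Total variance separates noise from signal. The free energy is `c i`-Lipschitz in the noise
coordinate i, which costs c_i² since E(z - z')² = 2. Replacing one row changes it by at most d,
which costs d²/2 for each of the n rows. -/
theorem variance_freeEnergy_le (P : Measure S) [IsProbabilityMeasure P]
    {Φ : (Fin n → S) → κ → ℝ} (hΦ : ∀ i, BddMeas fun x => Φ x i) {c : κ → ℝ}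
    (hc : ∀ x i, |Φ x i| ≤ c i) {d : ℝ}
    (hd : ∀ j x a b, ∑ i, |Φ (Function.update x j a) i - Φ (Function.update x j b) i| * c i ≤ d) :
    Var[freeEnergy (Measure.pi fun _ => P) Φ; chanLaw (Measure.pi fun _ => P) κ] ≤
      ∑ i, c i ^ 2 + n * (d ^ 2 / 2) := by
  classical
  set μ : Measure (Fin n → S) := Measure.pi fun _ => P with hμ
  have hF := memLp_freeEnergy (μ := μ) hΦ
  have hFm := measurable_freeEnergy (μ := μ) hΦ
  have hslice : ∀ x, MemLp (fun z => freeEnergy μ Φ (x, z)) 2 (stdGauss κ) := by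
    intro x
    have hb : MemLp (fun z : κ → ℝ => ∑ i, ((c i + |z i|) * c i + c i ^ 2)) 2 (stdGauss κ) :=
      memLp_finsetSum _ fun i _ => (((memLp_const (c i)).add
        (memLp_coord_stdGauss i).abs).mul_const (c i)).add (memLp_const (c i ^ 2))
    exact hb.of_le (hFm.comp measurable_prodMk_left).aestronglyMeasurable
      (Filter.Eventually.of_forall fun z =>
        (abs_freeEnergy_le hΦ hc (x, z)).trans (le_abs_self _))
  have hX : ∀ j x a b z, |freeEnergy μ Φ (Function.update x j a, z) -
      freeEnergy μ Φ (Function.update x j b, z)| ≤ d := by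
    intro j x a b z
    refine abs_log_integral_exp_sub_le (bddMeas_logLik hΦ _) (bddMeas_logLik hΦ _) fun y =>
      le_trans ?_ (hd j x a b)
    rw [logLik, logLik, ← Finset.sum_sub_distrib]
    refine (Finset.abs_sum_le_sum_abs _ _).trans (Finset.sum_le_sum fun i _ => ?_)
    have : (obs Φ (Function.update x j a, z) i * Φ y i - Φ y i ^ 2 / 2 -
        (obs Φ (Function.update x j b, z) i * Φ y i - Φ y i ^ 2 / 2)) =
        (Φ (Function.update x j a) i - Φ (Function.update x j b) i) * Φ y i := by
      simp only [obs, Pi.add_apply]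
      ring
    rw [this, abs_mul]
    exact mul_le_mul_of_nonneg_left (hc y i) (abs_nonneg _)
  refine variance_prod_le μ (stdGauss κ) hF (fun x => ?_) ?_
  · have hi : ∀ i, Integrable (fun q : ℝ × ℝ => (c i * |q.1 - q.2|) ^ 2)
        ((gaussianReal 0 1).prod (gaussianReal 0 1)) := by
      intro i
      have := (integrable_sub_sq_prod (gaussianReal 0 1)
        (memLp_id_gaussianReal (μ := 0) (v := 1) 2)).const_mul (c i ^ 2)
      refine this.congr (Filter.Eventually.of_forall fun q => ?_)
      simp only [id, mul_pow, sq_abs]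
    refine (variance_pi_le (gaussianReal 0 1) (F := fun z => freeEnergy μ Φ (x, z))
      (hFm.comp measurable_prodMk_left) (hslice x) (D := fun i a b => c i * |a - b|)
      (fun i z a b => ?_) hi).trans (le_of_eq ?_)
    · refine abs_log_integral_exp_sub_le (bddMeas_logLik hΦ _) (bddMeas_logLik hΦ _) fun y => ?_
      have : logLik Φ (obs Φ (x, Function.update z i a)) y -
          logLik Φ (obs Φ (x, Function.update z i b)) y = Φ y i * (a - b) := by
        rw [logLik, logLik, ← Finset.sum_sub_distrib, Finset.sum_eq_single i]
        · simp [obs]; ring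
        · intro k _ hk
          simp [obs, Function.update_of_ne hk]
        · simp
      rw [this, abs_mul]
      exact mul_le_mul_of_nonneg_right (hc y i) (abs_nonneg _)
    · refine Finset.sum_congr rfl fun i _ => ?_
      have h2 := integral_sub_sq_prod (gaussianReal 0 1)
        (memLp_id_gaussianReal (μ := 0) (v := 1) 2)
      rw [variance_id_gaussianReal] at h2
      simp only [mul_pow, sq_abs]
      rw [integral_const_mul]
      simp only [id] at h2
      rw [h2]
      push_cast
      ring
  · have hm : Measurable fun x => ∫ z, freeEnergy μ Φ (x, z) ∂(stdGauss κ) :=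
      (hFm.stronglyMeasurable.integral_prod_right').measurable
    have hL : MemLp (fun x => ∫ z, freeEnergy μ Φ (x, z) ∂(stdGauss κ)) 2 μ := by
      refine MemLp.of_bound hm.aestronglyMeasurable
        (∫ z : κ → ℝ, ∑ i, ((c i + |z i|) * c i + c i ^ 2) ∂(stdGauss κ))
        (Filter.Eventually.of_forall fun x => ?_)
      refine norm_integral_le_of_norm_le (integrable_finsetSum _ fun i _ => ?_)
        (Filter.Eventually.of_forall fun z => abs_freeEnergy_le hΦ hc (x, z))
      exact (((integrable_const (c i)).add
        (integrable_coord_stdGauss i).abs).mul_const (c i)).add (integrable_const (c i ^ 2))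
    refine (variance_pi_le P hm hL (D := fun _ _ _ => d) (fun j x a b => ?_)
      (fun _ => integrable_const _)).trans (le_of_eq ?_)
    · rw [← integral_sub ((hslice _).integrable one_le_two) ((hslice _).integrable one_le_two)]
      have := norm_integral_le_of_norm_le_const (μ := stdGauss κ)
        (f := fun z => freeEnergy μ Φ (Function.update x j a, z) -
          freeEnergy μ Φ (Function.update x j b, z)) (Filter.Eventually.of_forall (hX j x a b))
      simpa using this
    · simp only [integral_const, probReal_univ, one_smul, Finset.sum_const, Finset.card_univ,
        Fintype.card_fin, nsmul_eq_mul]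
      ring

end FreeEnergyVariance

/-! ### Tensor entries that involve a given row. -/

section Counting

theorem card_tensorIndex_le (n p : ℕ) : Fintype.card (TensorIndex n p) ≤ n ^ p := by
  refine (Fintype.card_subtype_le _).trans ?_
  simp

theorem card_filter_apply_eq (n p : ℕ) (a : Fin p) (j : Fin n) :
    (Finset.univ.filter fun i : Fin p → Fin n => i a = j).card = n ^ (p - 1) := by
  have : (Finset.univ.filter fun i : Fin p → Fin n => i a = j) =
      Fintype.piFinset
        (Function.update (fun _ => (Finset.univ : Finset (Fin n))) a ({j} : Finset (Fin n))) := by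
    ext i
    simp only [Finset.mem_filter, Finset.mem_univ, true_and, Fintype.mem_piFinset]
    constructor
    · intro h b
      by_cases hb : b = a
      · subst hb; simp [h]
      · simp [Function.update_of_ne hb]
    · intro h
      simpa using h a
  rw [this, Fintype.card_piFinset, ← Finset.mul_prod_erase _ _ (Finset.mem_univ a)]
  rw [Finset.prod_congr rfl (g := fun _ => n) fun b hb => by
    rw [Function.update_of_ne (Finset.ne_of_mem_erase hb)]; simp]
  simp

/-- The row j occupies one of p positions. The count of order n^(p-1) is what the factor n^(-(p-1))
in the signal-to-noise ratio compensates. -/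
theorem card_filter_mem_range_le (n p : ℕ) (j : Fin n) :
    (Finset.univ.filter fun i : TensorIndex n p => ∃ a, i.1 a = j).card ≤ p * n ^ (p - 1) := by
  classical
  have h1 : (Finset.univ.filter fun i : TensorIndex n p => ∃ a, i.1 a = j).card ≤
      ((Finset.univ : Finset (Fin p)).biUnion fun a =>
        Finset.univ.filter fun i : Fin p → Fin n => i a = j).card := by
    refine Finset.card_le_card_of_injOn Subtype.val (fun i hi => ?_) Subtype.val_injective.injOn
    simpa using hi
  refine h1.trans (Finset.card_biUnion_le.trans ?_)
  simp [card_filter_apply_eq]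

theorem tensorEntry_update_eq {n K p : ℕ} (B : ℝ) (x : Config n K) (j : Fin n) (a b : Fin K → ℝ)
    (i : TensorIndex n p) (h : ¬ ∃ c, i.1 c = j) :
    tensorEntry (truncRows B (Function.update x j a)) i =
      tensorEntry (truncRows B (Function.update x j b)) i := by
  push Not at h
  unfold tensorEntry
  refine Finset.sum_congr rfl fun k _ => Finset.prod_congr rfl fun c _ => ?_
  rw [truncRows_update B x j a (h c), truncRows_update B x j b (h c)]

end Counting

/-! ### The free energy of the line channel has variance O(n). -/

section LineVariance

variable {n K p : ℕ}

theorem abs_rowForm_le {B : ℝ} (hB : 0 ≤ B) {v : Fin K → ℝ} (hv : ∑ l, |v l| ≤ 2) (x : Config n K)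
    (j : Fin n) : |rowForm B v x j| ≤ 2 * B := by
  refine (Finset.abs_sum_le_sum_abs _ _).trans ?_
  refine (Finset.sum_le_sum (g := fun l => |v l| * B) fun l _ => ?_).trans ?_
  · rw [abs_mul]
    exact mul_le_mul_of_nonneg_left (abs_truncRows_le hB x j l) (abs_nonneg _)
  · rw [← Finset.sum_mul]
    exact mul_le_mul_of_nonneg_right hv hB

/-- The constant in the variance bound of the free energy. -/
noncomputable def freeEnergyConst (K p : ℕ) (B σ : ℝ) : ℝ :=
  (p - 1).factorial * (K * B ^ p) ^ 2 + K * (K * σ * B) ^ 2 + (6 * B) ^ 2 +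
    (p * (2 * ((p - 1).factorial * (K * B ^ p) ^ 2)) + K * (2 * (K * σ * B) ^ 2) +
      2 * (6 * B) ^ 2) ^ 2 / 2

theorem freeEnergyConst_nonneg {B σ : ℝ} : 0 ≤ freeEnergyConst K p B σ := by
  unfold freeEnergyConst
  positivity

theorem variance_freeEnergy_line_le (hp : 1 ≤ p) (hn : 1 ≤ n) (P : Measure (Fin K → ℝ))
    [IsProbabilityMeasure P] {B : ℝ} (hB : 0 ≤ B) {t : ℝ} (ht : t ∈ Set.Icc (0 : ℝ) 1)
    {S : Matrix (Fin K) (Fin K) ℝ} {σ : ℝ} (hS : ∀ l k, |S l k| ≤ σ) (hσ : 0 ≤ σ) {v : Fin K → ℝ}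
    (hv : ∑ l, |v l| ≤ 2) {r : ℝ} (hr : |r| ≤ 3) :
    Var[freeEnergy (Measure.pi fun _ : Fin n => P)
      (lineChan (baseChan (p := p) B t S) (rowForm B v) r);
      chanLaw (Measure.pi fun _ : Fin n => P) ((TensorIndex n p ⊕ Fin n × Fin K) ⊕ Fin n)] ≤
      freeEnergyConst K p B σ * n := by
  classical
  -- Suprema of the channel inputs; 6B is the product of |r| ≤ 3 and the bound 2B of the linear
  -- form.
  set c : (TensorIndex n p ⊕ Fin n × Fin K) ⊕ Fin n → ℝ :=
    Sum.elim (Sum.elim (fun _ => √(tensorSnr n p t) * (K * B ^ p)) fun _ => K * σ * B)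
      fun _ => 6 * B with hcdef
  have hL := bddMeas_lineChan (bddMeas_baseChan (n := n) (p := p) hB t S) (bddMeas_rowForm hB v) r
  have hc : ∀ x i, |lineChan (baseChan (p := p) B t S) (rowForm B v) r x i| ≤ c i := by
    rintro x ((i | q) | j)
    · simp only [lineChan, baseChan, Sum.elim_inl, hcdef]
      rw [abs_mul, abs_of_nonneg (Real.sqrt_nonneg _)]
      exact mul_le_mul_of_nonneg_left (abs_tensorEntry_le hB x i) (Real.sqrt_nonneg _)
    · simp only [lineChan, baseChan, Sum.elim_inl, Sum.elim_inr, hcdef]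
      refine (Finset.abs_sum_le_sum_abs _ _).trans
        ((Finset.sum_le_sum (g := fun _ => σ * B) fun l _ => ?_).trans ?_)
      · rw [abs_mul]
        exact mul_le_mul (hS _ _) (abs_truncRows_le hB _ _ _) (abs_nonneg _) hσ
      · simp [mul_assoc]
    · simp only [lineChan, Sum.elim_inr, hcdef]
      rw [abs_mul]
      have := mul_le_mul hr (abs_rowForm_le hB hv x j) (abs_nonneg _) (by norm_num)
      linarith
  have hn0 : (0 : ℝ) < n := by exact_mod_cast hn
  have hsn : tensorSnr n p t * (n : ℝ) ^ (p - 1) ≤ (p - 1).factorial := by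
    unfold tensorSnr
    rw [div_mul_cancel₀ _ (pow_ne_zero _ hn0.ne')]
    have : (0 : ℝ) ≤ (p - 1).factorial := by positivity
    nlinarith [ht.1, ht.2]
  have hs0 := tensorSnr_nonneg (n := n) (p := p) ht.2
  have hc2 : (√(tensorSnr n p t) * (K * B ^ p)) ^ 2 = tensorSnr n p t * (K * B ^ p) ^ 2 := by
    rw [mul_pow, Real.sq_sqrt hs0]
  have hsum : ∑ i, c i ^ 2 ≤ ((p - 1).factorial * (K * B ^ p) ^ 2 + K * (K * σ * B) ^ 2 +
      (6 * B) ^ 2) * n := by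
    simp only [Fintype.sum_sum_type, hcdef, Sum.elim_inl, Sum.elim_inr, hc2, Finset.sum_const,
      Finset.card_univ, Fintype.card_prod, Fintype.card_fin, nsmul_eq_mul]
    have h1 : (Fintype.card (TensorIndex n p) : ℝ) * (tensorSnr n p t * (K * B ^ p) ^ 2) ≤
        (p - 1).factorial * (K * B ^ p) ^ 2 * n := by
      have hcard : (Fintype.card (TensorIndex n p) : ℝ) ≤ (n : ℝ) ^ p := by
        exact_mod_cast card_tensorIndex_le n p
      have hnp : (n : ℝ) ^ p = (n : ℝ) ^ (p - 1) * n := by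
        rw [← pow_succ]; congr 1; omega
      calc (Fintype.card (TensorIndex n p) : ℝ) * (tensorSnr n p t * (K * B ^ p) ^ 2)
          ≤ (n : ℝ) ^ p * (tensorSnr n p t * (K * B ^ p) ^ 2) :=
            mul_le_mul_of_nonneg_right hcard (by positivity)
        _ = (tensorSnr n p t * (n : ℝ) ^ (p - 1)) * ((K * B ^ p) ^ 2 * n) := by rw [hnp]; ring
        _ ≤ (p - 1).factorial * ((K * B ^ p) ^ 2 * n) :=
            mul_le_mul_of_nonneg_right hsn (by positivity)
        _ = _ := by ring
    push_cast
    nlinarith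
  -- A row enters at most p n^(p-1) tensor channels, K gain channels and one extra channel, so
  -- changing it moves the exponent by O(1).
  have hd : ∀ j x a b, ∑ i, |lineChan (baseChan (p := p) B t S) (rowForm B v) r
      (Function.update x j a) i - lineChan (baseChan B t S) (rowForm B v) r
      (Function.update x j b) i| * c i ≤ p * (2 * ((p - 1).factorial * (K * B ^ p) ^ 2)) +
        K * (2 * (K * σ * B) ^ 2) + 2 * (6 * B) ^ 2 := by
    intro j x a b
    have hc0 : ∀ i, 0 ≤ c i := fun i => (abs_nonneg _).trans (hc x i)
    have h2 : ∀ i, |lineChan (baseChan (p := p) B t S) (rowForm B v) r (Function.update x j a) i -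
        lineChan (baseChan B t S) (rowForm B v) r (Function.update x j b) i| * c i ≤
        2 * c i ^ 2 := by
      intro i
      have := (abs_sub _ _).trans (add_le_add (hc (Function.update x j a) i)
        (hc (Function.update x j b) i))
      have := mul_le_mul_of_nonneg_right this (hc0 i)
      linarith
    rw [Fintype.sum_sum_type, Fintype.sum_sum_type]
    refine add_le_add (add_le_add ?_ ?_) ?_
    · calc _ ≤ ∑ i : TensorIndex n p, if ∃ e, i.1 e = j then
            2 * (tensorSnr n p t * (K * B ^ p) ^ 2) else 0 := by
            refine Finset.sum_le_sum fun i _ => ?_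
            split_ifs with h
            · refine (h2 _).trans (le_of_eq ?_)
              simp only [hcdef, Sum.elim_inl, hc2]
            · simp only [lineChan, baseChan, Sum.elim_inl]
              rw [tensorEntry_update_eq B x j a b i h]
              simp
        _ = ((Finset.univ.filter fun i : TensorIndex n p => ∃ e, i.1 e = j).card : ℝ) *
            (2 * (tensorSnr n p t * (K * B ^ p) ^ 2)) := by
            rw [← Finset.sum_filter, Finset.sum_const, nsmul_eq_mul]
        _ ≤ (p * (n : ℝ) ^ (p - 1)) * (2 * (tensorSnr n p t * (K * B ^ p) ^ 2)) := by
            refine mul_le_mul_of_nonneg_right ?_ (by positivity)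
            exact_mod_cast card_filter_mem_range_le n p j
        _ = (tensorSnr n p t * (n : ℝ) ^ (p - 1)) * (p * (2 * (K * B ^ p) ^ 2)) := by ring
        _ ≤ (p - 1).factorial * (p * (2 * (K * B ^ p) ^ 2)) :=
            mul_le_mul_of_nonneg_right hsn (by positivity)
        _ = _ := by ring
    · rw [Fintype.sum_prod_type, Finset.sum_eq_single j]
      · refine (Finset.sum_le_sum fun k _ => h2 (.inl (.inr (j, k)))).trans (le_of_eq ?_)
        simp [hcdef]
      · intro j' _ hj'
        refine Finset.sum_eq_zero fun k _ => ?_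
        simp only [lineChan, baseChan, Sum.elim_inl, Sum.elim_inr]
        rw [truncRows_update B x j a hj', truncRows_update B x j b hj']
        simp
      · simp
    · rw [Finset.sum_eq_single j]
      · refine (h2 (.inr j)).trans (le_of_eq ?_)
        simp [hcdef]
      · intro j' _ hj'
        simp only [lineChan, Sum.elim_inr, rowForm]
        rw [truncRows_update B x j a hj', truncRows_update B x j b hj']
        simp
      · simp
  refine (variance_freeEnergy_le P hL hc hd).trans ?_
  unfold freeEnergyConst
  nlinarith

end LineVariance

end TensorOverlap

namespace TensorOverlap

/-! ### Overlap fluctuations through posterior means and covariances. -/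

section Decomposition

variable {α κ J : Type*} [MeasurableSpace α] [Fintype κ] [Fintype J]
  {μ : Measure α} [IsProbabilityMeasure μ] {Φ : α → κ → ℝ}

/-- Prepared for polarisation, m m' = ((m + m')² - m² - m'²)/2. The factor 3 comes from (x - y - z)²
≤ 3(x² + y² + z²). -/
theorem variance_sub_sub_le {Ω : Type*} [MeasurableSpace Ω] {ν : Measure Ω} [IsProbabilityMeasure ν]
    {f g h : Ω → ℝ} (hf : MemLp f 2 ν) (hg : MemLp g 2 ν) (hh : MemLp h 2 ν) (c : ℝ) :
    Var[fun p => c * (f p - g p - h p); ν] ≤ 3 * c ^ 2 * (Var[f; ν] + Var[g; ν] + Var[h; ν]) := by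
  have hfi := hf.integrable one_le_two
  have hgi := hg.integrable one_le_two
  have hhi := hh.integrable one_le_two
  have hS : MemLp (fun p => c * (f p - g p - h p)) 2 ν := ((hf.sub hg).sub hh).const_mul c
  have hm : ∫ p, c * (f p - g p - h p) ∂ν = c * (∫ p, f p ∂ν - ∫ p, g p ∂ν - ∫ p, h p ∂ν) := by
    have hfg : Integrable (fun p => f p - g p) ν := hfi.sub hgi
    rw [integral_const_mul, integral_sub hfg hhi, integral_sub hfi hgi]
  rw [variance_eq_integral hS.aemeasurable, variance_eq_integral hf.aemeasurable,
    variance_eq_integral hg.aemeasurable, variance_eq_integral hh.aemeasurable, hm]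
  have i1 := (hf.sub (memLp_const (∫ p, f p ∂ν))).integrable_sq
  have i2 := (hg.sub (memLp_const (∫ p, g p ∂ν))).integrable_sq
  have i3 := (hh.sub (memLp_const (∫ p, h p ∂ν))).integrable_sq
  simp only [Pi.sub_apply] at i1 i2 i3
  have i12 : Integrable (fun p => (f p - ∫ p, f p ∂ν) ^ 2 + (g p - ∫ p, g p ∂ν) ^ 2) ν := i1.add i2
  rw [← integral_add i1 i2, ← integral_add i12 i3, ← integral_const_mul]
  refine integral_mono_of_nonneg (Filter.Eventually.of_forall fun p => sq_nonneg _)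
    ((i12.add i3).const_mul _) (Filter.Eventually.of_forall fun p => ?_)
  beta_reduce
  set x := f p - ∫ p, f p ∂ν
  set y := g p - ∫ p, g p ∂ν
  set z := h p - ∫ p, h p ∂ν
  have : c * (f p - g p - h p) - c * (∫ p, f p ∂ν - ∫ p, g p ∂ν - ∫ p, h p ∂ν) =
      c * (x - y - z) := by simp only [x, y, z]; ring
  rw [this]
  have : (x - y - z) ^ 2 ≤ 3 * (x ^ 2 + y ^ 2 + z ^ 2) := by
    nlinarith [sq_nonneg (x + y), sq_nonneg (x + z), sq_nonneg (y - z)]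
  have := mul_le_mul_of_nonneg_left this (sq_nonneg c)
  nlinarith

theorem post_sum (hΦ : ∀ i, BddMeas fun x => Φ x i) (y : κ → ℝ) {f : J → α → ℝ}
    (hf : ∀ j, BddMeas (f j)) (w : J → ℝ) :
    post μ Φ y (fun x => ∑ j, w j * f j x) = ∑ j, w j * post μ Φ y (f j) := by
  have hE := bddMeas_logLik hΦ y
  have := gibbsMean_sum (μ := μ) hE Finset.univ (f := fun j x => w j * f j x)
    fun j => (hf j).const_mul (w j)
  simp only [post]
  rw [this]
  exact Finset.sum_congr rfl fun j _ => gibbsMean_const_mul _ _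

/-- The posterior mean of f_j is a function of the observation, so Nishimori replaces the signal
value of g_j by its posterior mean. -/
theorem integral_post_overlap (hΦ : ∀ i, BddMeas fun x => Φ x i) {f g : J → α → ℝ}
    (hf : ∀ j, BddMeas (f j)) (hg : ∀ j, BddMeas (g j)) (c : ℝ) :
    ∫ p, post μ Φ (obs Φ p) (fun x => c * ∑ j, f j x * g j p.1) ∂(chanLaw μ κ) =
      ∫ p, c * ∑ j, post μ Φ (obs Φ p) (f j) * post μ Φ (obs Φ p) (g j) ∂(chanLaw μ κ) := by
  have h1 : ∀ p : α × (κ → ℝ), post μ Φ (obs Φ p) (fun x => c * ∑ j, f j x * g j p.1) =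
      c * ∑ j, g j p.1 * post μ Φ (obs Φ p) (f j) := by
    intro p
    rw [← post_sum hΦ _ hf]
    simp only [post]
    rw [← gibbsMean_const_mul]
    simp only [mul_comm]
  simp only [h1]
  rw [integral_const_mul, integral_const_mul, integral_finsetSum _ fun j _ =>
    ((hg j).signal.mul ((bddMeas_post hΦ (hf j)).obs hΦ)).integrable _,
    integral_finsetSum _ fun j _ => (((bddMeas_post hΦ (hf j)).obs hΦ).mul
      ((bddMeas_post hΦ (hg j)).obs hΦ)).integrable _]
  congr 1
  refine Finset.sum_congr rfl fun j _ => ?_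
  rw [nishimori hΦ (hg j) (bddMeas_post hΦ (hf j))]
  simp only [mul_comm]

/-- The square of an overlap is an overlap indexed by pairs, so the first-moment formula applies on
`J × J`. -/
theorem integral_post_overlap_sq (hΦ : ∀ i, BddMeas fun x => Φ x i) {f g : J → α → ℝ}
    (hf : ∀ j, BddMeas (f j)) (hg : ∀ j, BddMeas (g j)) (c : ℝ) :
    ∫ p, post μ Φ (obs Φ p) (fun x => (c * ∑ j, f j x * g j p.1) ^ 2) ∂(chanLaw μ κ) =
      c ^ 2 * ∑ i, ∑ j, ∫ p, post μ Φ (obs Φ p) (fun x => f i x * f j x) *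
        post μ Φ (obs Φ p) (fun x => g i x * g j x) ∂(chanLaw μ κ) := by
  have h := integral_post_overlap (μ := μ) hΦ (J := J × J) (f := fun q x => f q.1 x * f q.2 x)
    (g := fun q x => g q.1 x * g q.2 x) (fun q => (hf _).mul (hf _)) (fun q => (hg _).mul (hg _))
    (c ^ 2)
  have e : ∀ (p : α × (κ → ℝ)) x, (c * ∑ j, f j x * g j p.1) ^ 2 =
      c ^ 2 * ∑ q : J × J, f q.1 x * f q.2 x * (g q.1 p.1 * g q.2 p.1) := by
    intro p x
    rw [mul_pow, pow_two (∑ j, _), Finset.sum_mul_sum, Fintype.sum_prod_type]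
    congr 1
    exact Finset.sum_congr rfl fun i _ => Finset.sum_congr rfl fun j _ => by ring
  simp only [e]
  rw [h, integral_const_mul, integral_finsetSum _ fun q _ =>
    (((bddMeas_post hΦ ((hf q.1).mul (hf q.2))).obs hΦ).mul
      ((bddMeas_post hΦ ((hg q.1).mul (hg q.2))).obs hΦ)).integrable _, Fintype.sum_prod_type]

/-- From aa' - mm' = (a - m)a' + m(a' - m') and |c| ≤ η/2 + c²/(2η). The free parameter η trades the
linear dependence on the covariances for squares, which are the controlled quantities. -/
theorem mul_sub_mul_le {a a' m m' B η : ℝ} (hη : 0 < η) (ha' : |a'| ≤ B ^ 2)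
    (hm : |m| ≤ B ^ 2) :
    a * a' - m * m' ≤ B ^ 2 * (η + ((a - m) ^ 2 + (a' - m') ^ 2) / (2 * η)) := by
  have key : ∀ c : ℝ, |c| ≤ η / 2 + c ^ 2 / (2 * η) := by
    intro c
    rw [← sq_abs c]
    have : η / 2 + |c| ^ 2 / (2 * η) - |c| = (|c| - η) ^ 2 / (2 * η) := by
      field_simp; ring
    have h2 : 0 ≤ (|c| - η) ^ 2 / (2 * η) := by positivity
    linarith
  have h1 : (a - m) * a' ≤ |a - m| * B ^ 2 := (le_abs_self _).trans (by
    rw [abs_mul]; exact mul_le_mul_of_nonneg_left ha' (abs_nonneg _))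
  have h2 : m * (a' - m') ≤ B ^ 2 * |a' - m'| := (le_abs_self _).trans (by
    rw [abs_mul]; exact mul_le_mul_of_nonneg_right hm (abs_nonneg _))
  have h3 := mul_le_mul_of_nonneg_left (key (a - m)) (sq_nonneg B)
  have h4 := mul_le_mul_of_nonneg_left (key (a' - m')) (sq_nonneg B)
  calc a * a' - m * m' = (a - m) * a' + m * (a' - m') := by ring
    _ ≤ B ^ 2 * (η / 2 + (a - m) ^ 2 / (2 * η)) + B ^ 2 * (η / 2 + (a' - m') ^ 2 / (2 * η)) := by
      linarith
    _ = _ := by field_simp; ring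

/-- The fluctuation of one entry of an overlap matrix is bounded by the variance of the overlap of
posterior means and by the posterior covariances. -/
theorem integral_post_overlap_sub_sq_le (hΦ : ∀ i, BddMeas fun x => Φ x i) {f g : J → α → ℝ}
    (hf : ∀ j, BddMeas (f j)) (hg : ∀ j, BddMeas (g j)) {B η : ℝ} (hB : 0 ≤ B) (hη : 0 < η)
    (hfB : ∀ j x, |f j x| ≤ B) (hgB : ∀ j x, |g j x| ≤ B) (c : ℝ) :
    ∫ p, post μ Φ (obs Φ p) (fun x => (c * ∑ j, f j x * g j p.1 -
        ∫ p', post μ Φ (obs Φ p') (fun x => c * ∑ j, f j x * g j p'.1) ∂(chanLaw μ κ)) ^ 2)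
        ∂(chanLaw μ κ) ≤
      Var[fun p => c * ∑ j, post μ Φ (obs Φ p) (f j) * post μ Φ (obs Φ p) (g j); chanLaw μ κ] +
      c ^ 2 * (B ^ 2 * (Fintype.card J ^ 2 * η +
        ((∑ i, ∑ j, ∫ p, postCov μ Φ (obs Φ p) (f i) (f j) ^ 2 ∂(chanLaw μ κ)) +
        ∑ i, ∑ j, ∫ p, postCov μ Φ (obs Φ p) (g i) (g j) ^ 2 ∂(chanLaw μ κ)) / (2 * η))) := by
  set m := ∫ p', post μ Φ (obs Φ p') (fun x => c * ∑ j, f j x * g j p'.1) ∂(chanLaw μ κ) with hm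
  set q : α × (κ → ℝ) → ℝ := fun p =>
    c * ∑ j, post μ Φ (obs Φ p) (f j) * post μ Φ (obs Φ p) (g j) with hq
  have hmq : m = ∫ p, q p ∂(chanLaw μ κ) := integral_post_overlap hΦ hf hg c
  have hbf := fun j => (bddMeas_post (μ := μ) hΦ (hf j)).obs hΦ
  have hbg := fun j => (bddMeas_post (μ := μ) hΦ (hg j)).obs hΦ
  have hqb : BddMeas q := (BddMeas.sum fun j => (hbf j).mul (hbg j)).const_mul c
  have hO : ∀ X, BddMeas fun x => c * ∑ j, f j x * g j X := fun X =>
    (BddMeas.sum fun j => by simpa only [mul_comm] using (hf j).const_mul (g j X)).const_mul c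
  have e1 : ∀ p : α × (κ → ℝ), post μ Φ (obs Φ p) (fun x => (c * ∑ j, f j x * g j p.1 - m) ^ 2) =
      post μ Φ (obs Φ p) (fun x => (c * ∑ j, f j x * g j p.1) ^ 2) -
      2 * m * post μ Φ (obs Φ p) (fun x => c * ∑ j, f j x * g j p.1) + m ^ 2 := by
    intro p
    have hE := bddMeas_logLik hΦ (obs Φ p)
    have e : (fun x => (c * ∑ j, f j x * g j p.1 - m) ^ 2) = fun x =>
        ((c * ∑ j, f j x * g j p.1) ^ 2 - 2 * m * (c * ∑ j, f j x * g j p.1)) + m ^ 2 := by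
      ext x; ring
    simp only [post]
    rw [e, gibbsMean_add hE (((hO p.1).pow 2).sub ((hO p.1).const_mul _)) (BddMeas.const _),
      gibbsMean_sub hE ((hO p.1).pow 2) ((hO p.1).const_mul _), gibbsMean_const_mul,
      gibbsMean_const hE]
  have hjoint : BddMeas fun z : (α × (κ → ℝ)) × α => c * ∑ j, f j z.2 * g j z.1.1 :=
    (BddMeas.sum fun j => ((hf j).comp measurable_snd).mul
      ((hg j).comp (measurable_fst.comp measurable_fst))).const_mul c
  have hEm : Measurable (Function.uncurry fun p : α × (κ → ℝ) => logLik Φ (obs Φ p)) :=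
    (measurable_logLik hΦ).comp ((measurable_obs hΦ).prodMap measurable_id)
  have hi1 : BddMeas fun p : α × (κ → ℝ) =>
      post μ Φ (obs Φ p) (fun x => (c * ∑ j, f j x * g j p.1) ^ 2) :=
    bddMeas_gibbsMean hEm (fun p => bddMeas_logLik hΦ _) (hjoint.pow 2)
  have hi2 : BddMeas fun p : α × (κ → ℝ) =>
      post μ Φ (obs Φ p) (fun x => c * ∑ j, f j x * g j p.1) :=
    bddMeas_gibbsMean hEm (fun p => bddMeas_logLik hΦ _) hjoint
  simp only [e1]
  rw [integral_add ((hi1.sub (hi2.const_mul _)).integrable _) (integrable_const _),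
    integral_sub (hi1.integrable _) ((hi2.const_mul _).integrable _), integral_const_mul, ← hm,
    integral_post_overlap_sq hΦ hf hg, variance_eq_sub (hqb.memLp _)]
  have e2 : ∫ p, (q ^ 2) p ∂(chanLaw μ κ) = c ^ 2 * ∑ i, ∑ j, ∫ p,
      (post μ Φ (obs Φ p) (f i) * post μ Φ (obs Φ p) (f j)) *
      (post μ Φ (obs Φ p) (g i) * post μ Φ (obs Φ p) (g j)) ∂(chanLaw μ κ) := by
    have : ∀ p, (q ^ 2) p = c ^ 2 * ∑ i, ∑ j,
        (post μ Φ (obs Φ p) (f i) * post μ Φ (obs Φ p) (f j)) *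
        (post μ Φ (obs Φ p) (g i) * post μ Φ (obs Φ p) (g j)) := by
      intro p
      simp only [hq, Pi.pow_apply]
      rw [mul_pow, pow_two (∑ j, _), Finset.sum_mul_sum]
      congr 1
      exact Finset.sum_congr rfl fun i _ => Finset.sum_congr rfl fun j _ => by ring
    simp only [this]
    rw [integral_const_mul, integral_finsetSum _ fun i _ => (BddMeas.sum fun j =>
      ((hbf i).mul (hbf j)).mul ((hbg i).mul (hbg j))).integrable _]
    congr 1
    exact Finset.sum_congr rfl fun i _ => integral_finsetSum _ fun j _ =>
      (((hbf i).mul (hbf j)).mul ((hbg i).mul (hbg j))).integrable _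
  have hmm : (∫ p, q p ∂(chanLaw μ κ)) = m := hmq.symm
  simp only [integral_const, probReal_univ, one_smul]
  rw [hmm, e2]
  -- The second moment of the overlap under the bracket exceeds that of the overlap of posterior
  -- means only by factorisation errors of pairs, that is, by covariances of f and of g.
  have key : ∀ i j, ∫ p, post μ Φ (obs Φ p) (fun x => f i x * f j x) *
        post μ Φ (obs Φ p) (fun x => g i x * g j x) ∂(chanLaw μ κ) -
      ∫ p, (post μ Φ (obs Φ p) (f i) * post μ Φ (obs Φ p) (f j)) *
        (post μ Φ (obs Φ p) (g i) * post μ Φ (obs Φ p) (g j)) ∂(chanLaw μ κ) ≤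
      B ^ 2 * (η + (∫ p, postCov μ Φ (obs Φ p) (f i) (f j) ^ 2 ∂(chanLaw μ κ) +
        ∫ p, postCov μ Φ (obs Φ p) (g i) (g j) ^ 2 ∂(chanLaw μ κ)) / (2 * η)) := by
    intro i j
    have b1 := ((bddMeas_post (μ := μ) hΦ ((hf i).mul (hf j))).obs hΦ).mul
      ((bddMeas_post (μ := μ) hΦ ((hg i).mul (hg j))).obs hΦ)
    have b2 := ((hbf i).mul (hbf j)).mul ((hbg i).mul (hbg j))
    have b3 := (((bddMeas_postCov (μ := μ) hΦ (hf i) (hf j)).obs hΦ).pow 2)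
    have b4 := (((bddMeas_postCov (μ := μ) hΦ (hg i) (hg j)).obs hΦ).pow 2)
    rw [← integral_sub (b1.integrable _) (b2.integrable _)]
    have : B ^ 2 * (η + (∫ p, postCov μ Φ (obs Φ p) (f i) (f j) ^ 2 ∂(chanLaw μ κ) +
        ∫ p, postCov μ Φ (obs Φ p) (g i) (g j) ^ 2 ∂(chanLaw μ κ)) / (2 * η)) =
        ∫ p, B ^ 2 * (η + (postCov μ Φ (obs Φ p) (f i) (f j) ^ 2 +
          postCov μ Φ (obs Φ p) (g i) (g j) ^ 2) / (2 * η)) ∂(chanLaw μ κ) := by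
      rw [integral_const_mul, integral_add (integrable_const _)
        (((b3.add b4).div_const _).integrable _), integral_div,
        integral_add (b3.integrable _) (b4.integrable _)]
      simp
    rw [this]
    refine integral_mono ((b1.sub b2).integrable _) ((((BddMeas.const η).add
      ((b3.add b4).div_const (2 * η))).const_mul _).integrable _) fun p => ?_
    have hE := bddMeas_logLik hΦ (obs Φ p)
    refine mul_sub_mul_le hη (abs_gibbsMean_le hE fun x => ?_) ?_
    · rw [abs_mul, pow_two]
      exact mul_le_mul (hgB _ _) (hgB _ _) (abs_nonneg _) hB
    · rw [abs_mul, pow_two]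
      exact mul_le_mul (abs_gibbsMean_le hE (hfB _)) (abs_gibbsMean_le hE (hfB _)) (abs_nonneg _) hB
  have hsum := Finset.sum_le_sum fun i (_ : i ∈ (Finset.univ : Finset J)) =>
    Finset.sum_le_sum fun j (_ : j ∈ (Finset.univ : Finset J)) => key i j
  simp only [Finset.sum_sub_distrib, ← Finset.mul_sum, Finset.sum_add_distrib, ← Finset.sum_div,
    Finset.sum_const, Finset.card_univ, nsmul_eq_mul] at hsum
  have := mul_le_mul_of_nonneg_left hsum (sq_nonneg c)
  rw [show (Fintype.card J : ℝ) ^ 2 * η = Fintype.card J * (Fintype.card J * η) by ring]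
  nlinarith

end Decomposition

end TensorOverlap

namespace TensorOverlap

/-! ### Brackets as functions of signal and field. -/

section FieldMean

variable {n K p : ℕ}

theorem gibbsMean_congr_ae {α : Type*} [MeasurableSpace α] {μ : Measure α} {E E' g g' : α → ℝ}
    (hE : E =ᵐ[μ] E') (hg : g =ᵐ[μ] g') : gibbsMean μ E g = gibbsMean μ E' g' := by
  unfold gibbsMean
  rw [integral_congr_ae (hE.mono fun x hx => show Real.exp (E x) = Real.exp (E' x) by rw [hx]),
    integral_congr_ae (f := fun x => g x * Real.exp (E x)) (g := fun x => g' x * Real.exp (E' x))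
      (by filter_upwards [hE, hg] with x h1 h2; rw [h1, h2])]

/-- Gibbs mean given the signal and the field, for truncated configurations. -/
noncomputable def fieldMean (P : Measure (Fin K → ℝ)) (B t : ℝ) (R : Matrix (Fin K) (Fin K) ℝ)
    (w : Config n K × Field n K p) (g : Config n K → ℝ) : ℝ :=
  gibbsMean (Measure.pi fun _ : Fin n => P)
    (fun x => fieldExp t R (truncRows B w.1) w.2 (truncRows B x)) g

/-- The joint law of the signal and the field, for the signal-to-noise matrix `R`. -/
noncomputable def fieldLaw (P : Measure (Fin K → ℝ)) (n p : ℕ) (R : Matrix (Fin K) (Fin K) ℝ) :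
    Measure (Config n K × Field n K p) :=
  (disorderLaw P n p).map (Prod.map id (rowField (matSqrt R)))

instance (P : Measure (Fin K → ℝ)) [IsProbabilityMeasure P] (R : Matrix (Fin K) (Fin K) ℝ) :
    IsProbabilityMeasure (fieldLaw P n p R) :=
  Measure.isProbabilityMeasure_map
    (measurable_id.prodMap (measurable_rowField (matSqrt R))).aemeasurable

/-- A bound of the exponent in terms of the signal-to-noise matrix and the field. -/
noncomputable def fieldBound (B t : ℝ) (y : (Fin K → Fin K → ℝ) × Field n K p) : ℝ :=
  (∑ i : TensorIndex n p, ((√(tensorSnr n p t) * (K * B ^ p) + |y.2.1 i|) *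
      (√(tensorSnr n p t) * (K * B ^ p)) + (√(tensorSnr n p t) * (K * B ^ p)) ^ 2 / 2)) +
  ∑ j, ((∑ l, ∑ l', |y.1 l l'| * (2 * (B * B))) + ∑ l, |y.2.2 j l| * B)

theorem abs_fieldExp_le {B : ℝ} (hB : 0 ≤ B) (t : ℝ) (R : Matrix (Fin K) (Fin K) ℝ)
    (X : Config n K) (q : Field n K p) (x : Config n K) :
    |fieldExp t R (truncRows B X) q (truncRows B x)| ≤ fieldBound B t (R, q) := by
  have hs := Real.sqrt_nonneg (tensorSnr n p t)
  unfold fieldExp fieldBound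
  refine (abs_add_le _ _).trans (add_le_add ((Finset.abs_sum_le_sum_abs _ _).trans
    (Finset.sum_le_sum fun i _ => ?_)) ((Finset.abs_sum_le_sum_abs _ _).trans
    (Finset.sum_le_sum fun j _ => ?_)))
  · have h1 : ∀ y : Config n K, |√(tensorSnr n p t) * tensorEntry (truncRows B y) i| ≤
        √(tensorSnr n p t) * (K * B ^ p) := fun y => by
      rw [abs_mul, abs_of_nonneg hs]
      exact mul_le_mul_of_nonneg_left (abs_tensorEntry_le hB y i) hs
    refine (abs_sub _ _).trans (add_le_add ?_ ?_)
    · rw [abs_mul]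
      exact mul_le_mul ((abs_add_le _ _).trans (add_le_add_left (h1 X) _)) (h1 x) (abs_nonneg _)
        (by positivity)
    · rw [abs_div, abs_pow, abs_two]
      have := pow_le_pow_left₀ (abs_nonneg _) (h1 x) 2
      linarith
  · refine (abs_add_le _ _).trans (add_le_add ((Finset.abs_sum_le_sum_abs _ _).trans
      (Finset.sum_le_sum fun l _ => (Finset.abs_sum_le_sum_abs _ _).trans
      (Finset.sum_le_sum fun l' _ => ?_))) ((Finset.abs_sum_le_sum_abs _ _).trans
      (Finset.sum_le_sum fun l _ => ?_)))
    · rw [abs_mul]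
      refine mul_le_mul_of_nonneg_left ((abs_sub _ _).trans ?_) (abs_nonneg _)
      rw [abs_div, abs_mul, abs_mul, abs_two]
      have h1 := mul_le_mul (abs_truncRows_le hB x j l) (abs_truncRows_le hB X j l')
        (abs_nonneg _) hB
      have h2 := mul_le_mul (abs_truncRows_le hB x j l) (abs_truncRows_le hB x j l')
        (abs_nonneg _) hB
      have := mul_nonneg hB hB
      linarith
    · rw [abs_mul]
      exact mul_le_mul_of_nonneg_left (abs_truncRows_le hB x j l) (abs_nonneg _)

theorem continuous_fieldBound (B t : ℝ) :
    Continuous (fieldBound (n := n) (K := K) (p := p) B t) := by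
  unfold fieldBound
  fun_prop

theorem continuous_fieldExp (t : ℝ) (X x : Config n K) :
    Continuous fun y : (Fin K → Fin K → ℝ) × Field n K p =>
      fieldExp t (y.1 : Matrix (Fin K) (Fin K) ℝ) X y.2 x := by
  refine Continuous.add (continuous_finsetSum _ fun i _ => ?_) (continuous_finsetSum _ fun j _ =>
    Continuous.add (continuous_finsetSum _ fun l _ => continuous_finsetSum _ fun l' _ => ?_)
      (continuous_finsetSum _ fun l _ => ?_))
  · fun_prop
  · have : Continuous fun y : (Fin K → Fin K → ℝ) × Field n K p => y.1 l l' := by fun_prop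
    exact this.mul continuous_const
  · fun_prop

theorem measurable_fieldExp (B t : ℝ) (R : Matrix (Fin K) (Fin K) ℝ) :
    Measurable (Function.uncurry fun (w : Config n K × Field n K p) (x : Config n K) =>
      fieldExp t R (truncRows B w.1) w.2 (truncRows B x)) := by
  have h : Measurable fun y : (Config n K × Field n K p) × Config n K =>
      fieldExp t R y.1.1 y.1.2 y.2 := by
    have h0 : ∀ i : TensorIndex n p, Measurable fun x : Config n K => tensorEntry x i := by
      intro i
      unfold tensorEntry
      fun_prop
    have hX : ∀ i, Measurable fun y : (Config n K × Field n K p) × Config n K =>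
        tensorEntry y.1.1 i := fun i => (h0 i).comp (measurable_fst.comp measurable_fst)
    have hx : ∀ i, Measurable fun y : (Config n K × Field n K p) × Config n K =>
        tensorEntry y.2 i := fun i => (h0 i).comp measurable_snd
    refine Measurable.add (Finset.measurable_fun_sum _ fun i _ => ?_)
      (Finset.measurable_fun_sum _ fun j _ => Measurable.add
        (Finset.measurable_fun_sum _ fun l _ => Finset.measurable_fun_sum _ fun l' _ => ?_)
        (Finset.measurable_fun_sum _ fun l _ => ?_))
    · have hq : Measurable fun y : (Config n K × Field n K p) × Config n K => y.1.2.1 i := by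
        fun_prop
      exact (((hX i).const_mul _).add hq |>.mul ((hx i).const_mul _)).sub
        ((((hx i).const_mul _).pow_const 2).div_const 2)
    · have e1 : Measurable fun y : (Config n K × Field n K p) × Config n K => y.2 j l := by
        fun_prop
      have e2 : Measurable fun y : (Config n K × Field n K p) × Config n K => y.1.1 j l' := by
        fun_prop
      have e3 : Measurable fun y : (Config n K × Field n K p) × Config n K => y.2 j l' := by
        fun_prop
      exact ((e1.mul e2).sub ((e1.mul e3).div_const 2)).const_mul _
    · have e1 : Measurable fun y : (Config n K × Field n K p) × Config n K => y.2 j l := by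
        fun_prop
      have e2 : Measurable fun y : (Config n K × Field n K p) × Config n K => y.1.2.2 j l := by
        fun_prop
      exact e2.mul e1
  exact Measurable.comp (g := fun y : (Config n K × Field n K p) × Config n K =>
      fieldExp t R y.1.1 y.1.2 y.2) (f := fun z : (Config n K × Field n K p) × Config n K =>
      ((truncRows B z.1.1, z.1.2), truncRows B z.2)) h
    ((((measurable_truncRows B).comp (measurable_fst.comp measurable_fst)).prodMk
      (measurable_snd.comp measurable_fst)).prodMk
      ((measurable_truncRows B).comp measurable_snd))

theorem bddMeas_fieldExp {B : ℝ} (hB : 0 ≤ B) (t : ℝ) (R : Matrix (Fin K) (Fin K) ℝ)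
    (w : Config n K × Field n K p) :
    BddMeas fun x => fieldExp t R (truncRows B w.1) w.2 (truncRows B x) :=
  ⟨Measurable.comp (g := Function.uncurry fun (w : Config n K × Field n K p) (x : Config n K) =>
      fieldExp t R (truncRows B w.1) w.2 (truncRows B x)) (f := fun x => (w, x))
      (measurable_fieldExp B t R) measurable_prodMk_left, _,
    fun x => abs_fieldExp_le hB t R w.1 w.2 x⟩

variable {P : Measure (Fin K → ℝ)} [IsProbabilityMeasure P]

theorem bddMeas_fieldMean {B : ℝ} (hB : 0 ≤ B) (t : ℝ) (R : Matrix (Fin K) (Fin K) ℝ)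
    {g : Config n K × Field n K p → Config n K → ℝ} (hg : BddMeas (Function.uncurry g)) :
    BddMeas fun w => fieldMean P B t R w (g w) :=
  bddMeas_gibbsMean (measurable_fieldExp B t R) (bddMeas_fieldExp hB t R) hg

theorem BddMeas.fieldMean {B : ℝ} (hB : 0 ≤ B) (t : ℝ) (R : Matrix (Fin K) (Fin K) ℝ)
    {g : Config n K → ℝ} (hg : BddMeas g) :
    BddMeas fun w : Config n K × Field n K p => TensorOverlap.fieldMean P B t R w g :=
  bddMeas_fieldMean hB t R (g := fun _ => g)
    (hg.comp (measurable_snd (α := Config n K × Field n K p) (β := Config n K)))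

omit [IsProbabilityMeasure P] in
theorem fieldMean_line {B t : ℝ} {S R : Matrix (Fin K) (Fin K) ℝ} {v : Fin K → ℝ} {r : ℝ}
    (hR : ∀ l l', (∑ k, S l k * S l' k) + r ^ 2 * (v l * v l') = R l l')
    (z : Config n K × ((TensorIndex n p ⊕ Fin n × Fin K) ⊕ Fin n → ℝ)) (g : Config n K → ℝ) :
    fieldMean P B t R (Prod.map id (lineField S fun l => r * v l) z) g =
      post (Measure.pi fun _ : Fin n => P) (lineChan (baseChan B t S) (rowForm B v) r)
        (obs (lineChan (baseChan B t S) (rowForm B v) r) z) g := by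
  unfold fieldMean post
  rw [logLik_baseChan_line hR]
  rfl

/-- Averages over the model at R may be computed in any line channel with R = S Sᵀ + r² v vᵀ. With v
= u this gives the estimates along lines; with v = 0 and S = √R, those of the unperturbed model. -/
theorem integral_fieldLaw_line {S R : Matrix (Fin K) (Fin K) ℝ} (hRp : R.PosSemidef)
    {v : Fin K → ℝ} {r : ℝ}
    (hR : ∀ l l', (∑ k, S l k * S l' k) + r ^ 2 * (v l * v l') = R l l')
    {h : Config n K × Field n K p → ℝ} (hh : Measurable h) :
    ∫ w, h w ∂(fieldLaw P n p R) =
      ∫ z, h (Prod.map id (lineField S fun l => r * v l) z)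
        ∂(chanLaw (Measure.pi fun _ : Fin n => P)
          ((TensorIndex n p ⊕ Fin n × Fin K) ⊕ Fin n)) := by
  unfold fieldLaw
  rw [← map_lineField_eq P hRp hR]
  exact integral_map (measurable_id.prodMap (measurable_lineField S fun l => r * v l)).aemeasurable
    hh.aestronglyMeasurable

theorem variance_fieldLaw_line {S R : Matrix (Fin K) (Fin K) ℝ} (hRp : R.PosSemidef)
    {v : Fin K → ℝ} {r : ℝ}
    (hR : ∀ l l', (∑ k, S l k * S l' k) + r ^ 2 * (v l * v l') = R l l')
    {h : Config n K × Field n K p → ℝ} (hh : Measurable h) :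
    Var[h; fieldLaw P n p R] =
      Var[fun z => h (Prod.map id (lineField S fun l => r * v l) z);
        chanLaw (Measure.pi fun _ : Fin n => P) ((TensorIndex n p ⊕ Fin n × Fin K) ⊕ Fin n)] := by
  unfold fieldLaw
  rw [← map_lineField_eq P hRp hR]
  exact variance_map hh.aemeasurable
    (measurable_id.prodMap (measurable_lineField S fun l => r * v l)).aemeasurable

/-- The variance of the overlap of the posterior means in the direction `v`. -/
noncomputable def overlapVar (P : Measure (Fin K → ℝ)) (n p : ℕ) (B t : ℝ) (v : Fin K → ℝ)
    (R : Matrix (Fin K) (Fin K) ℝ) : ℝ :=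
  Var[fun w => ∑ j : Fin n, fieldMean P B t R w (fun x => rowForm B v x j) ^ 2; fieldLaw P n p R]

/-- The sum of the squared posterior covariances of the rows in the direction `v`. -/
noncomputable def covSq (P : Measure (Fin K → ℝ)) (n p : ℕ) (B t : ℝ) (v : Fin K → ℝ)
    (R : Matrix (Fin K) (Fin K) ℝ) : ℝ :=
  ∑ k : Fin n, ∑ j : Fin n, ∫ w, (fieldMean P B t R w (fun x => rowForm B v x k * rowForm B v x j) -
    fieldMean P B t R w (fun x => rowForm B v x k) *
      fieldMean P B t R w (fun x => rowForm B v x j)) ^ 2 ∂(fieldLaw P n p R)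

/-- The left side depends on R only, while the right side may use any factorisation. The direction
v' that is measured is independent of the direction v that is perturbed. -/
theorem overlapVar_eq {B : ℝ} (hB : 0 ≤ B) (t : ℝ) {S R : Matrix (Fin K) (Fin K) ℝ}
    (hRp : R.PosSemidef) {v : Fin K → ℝ} {r : ℝ}
    (hR : ∀ l l', (∑ k, S l k * S l' k) + r ^ 2 * (v l * v l') = R l l') (v' : Fin K → ℝ) :
    overlapVar P n p B t v' R = Var[fun z => ∑ j : Fin n, post (Measure.pi fun _ : Fin n => P)
      (lineChan (baseChan (p := p) B t S) (rowForm B v) r)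
      (obs (lineChan (baseChan B t S) (rowForm B v) r) z) (fun x => rowForm B v' x j) ^ 2;
      chanLaw (Measure.pi fun _ : Fin n => P) ((TensorIndex n p ⊕ Fin n × Fin K) ⊕ Fin n)] := by
  unfold overlapVar
  rw [variance_fieldLaw_line hRp hR]
  · simp only [fieldMean_line hR]
  · exact (BddMeas.sum fun j => ((bddMeas_rowForm hB v' j).fieldMean hB t R).pow 2).1

theorem covSq_eq {B : ℝ} (hB : 0 ≤ B) (t : ℝ) {S R : Matrix (Fin K) (Fin K) ℝ}
    (hRp : R.PosSemidef) {v : Fin K → ℝ} {r : ℝ}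
    (hR : ∀ l l', (∑ k, S l k * S l' k) + r ^ 2 * (v l * v l') = R l l') (v' : Fin K → ℝ) :
    covSq P n p B t v' R = ∑ k : Fin n, ∑ j : Fin n, ∫ z,
      postCov (Measure.pi fun _ : Fin n => P)
      (lineChan (baseChan (p := p) B t S) (rowForm B v) r)
      (obs (lineChan (baseChan B t S) (rowForm B v) r) z) (fun x => rowForm B v' x k)
        (fun x => rowForm B v' x j) ^ 2
      ∂(chanLaw (Measure.pi fun _ : Fin n => P) ((TensorIndex n p ⊕ Fin n × Fin K) ⊕ Fin n)) := by
  unfold covSq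
  refine Finset.sum_congr rfl fun k _ => Finset.sum_congr rfl fun j _ => ?_
  rw [integral_fieldLaw_line hRp hR]
  · simp only [fieldMean_line hR, postCov]
  · have h1 := ((bddMeas_rowForm (n := n) hB v' k).mul (bddMeas_rowForm hB v' j)).fieldMean
      (P := P) (p := p) hB t R
    have h2 := (bddMeas_rowForm (n := n) hB v' k).fieldMean (P := P) (p := p) hB t R
    have h3 := (bddMeas_rowForm (n := n) hB v' j).fieldMean (P := P) (p := p) hB t R
    exact ((h1.sub (h2.mul h3)).pow 2).1

/-- Averages of Gibbs brackets, for truncated configurations. -/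
theorem integral_gibbs_eq {B : ℝ} (hB : 0 ≤ B) (hP : ∀ᵐ x ∂P, ‖x‖ ≤ B) {t : ℝ} (ht : t ≤ 1)
    {R : Matrix (Fin K) (Fin K) ℝ} (hR : R.PosSemidef) {G : Config n K → Config n K → ℝ}
    (hG : BddMeas fun z : Config n K × Config n K => G (truncRows B z.1) (truncRows B z.2)) :
    ∫ ω, gibbs P t R ω (fun x => G ω.1 x) ∂(disorderLaw P n p) =
      ∫ w, fieldMean P B t R w (fun x => G (truncRows B w.1) (truncRows B x))
        ∂(fieldLaw P n p R) := by
  have hx := ae_truncRows_eq hP n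
  have hω : ∀ᵐ ω ∂(disorderLaw P n p), truncRows B ω.1 = ω.1 := by
    unfold disorderLaw
    exact Measure.quasiMeasurePreserving_fst.ae hx
  unfold fieldLaw
  rw [integral_map (measurable_id.prodMap (measurable_rowField (matSqrt R))).aemeasurable]
  · refine integral_congr_ae (hω.mono fun ω h => ?_)
    simp only [fieldMean, Prod.map_fst, Prod.map_snd, id, h]
    have : gibbs P t R ω (fun x => G ω.1 x) = gibbsMean (Measure.pi fun _ : Fin n => P)
        (fun x => fieldExp t R ω.1 (rowField (matSqrt R) ω.2) x) (fun x => G ω.1 x) := by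
      unfold gibbs gibbsMean gibbsWeight
      simp only [neg_hamiltonian_eq ht hR]
    rw [this]
    refine gibbsMean_congr_ae ?_ ?_ <;>
    exact hx.mono fun x hx => by simp only [hx]
  · exact (bddMeas_fieldMean hB t R (g := fun w x => G (truncRows B w.1) (truncRows B x))
      (hG.comp (g := fun z : (Config n K × Field n K p) × Config n K => (z.1.1, z.2))
      ((measurable_fst.comp measurable_fst).prodMk measurable_snd))).1.aestronglyMeasurable

end FieldMean

end TensorOverlap

namespace TensorOverlap

/-! ### Continuity in the signal-to-noise matrix. -/

section Continuity

open Filter Topology in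
theorem continuous_integral_mul_exp {α Y : Type*} [MeasurableSpace α] [TopologicalSpace Y]
    [FirstCountableTopology Y] {μ : Measure α} [IsProbabilityMeasure μ] {E : Y → α → ℝ}
    (hE : ∀ y, BddMeas (E y)) (hc : ∀ x, Continuous fun y => E y x) {C : Y → ℝ} (hC : Continuous C)
    (hEC : ∀ y x, |E y x| ≤ C y) {g : α → ℝ} (hg : BddMeas g) :
    Continuous fun y => ∫ x, g x * Real.exp (E y x) ∂μ := by
  obtain ⟨D, hD⟩ := hg.2
  refine continuous_iff_continuousAt.2 fun y₀ => ?_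
  have hev : ∀ᶠ y in 𝓝 y₀, C y < C y₀ + 1 :=
    hC.continuousAt.eventually_lt_const (lt_add_one _)
  refine continuousAt_of_dominated (bound := fun _ => D * Real.exp (C y₀ + 1))
    (Eventually.of_forall fun y => (hg.mul (hE y).exp).1.aestronglyMeasurable)
    (hev.mono fun y hy => Eventually.of_forall fun x => ?_) (integrable_const _)
    (Eventually.of_forall fun x => (Continuous.mul continuous_const (hc x).rexp).continuousAt)
  rw [Real.norm_eq_abs, abs_mul, Real.abs_exp]
  exact mul_le_mul (hD x) (Real.exp_le_exp.2 ((le_abs_self _).trans ((hEC y x).trans hy.le)))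
    (Real.exp_pos _).le ((abs_nonneg _).trans (hD x))

theorem continuous_gibbsMean {α Y : Type*} [MeasurableSpace α] [TopologicalSpace Y]
    [FirstCountableTopology Y] {μ : Measure α} [IsProbabilityMeasure μ] {E : Y → α → ℝ}
    (hE : ∀ y, BddMeas (E y)) (hc : ∀ x, Continuous fun y => E y x) {C : Y → ℝ} (hC : Continuous C)
    (hEC : ∀ y x, |E y x| ≤ C y) {g : α → ℝ} (hg : BddMeas g) :
    Continuous fun y => gibbsMean μ (E y) g := by
  have h1 := continuous_integral_mul_exp (μ := μ) hE hc hC hEC (BddMeas.const 1)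
  simp only [one_mul] at h1
  exact (continuous_integral_mul_exp hE hc hC hEC hg).div h1 fun y => (integral_exp_pos (hE y)).ne'

variable {n K p : ℕ} {P : Measure (Fin K → ℝ)} [IsProbabilityMeasure P]

theorem continuousOn_fieldMean {B : ℝ} (hB : 0 ≤ B) (t : ℝ) (X : Config n K) (q : Field n K p)
    {g : Config n K → ℝ} (hg : BddMeas g) :
    ContinuousOn (fun R => fieldMean P B t R (X, rowField (matSqrt R) q) g)
      {R : Matrix (Fin K) (Fin K) ℝ | R.PosSemidef} := by
  have h := continuous_gibbsMean (μ := Measure.pi fun _ : Fin n => P)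
    (E := fun (y : (Fin K → Fin K → ℝ) × Field n K p) x =>
      fieldExp t (y.1 : Matrix (Fin K) (Fin K) ℝ) (truncRows B X) y.2 (truncRows B x))
    (fun y => bddMeas_fieldExp hB t y.1 (X, y.2)) (fun x => continuous_fieldExp t _ _)
    (continuous_fieldBound B t) (fun y x => abs_fieldExp_le hB t y.1 X y.2 x) hg
  have h2 : ContinuousOn (fun R : Matrix (Fin K) (Fin K) ℝ =>
      ((R : Fin K → Fin K → ℝ), rowField (n := n) (p := p) (matSqrt R) q))
      {R : Matrix (Fin K) (Fin K) ℝ | R.PosSemidef} := by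
    have hs : ContinuousOn (fun R : Matrix (Fin K) (Fin K) ℝ => (matSqrt R : Fin K → Fin K → ℝ))
      {R : Matrix (Fin K) (Fin K) ℝ | R.PosSemidef} := continuousOn_matSqrt K
    have hq : Continuous fun S : Fin K → Fin K → ℝ => rowField (n := n) (p := p) S q := by
      unfold rowField
      fun_prop
    have hid : ContinuousOn (fun R : Matrix (Fin K) (Fin K) ℝ => (R : Fin K → Fin K → ℝ))
      {R : Matrix (Fin K) (Fin K) ℝ | R.PosSemidef} := continuousOn_id
    exact hid.prodMk (hq.comp_continuousOn hs)
  exact Continuous.comp_continuousOn (g := fun y : (Fin K → Fin K → ℝ) × Field n K p =>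
      gibbsMean (Measure.pi fun _ : Fin n => P) (fun x =>
        fieldExp t (y.1 : Matrix (Fin K) (Fin K) ℝ) (truncRows B X) y.2 (truncRows B x)) g)
    (f := fun R : Matrix (Fin K) (Fin K) ℝ =>
      ((R : Fin K → Fin K → ℝ), rowField (n := n) (p := p) (matSqrt R) q)) h h2

/-- The measure `fieldLaw` varies with R. Pulled back to the fixed law of the disorder, R enters
only the integrand, through the exponent and √R, and dominated convergence applies. -/
theorem continuousOn_integral_comp_fieldMean {ι : Type*} [Fintype ι] {B : ℝ} (hB : 0 ≤ B) (t : ℝ)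
    {g : ι → Config n K → Config n K → ℝ} (hg : ∀ i, BddMeas (Function.uncurry (g i)))
    {H : (ι → ℝ) → ℝ} (hH : Continuous H) :
    ContinuousOn (fun R => ∫ w, H (fun i => fieldMean P B t R w (g i w.1)) ∂(fieldLaw P n p R))
      {R : Matrix (Fin K) (Fin K) ℝ | R.PosSemidef} := by
  choose D hD using fun i => (hg i).2
  have hb : ∀ R (w : Config n K × Field n K p) i, |fieldMean P B t R w (g i w.1)| ≤ D i :=
    fun R w i => abs_gibbsMean_le (bddMeas_fieldExp hB t R w) fun x => hD i (w.1, x)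
  -- The Gibbs means range over a fixed compact box, on which H is bounded; this constant dominates.
  obtain ⟨A, hA⟩ := (isCompact_univ_pi fun i => isCompact_Icc (a := -D i) (b := D i))
    |>.exists_bound_of_continuousOn hH.continuousOn
  have hbm : ∀ R i, BddMeas fun w : Config n K × Field n K p => fieldMean P B t R w (g i w.1) :=
    fun R i => bddMeas_fieldMean hB t R (g := fun w => g i w.1)
      ((hg i).comp (g := fun z : (Config n K × Field n K p) × Config n K => (z.1.1, z.2))
      ((measurable_fst.comp measurable_fst).prodMk measurable_snd))
  have hm : ∀ R, Measurable fun w : Config n K × Field n K p =>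
      H fun i => fieldMean P B t R w (g i w.1) := fun R =>
    hH.measurable.comp (measurable_pi_iff.2 fun i => (hbm R i).1)
  have hw : ∀ R : Matrix (Fin K) (Fin K) ℝ,
      Measurable (Prod.map (id : Config n K → Config n K) (rowField (n := n) (p := p)
        (matSqrt R))) :=
    fun R => measurable_id.prodMap (measurable_rowField (matSqrt R))
  have he : ∀ R, ∫ w, H (fun i => fieldMean P B t R w (g i w.1)) ∂(fieldLaw P n p R) =
      ∫ ω, H (fun i => fieldMean P B t R (ω.1, rowField (matSqrt R) ω.2) (g i ω.1))
        ∂(disorderLaw P n p) := fun R =>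
    integral_map (hw R).aemeasurable (hm R).aestronglyMeasurable
  simp only [he]
  have : FirstCountableTopology (Matrix (Fin K) (Fin K) ℝ) :=
    inferInstanceAs (FirstCountableTopology (Fin K → Fin K → ℝ))
  refine continuousOn_of_dominated (bound := fun _ => A)
    (fun R _ => ((hm R).comp (hw R)).aestronglyMeasurable)
    (fun R _ => Filter.Eventually.of_forall fun ω => hA _ fun i _ => ?_) (integrable_const _)
    (Filter.Eventually.of_forall fun ω => ?_)
  · exact abs_le.1 (hb R (ω.1, rowField (matSqrt R) ω.2) i)
  · exact hH.comp_continuousOn (continuousOn_pi.2 fun i => continuousOn_fieldMean hB t ω.1 ω.2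
      ((hg i).comp (measurable_prodMk_left (x := ω.1))))

theorem continuousOn_overlapVar {B : ℝ} (hB : 0 ≤ B) (t : ℝ) (v : Fin K → ℝ) :
    ContinuousOn (overlapVar P n p B t v) {R : Matrix (Fin K) (Fin K) ℝ | R.PosSemidef} := by
  have hg : ∀ j : Fin n, BddMeas (Function.uncurry fun (_ : Config n K) x => rowForm B v x j) :=
    fun j => (bddMeas_rowForm hB v j).comp (measurable_snd (α := Config n K) (β := Config n K))
  have h1 := continuousOn_integral_comp_fieldMean (P := P) (p := p) hB t hg
    (H := fun y => (∑ j, y j ^ 2) ^ 2) (by fun_prop)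
  have h2 := continuousOn_integral_comp_fieldMean (P := P) (p := p) hB t hg
    (H := fun y => ∑ j, y j ^ 2) (by fun_prop)
  refine (h1.sub (h2.pow 2)).congr fun R _ => ?_
  exact variance_eq_sub ((BddMeas.sum fun j =>
    ((bddMeas_rowForm hB v j).fieldMean hB t R).pow 2).memLp _)

theorem continuousOn_covSq {B : ℝ} (hB : 0 ≤ B) (t : ℝ) (v : Fin K → ℝ) :
    ContinuousOn (covSq P n p B t v) {R : Matrix (Fin K) (Fin K) ℝ | R.PosSemidef} := by
  refine continuousOn_finsetSum _ fun k _ => continuousOn_finsetSum _ fun j _ => ?_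
  have hs : Measurable (Prod.snd : Config n K × Config n K → Config n K) := measurable_snd
  have := continuousOn_integral_comp_fieldMean (P := P) (p := p) (ι := Fin 3) hB t
    (g := ![fun (_ : Config n K) x => rowForm B v x k * rowForm B v x j,
      fun _ x => rowForm B v x k, fun _ x => rowForm B v x j])
    (fun i => by
      fin_cases i
      · exact ((bddMeas_rowForm hB v k).mul (bddMeas_rowForm hB v j)).comp hs
      · exact (bddMeas_rowForm hB v k).comp hs
      · exact (bddMeas_rowForm hB v j).comp hs)
    (H := fun y => (y 0 - y 1 * y 2) ^ 2) (by fun_prop)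
  exact this

end Continuity

end TensorOverlap

namespace TensorOverlap

/-! ### The overlap matrix: regularity, positivity and reduction to directions. -/

section Overlap

variable {n K p : ℕ} {P : Measure (Fin K → ℝ)} [IsProbabilityMeasure P]

theorem bddMeas_overlap {B : ℝ} (hB : 0 ≤ B) (l l' : Fin K) :
    BddMeas fun z : Config n K × Config n K =>
      overlap (truncRows B z.2) (truncRows B z.1) l l' :=
  (BddMeas.sum fun j => ((bddMeas_truncRows hB j l).comp measurable_snd).mul
    ((bddMeas_truncRows hB j l').comp measurable_fst)).const_mul _

theorem bddMeas_overlap_right {B : ℝ} (hB : 0 ≤ B) (X : Config n K) (l l' : Fin K) :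
    BddMeas fun x : Config n K => overlap (truncRows B x) (truncRows B X) l l' :=
  (bddMeas_overlap hB l l').comp (measurable_prodMk_left (x := X))

theorem bddMeas_fieldMean_of_signal {B : ℝ} (hB : 0 ≤ B) (t : ℝ) (R : Matrix (Fin K) (Fin K) ℝ)
    {g : Config n K → Config n K → ℝ} (hg : BddMeas (Function.uncurry g)) :
    BddMeas fun w : Config n K × Field n K p => fieldMean P B t R w (g w.1) :=
  bddMeas_fieldMean hB t R (g := fun w => g w.1)
    (hg.comp (g := fun z : (Config n K × Field n K p) × Config n K => (z.1.1, z.2))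
      ((measurable_fst.comp measurable_fst).prodMk measurable_snd))

theorem meanOverlap_eq {B : ℝ} (hB : 0 ≤ B) (hP : ∀ᵐ x ∂P, ‖x‖ ≤ B) {t : ℝ} (ht : t ≤ 1)
    {R : Matrix (Fin K) (Fin K) ℝ} (hR : R.PosSemidef) (l l' : Fin K) :
    meanOverlap P n p t R l l' =
      ∫ w, fieldMean P B t R w (fun x => overlap (truncRows B x) (truncRows B w.1) l l')
        ∂(fieldLaw P n p R) :=
  integral_gibbs_eq hB hP ht hR (G := fun X x => overlap x X l l') (bddMeas_overlap hB l l')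

theorem overlapFluctuation_eq {B : ℝ} (hB : 0 ≤ B) (hP : ∀ᵐ x ∂P, ‖x‖ ≤ B) {t : ℝ} (ht : t ≤ 1)
    {R : Matrix (Fin K) (Fin K) ℝ} (hR : R.PosSemidef) :
    overlapFluctuation P n p t R = ∑ l, ∑ l', ∫ w, fieldMean P B t R w
      (fun x => (overlap (truncRows B x) (truncRows B w.1) l l' - meanOverlap P n p t R l l') ^ 2)
        ∂(fieldLaw P n p R) := by
  have hb : ∀ l l', BddMeas fun z : Config n K × Config n K =>
      (overlap (truncRows B z.2) (truncRows B z.1) l l' - meanOverlap P n p t R l l') ^ 2 :=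
    fun l l' => ((bddMeas_overlap hB l l').sub (BddMeas.const _)).pow 2
  have hG : BddMeas fun z : Config n K × Config n K =>
      frobSq (overlap (truncRows B z.2) (truncRows B z.1) - meanOverlap P n p t R) := by
    simp only [frobSq, Matrix.sub_apply]
    exact BddMeas.sum fun l => BddMeas.sum fun l' => hb l l'
  have h0 := integral_gibbs_eq hB hP ht hR (p := p) (G := fun X x => frobSq (overlap x X -
    meanOverlap P n p t R)) hG
  rw [overlapFluctuation, h0]
  have e : ∀ w : Config n K × Field n K p, fieldMean P B t R w (fun x =>
      frobSq (overlap (truncRows B x) (truncRows B w.1) - meanOverlap P n p t R)) =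
      ∑ l, ∑ l', fieldMean P B t R w (fun x =>
      (overlap (truncRows B x) (truncRows B w.1) l l' - meanOverlap P n p t R l l') ^ 2) := by
    intro w
    have hE := bddMeas_fieldExp hB t R w
    have hb' : ∀ l l', BddMeas fun x : Config n K =>
      (overlap (truncRows B x) (truncRows B w.1) l l' - meanOverlap P n p t R l l') ^ 2 :=
      fun l l' => ((bddMeas_overlap_right hB w.1 l l').sub (BddMeas.const _)).pow 2
    simp only [fieldMean, frobSq, Matrix.sub_apply]
    rw [gibbsMean_sum hE _ fun l => BddMeas.sum fun l' => hb' l l']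
    exact Finset.sum_congr rfl fun l _ => gibbsMean_sum hE _ fun l' => hb' l l'
  simp only [e]
  have hi : ∀ l l', BddMeas fun w : Config n K × Field n K p => fieldMean P B t R w (fun x =>
      (overlap (truncRows B x) (truncRows B w.1) l l' - meanOverlap P n p t R l l') ^ 2) :=
    fun l l' => bddMeas_fieldMean_of_signal hB t R (g := fun X x =>
      (overlap (truncRows B x) (truncRows B X) l l' - meanOverlap P n p t R l l') ^ 2) (hb l l')
  rw [integral_finsetSum _ fun l _ => (BddMeas.sum fun l' => hi l l').integrable _]
  exact Finset.sum_congr rfl fun l _ => integral_finsetSum _ fun l' _ => (hi l l').integrable _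

/-- The centring depends on R as well; expanding into second moment minus squared mean separates the
two. -/
theorem continuousOn_overlapFluctuation {B : ℝ} (hB : 0 ≤ B) (hP : ∀ᵐ x ∂P, ‖x‖ ≤ B) {t : ℝ}
    (ht : t ≤ 1) :
    ContinuousOn (overlapFluctuation P n p t) {R : Matrix (Fin K) (Fin K) ℝ | R.PosSemidef} := by
  have hc : ∀ l l', ContinuousOn (fun R => (∫ w, fieldMean P B t R w
      (fun x => overlap (truncRows B x) (truncRows B w.1) l l' ^ 2) ∂(fieldLaw P n p R)) -
      meanOverlap P n p t R l l' ^ 2) {R : Matrix (Fin K) (Fin K) ℝ | R.PosSemidef} := by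
    intro l l'
    have h1 := continuousOn_integral_comp_fieldMean (P := P) (n := n) (p := p)
      (ι := Unit) hB t
      (g := fun _ X x => overlap (truncRows B x) (truncRows B X) l l' ^ 2)
      (fun _ => (bddMeas_overlap hB l l').pow 2) (H := fun y => y ()) (by fun_prop)
    have h2 := continuousOn_integral_comp_fieldMean (P := P) (n := n) (p := p)
      (ι := Unit) hB t
      (g := fun _ X x => overlap (truncRows B x) (truncRows B X) l l')
      (fun _ => bddMeas_overlap hB l l') (H := fun y => y ()) (by fun_prop)
    refine h1.sub (ContinuousOn.pow (h2.congr fun R hR => ?_) 2)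
    exact meanOverlap_eq hB hP ht hR l l'
  refine (continuousOn_finsetSum Finset.univ fun l _ => continuousOn_finsetSum Finset.univ
    fun l' _ => hc l l').congr fun R hR => ?_
  rw [overlapFluctuation_eq hB hP ht hR]
  refine Finset.sum_congr rfl fun l _ => Finset.sum_congr rfl fun l' _ => ?_
  set m := meanOverlap P n p t R l l' with hm
  have e : ∀ w : Config n K × Field n K p, fieldMean P B t R w (fun x =>
      (overlap (truncRows B x) (truncRows B w.1) l l' - m) ^ 2) =
      fieldMean P B t R w (fun x => overlap (truncRows B x) (truncRows B w.1) l l' ^ 2) -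
      2 * m * fieldMean P B t R w (fun x => overlap (truncRows B x) (truncRows B w.1) l l') +
      m ^ 2 := by
    intro w
    have hE := bddMeas_fieldExp hB t R w
    have hb := bddMeas_overlap_right hB w.1 l l'
    have : (fun x => (overlap (truncRows B x) (truncRows B w.1) l l' - m) ^ 2) = fun x =>
        (overlap (truncRows B x) (truncRows B w.1) l l' ^ 2 -
          2 * m * overlap (truncRows B x) (truncRows B w.1) l l') + m ^ 2 := by
      ext x; ring
    simp only [fieldMean]
    rw [this, gibbsMean_add hE ((hb.pow 2).sub (hb.const_mul _)) (BddMeas.const _),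
      gibbsMean_sub hE (hb.pow 2) (hb.const_mul _), gibbsMean_const_mul, gibbsMean_const hE]
  have i1 : BddMeas fun w : Config n K × Field n K p => fieldMean P B t R w
      (fun x => overlap (truncRows B x) (truncRows B w.1) l l' ^ 2) :=
    bddMeas_fieldMean_of_signal hB t R (g := fun X x =>
      overlap (truncRows B x) (truncRows B X) l l' ^ 2) ((bddMeas_overlap hB l l').pow 2)
  have i2 : BddMeas fun w : Config n K × Field n K p => fieldMean P B t R w
      (fun x => overlap (truncRows B x) (truncRows B w.1) l l') :=
    bddMeas_fieldMean_of_signal hB t R (g := fun X x =>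
      overlap (truncRows B x) (truncRows B X) l l') (bddMeas_overlap hB l l')
  simp only [e]
  rw [integral_add ((i1.sub (i2.const_mul _)).integrable _) (integrable_const _),
    integral_sub (i1.integrable _) ((i2.const_mul _).integrable _), integral_const_mul,
    ← meanOverlap_eq hB hP ht hR, ← hm]
  simp only [integral_const, probReal_univ, one_smul]
  ring

theorem overlapFluctuation_nonneg {B : ℝ} (hB : 0 ≤ B) (hP : ∀ᵐ x ∂P, ‖x‖ ≤ B) {t : ℝ} (ht : t ≤ 1)
    {R : Matrix (Fin K) (Fin K) ℝ} (hR : R.PosSemidef) : 0 ≤ overlapFluctuation P n p t R := by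
  rw [overlapFluctuation_eq hB hP ht hR]
  refine Finset.sum_nonneg fun l _ => Finset.sum_nonneg fun l' _ => integral_nonneg fun w => ?_
  have h := gibbsMean_mono (μ := Measure.pi fun _ : Fin n => P) (bddMeas_fieldExp hB t R w)
    (BddMeas.const 0) (((bddMeas_overlap_right hB w.1 l l').sub
    (BddMeas.const (meanOverlap P n p t R l l'))).pow 2) fun x => sq_nonneg _
  rw [gibbsMean_const (bddMeas_fieldExp hB t R w)] at h
  exact h

/-- The degenerate factorisation with gain 0 and direction 0: results on line channels thereby cover
the model itself. -/
theorem matSqrt_line {R : Matrix (Fin K) (Fin K) ℝ} (hR : R.PosSemidef) (l l' : Fin K) :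
    (∑ k, matSqrt R l k * matSqrt R l' k) + (0 : ℝ) ^ 2 * ((0 : Fin K → ℝ) l * (0 : Fin K → ℝ) l') =
      R l l' := by
  rw [sum_matSqrt_mul hR]
  simp

theorem rowForm_single (B : ℝ) (l : Fin K) (x : Config n K) (j : Fin n) :
    rowForm B (Pi.single l 1) x j = truncRows B x j l := by
  simp [rowForm, Pi.single_apply]

theorem rowForm_add (B : ℝ) (v v' : Fin K → ℝ) (x : Config n K) (j : Fin n) :
    rowForm B (v + v') x j = rowForm B v x j + rowForm B v' x j := by
  simp [rowForm, add_mul, Finset.sum_add_distrib]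

/-- The channel without additional observation, in the form of a line channel. -/
noncomputable abbrev restChan (B t : ℝ) (R : Matrix (Fin K) (Fin K) ℝ) :
    Config n K → (TensorIndex n p ⊕ Fin n × Fin K) ⊕ Fin n → ℝ :=
  lineChan (baseChan B t (matSqrt R)) (rowForm B 0) 0

theorem bddMeas_restChan {B : ℝ} (hB : 0 ≤ B) (t : ℝ) (R : Matrix (Fin K) (Fin K) ℝ)
    (i : (TensorIndex n p ⊕ Fin n × Fin K) ⊕ Fin n) :
    BddMeas fun x : Config n K => restChan B t R x i :=
  bddMeas_lineChan (bddMeas_baseChan hB t (matSqrt R)) (bddMeas_rowForm hB 0) 0 i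

theorem integral_fieldMean_eq_post {B : ℝ} (hB : 0 ≤ B) (t : ℝ)
    {R : Matrix (Fin K) (Fin K) ℝ} (hR : R.PosSemidef) {g : Config n K → Config n K → ℝ}
    (hg : BddMeas (Function.uncurry g)) :
    ∫ w, fieldMean P B t R w (g w.1) ∂(fieldLaw P n p R) =
      ∫ z, post (Measure.pi fun _ : Fin n => P) (restChan (p := p) B t R)
        (obs (restChan B t R) z) (g z.1)
        ∂(chanLaw (Measure.pi fun _ : Fin n => P)
          ((TensorIndex n p ⊕ Fin n × Fin K) ⊕ Fin n)) := by
  rw [integral_fieldLaw_line hR (matSqrt_line hR)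
    (bddMeas_fieldMean_of_signal hB t R hg).1]
  simp only [fieldMean_line (matSqrt_line hR), Prod.map_fst, id]

theorem meanOverlap_eq_post {B : ℝ} (hB : 0 ≤ B) (hP : ∀ᵐ x ∂P, ‖x‖ ≤ B) {t : ℝ} (ht : t ≤ 1)
    {R : Matrix (Fin K) (Fin K) ℝ} (hR : R.PosSemidef) (l l' : Fin K) :
    meanOverlap P n p t R l l' =
      ∫ z, post (Measure.pi fun _ : Fin n => P) (restChan (p := p) B t R)
        (obs (restChan B t R) z)
        (fun x => 1 / (n : ℝ) * ∑ j, truncRows B x j l * truncRows B z.1 j l')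
        ∂(chanLaw (Measure.pi fun _ : Fin n => P)
          ((TensorIndex n p ⊕ Fin n × Fin K) ⊕ Fin n)) := by
  rw [meanOverlap_eq hB hP ht hR]
  exact integral_fieldMean_eq_post hB t hR (g := fun X x =>
    overlap (truncRows B x) (truncRows B X) l l') (bddMeas_overlap hB l l')

theorem meanOverlap_eq_integral_mul {B : ℝ} (hB : 0 ≤ B) (hP : ∀ᵐ x ∂P, ‖x‖ ≤ B) {t : ℝ}
    (ht : t ≤ 1) {R : Matrix (Fin K) (Fin K) ℝ} (hR : R.PosSemidef) (l l' : Fin K) :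
    meanOverlap P n p t R l l' = ∫ z, 1 / (n : ℝ) * ∑ j,
        post (Measure.pi fun _ : Fin n => P) (restChan (p := p) B t R) (obs (restChan B t R) z)
          (fun x => truncRows B x j l) *
        post (Measure.pi fun _ : Fin n => P) (restChan (p := p) B t R) (obs (restChan B t R) z)
          (fun x => truncRows B x j l')
        ∂(chanLaw (Measure.pi fun _ : Fin n => P)
          ((TensorIndex n p ⊕ Fin n × Fin K) ⊕ Fin n)) := by
  rw [meanOverlap_eq_post hB hP ht hR]
  exact integral_post_overlap (bddMeas_restChan hB t R) (fun j => bddMeas_truncRows hB j l)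
    (fun j => bddMeas_truncRows hB j l') _

theorem abs_meanOverlap_le {B : ℝ} (hB : 0 ≤ B) (hP : ∀ᵐ x ∂P, ‖x‖ ≤ B) {t : ℝ}
    (ht : t ≤ 1) (hn : 1 ≤ n) {R : Matrix (Fin K) (Fin K) ℝ} (hR : R.PosSemidef) (l l' : Fin K) :
    |meanOverlap P n p t R l l'| ≤ B ^ 2 := by
  rw [meanOverlap_eq_integral_mul hB hP ht hR, ← Real.norm_eq_abs]
  refine (norm_integral_le_of_norm_le_const (C := B ^ 2)
    (μ := chanLaw (Measure.pi fun _ : Fin n => P) ((TensorIndex n p ⊕ Fin n × Fin K) ⊕ Fin n))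
    (Filter.Eventually.of_forall fun z => ?_)).trans
    (by rw [probReal_univ, mul_one])
  have hE := bddMeas_logLik (bddMeas_restChan (n := n) (p := p) hB t R) (obs (restChan B t R) z)
  have hm : ∀ j l, |post (Measure.pi fun _ : Fin n => P) (restChan (p := p) B t R)
      (obs (restChan B t R) z) (fun x => truncRows B x j l)| ≤ B := fun j l =>
    abs_gibbsMean_le hE fun x => abs_truncRows_le hB x j l
  have hn0 : (0 : ℝ) < n := by exact_mod_cast hn
  rw [Real.norm_eq_abs, abs_mul, abs_of_nonneg (by positivity : (0 : ℝ) ≤ 1 / n)]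
  have : |∑ j, post (Measure.pi fun _ : Fin n => P) (restChan (p := p) B t R)
      (obs (restChan B t R) z) (fun x => truncRows B x j l) *
      post (Measure.pi fun _ : Fin n => P) (restChan (p := p) B t R)
      (obs (restChan B t R) z) (fun x => truncRows B x j l')| ≤ n * B ^ 2 := by
    refine (Finset.abs_sum_le_sum_abs _ _).trans
      ((Finset.sum_le_sum (g := fun _ => B ^ 2) fun j _ => ?_).trans (by simp))
    rw [abs_mul, pow_two]
    exact mul_le_mul (hm j l) (hm j l') (abs_nonneg _) hB
  refine (mul_le_mul_of_nonneg_left this (by positivity)).trans (le_of_eq ?_)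
  field_simp

/-- By Nishimori the mean overlap is the expectation of the Gram matrix mᵀm/n of the posterior
means. -/
theorem posSemidef_meanOverlap {B : ℝ} (hB : 0 ≤ B) (hP : ∀ᵐ x ∂P, ‖x‖ ≤ B) {t : ℝ}
    (ht : t ≤ 1) {R : Matrix (Fin K) (Fin K) ℝ} (hR : R.PosSemidef) :
    (meanOverlap P n p t R).PosSemidef := by
  set m : Config n K × ((TensorIndex n p ⊕ Fin n × Fin K) ⊕ Fin n → ℝ) → Fin n → Fin K → ℝ :=
    fun z j l => post (Measure.pi fun _ : Fin n => P) (restChan (p := p) B t R)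
      (obs (restChan B t R) z) (fun x => truncRows B x j l) with hm
  have hmb : ∀ j l, BddMeas fun z => m z j l := fun j l =>
    (bddMeas_post (bddMeas_restChan hB t R) (bddMeas_truncRows hB j l)).obs
      (bddMeas_restChan hB t R)
  have he : ∀ l l', meanOverlap P n p t R l l' = ∫ z, 1 / (n : ℝ) * ∑ j, m z j l * m z j l'
      ∂(chanLaw (Measure.pi fun _ : Fin n => P) ((TensorIndex n p ⊕ Fin n × Fin K) ⊕ Fin n)) :=
    meanOverlap_eq_integral_mul hB hP ht hR
  have hb : ∀ l l', BddMeas fun z => 1 / (n : ℝ) * ∑ j, m z j l * m z j l' := fun l l' =>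
    (BddMeas.sum fun j => (hmb j l).mul (hmb j l')).const_mul _
  refine Matrix.PosSemidef.of_dotProduct_mulVec_nonneg ?_ fun x => ?_
  · ext l l'
    simp only [Matrix.conjTranspose_apply, star_trivial]
    rw [he, he]
    simp only [mul_comm]
  · have e : star x ⬝ᵥ (meanOverlap P n p t R).mulVec x = ∑ l, ∑ l', x l * x l' *
        meanOverlap P n p t R l l' := by
      simp only [dotProduct, Matrix.mulVec, Finset.mul_sum, star_trivial]
      exact Finset.sum_congr rfl fun l _ => Finset.sum_congr rfl fun l' _ => by ring
    rw [e]
    have e2 : ∑ l, ∑ l', x l * x l' * meanOverlap P n p t R l l' = ∫ z, ∑ l, ∑ l', x l * x l' *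
        (1 / (n : ℝ) * ∑ j, m z j l * m z j l') ∂(chanLaw (Measure.pi fun _ : Fin n => P)
        ((TensorIndex n p ⊕ Fin n × Fin K) ⊕ Fin n)) := by
      rw [integral_finsetSum _ fun l _ => (BddMeas.sum fun l' =>
        (hb l l').const_mul _).integrable _]
      refine Finset.sum_congr rfl fun l _ => ?_
      rw [integral_finsetSum _ fun l' _ => ((hb l l').const_mul _).integrable _]
      refine Finset.sum_congr rfl fun l' _ => ?_
      rw [integral_const_mul, he]
    rw [e2]
    refine integral_nonneg fun z => ?_
    have : ∑ l, ∑ l', x l * x l' * (1 / (n : ℝ) * ∑ j, m z j l * m z j l') =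
        1 / (n : ℝ) * ∑ j, (∑ l, x l * m z j l) ^ 2 := by
      have h2 : ∑ j, (∑ l, x l * m z j l) ^ 2 =
          ∑ l, ∑ l', ∑ j, x l * m z j l * (x l' * m z j l') := by
        simp only [pow_two, Finset.sum_mul_sum]
        rw [Finset.sum_comm]
        exact Finset.sum_congr rfl fun l _ => Finset.sum_comm
      rw [h2]
      simp only [Finset.mul_sum]
      exact Finset.sum_congr rfl fun l _ => Finset.sum_congr rfl fun l' _ =>
        Finset.sum_congr rfl fun j _ => by ring
    simp only [Pi.zero_apply]
    rw [this]
    positivity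

/-- The fluctuations of the overlap in terms of the variances of the overlaps of posterior means
and the posterior covariances, in finitely many directions. -/
theorem overlapFluctuation_le {B : ℝ} (hB : 0 ≤ B) (hP : ∀ᵐ x ∂P, ‖x‖ ≤ B) {t : ℝ}
    (ht : t ≤ 1) (hn : 1 ≤ n) {η : ℝ} (hη : 0 < η) {R : Matrix (Fin K) (Fin K) ℝ}
    (hR : R.PosSemidef) :
    overlapFluctuation P n p t R ≤ ∑ l, ∑ l' : Fin K, (3 / (4 * (n : ℝ) ^ 2) *
      (overlapVar P n p B t (Pi.single l 1 + Pi.single l' 1) R +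
        overlapVar P n p B t (Pi.single l 1) R + overlapVar P n p B t (Pi.single l' 1) R) +
      (B ^ 2 * η + B ^ 2 / (2 * η * (n : ℝ) ^ 2) *
        (covSq P n p B t (Pi.single l 1) R + covSq P n p B t (Pi.single l' 1) R))) := by
  rw [overlapFluctuation_eq hB hP ht hR]
  refine Finset.sum_le_sum fun l _ => Finset.sum_le_sum fun l' _ => ?_
  have hn0 : (0 : ℝ) < n := by exact_mod_cast hn
  have hΦ := bddMeas_restChan (n := n) (p := p) hB t R
  have hf : ∀ l, ∀ j : Fin n, BddMeas fun x : Config n K => truncRows B x j l :=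
    fun l j => bddMeas_truncRows hB j l
  have h1 := integral_post_overlap_sub_sq_le (μ := Measure.pi fun _ : Fin n => P) hΦ (hf l) (hf l')
    hB hη (fun j x => abs_truncRows_le hB x j l) (fun j x => abs_truncRows_le hB x j l')
    (1 / (n : ℝ))
  rw [← meanOverlap_eq_post hB hP ht hR] at h1
  rw [integral_fieldMean_eq_post hB t hR (g := fun X x =>
    (overlap (truncRows B x) (truncRows B X) l l' - meanOverlap P n p t R l l') ^ 2)
    (((bddMeas_overlap hB l l').sub (BddMeas.const _)).pow 2)]
  refine h1.trans (add_le_add ?_ ?_)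
  · rw [overlapVar_eq hB t hR (matSqrt_line hR), overlapVar_eq hB t hR (matSqrt_line hR),
      overlapVar_eq hB t hR (matSqrt_line hR)]
    have hb : ∀ v : Fin K → ℝ, BddMeas fun z => ∑ j : Fin n, post (Measure.pi fun _ : Fin n => P)
        (restChan (p := p) B t R) (obs (restChan B t R) z) (fun x => rowForm B v x j) ^ 2 :=
      fun v => BddMeas.sum fun j => ((bddMeas_post hΦ (bddMeas_rowForm hB v j)).obs hΦ).pow 2
    -- Polarisation of the entry (l, l'), with prefactor 1/(2n), whence 3 · (1/(2n))² = 3/(4n²).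
    have h2 := variance_sub_sub_le ((hb (Pi.single l 1 + Pi.single l' 1)).memLp
      (chanLaw (Measure.pi fun _ : Fin n => P) ((TensorIndex n p ⊕ Fin n × Fin K) ⊕ Fin n)))
      ((hb (Pi.single l 1)).memLp _) ((hb (Pi.single l' 1)).memLp _) (1 / (2 * (n : ℝ)))
    refine le_trans (le_of_eq ?_) (h2.trans (le_of_eq ?_))
    · congr 1
      ext z
      have hE := bddMeas_logLik hΦ (obs (restChan B t R) z)
      rw [← Finset.sum_sub_distrib, ← Finset.sum_sub_distrib, Finset.mul_sum, Finset.mul_sum]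
      refine Finset.sum_congr rfl fun j _ => ?_
      have : post (Measure.pi fun _ : Fin n => P) (restChan (p := p) B t R)
          (obs (restChan B t R) z) (fun x => rowForm B (Pi.single l 1 + Pi.single l' 1) x j) =
          post (Measure.pi fun _ : Fin n => P) (restChan (p := p) B t R)
            (obs (restChan B t R) z) (fun x => truncRows B x j l) +
          post (Measure.pi fun _ : Fin n => P) (restChan (p := p) B t R)
            (obs (restChan B t R) z) (fun x => truncRows B x j l') := by
        simp only [rowForm_add, rowForm_single]
        exact gibbsMean_add hE (hf l j) (hf l' j)
      rw [this]
      simp only [rowForm_single]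
      field_simp
      ring
    · field_simp
      ring
  · rw [covSq_eq hB t hR (matSqrt_line hR), covSq_eq hB t hR (matSqrt_line hR)]
    simp only [rowForm_single, Fintype.card_fin]
    refine le_of_eq ?_
    field_simp

end Overlap

end TensorOverlap

namespace TensorOverlap

/-! ### Estimates along lines of signal-to-noise matrices. -/

section Line

/-- The matrix is affine in x = r², whereas the free energy is studied in the gain r. -/
theorem lintegral_Icc_eq_lintegral_sq {a b : ℝ} (ha : 0 < a) (hab : a ≤ b) (f : ℝ → ℝ) :
    ∫⁻ x in Set.Icc (a ^ 2) (b ^ 2), ENNReal.ofReal (f x) =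
      ∫⁻ r in Set.Icc a b, ENNReal.ofReal (2 * r * f (r ^ 2)) := by
  have himg : (fun r : ℝ => r ^ 2) '' Set.Icc a b = Set.Icc (a ^ 2) (b ^ 2) := by
    ext x
    constructor
    · rintro ⟨r, hr, rfl⟩
      exact ⟨pow_le_pow_left₀ ha.le hr.1 2, pow_le_pow_left₀ (ha.le.trans hr.1) hr.2 2⟩
    · intro hx
      have hx0 : 0 ≤ x := (sq_nonneg a).trans hx.1
      exact ⟨√x, ⟨Real.le_sqrt_of_sq_le hx.1,
        (Real.sqrt_le_left (ha.le.trans hab)).2 hx.2⟩, Real.sq_sqrt hx0⟩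
  rw [← himg, lintegral_image_eq_lintegral_abs_deriv_mul measurableSet_Icc
    (f' := fun r => 2 * r) (fun r _ => ?_) (fun r hr r' hr' h => ?_)]
  · refine setLIntegral_congr_fun measurableSet_Icc fun r hr => ?_
    have h2 : 0 ≤ 2 * r := by linarith [hr.1]
    rw [abs_of_nonneg h2, ENNReal.ofReal_mul h2]
  · simpa using (hasDerivAt_pow 2 r).hasDerivWithinAt
  · exact (pow_left_inj₀ (ha.le.trans hr.1) (ha.le.trans hr'.1) two_ne_zero).1 h

variable {n K p : ℕ} {P : Measure (Fin K → ℝ)} [IsProbabilityMeasure P]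

/-- The constant in the bound for the variance of the overlap along lines. -/
noncomputable def lineConst (K p : ℕ) (B σ : ℝ) : ℝ :=
  36 * freeEnergyConst K p B σ + 16 * (72 * B ^ 2 + 2 * B) ^ 2

theorem lineConst_nonneg {B σ : ℝ} : 0 ≤ lineConst K p B σ := by
  have := freeEnergyConst_nonneg (K := K) (p := p) (B := B) (σ := σ)
  unfold lineConst
  positivity

theorem posSemidef_add_smul {R₀ : Matrix (Fin K) (Fin K) ℝ} (hR₀ : R₀.PosSemidef) (u : Fin K → ℝ)
    {c : ℝ} (hc : 0 ≤ c) : (R₀ + c • Matrix.vecMulVec u u).PosSemidef :=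
  hR₀.add ((by simpa using Matrix.posSemidef_vecMulVec_self_star u :
    (Matrix.vecMulVec u u).PosSemidef).smul hc)

theorem sum_matSqrt_add {R₀ : Matrix (Fin K) (Fin K) ℝ} (hR₀ : R₀.PosSemidef) (u : Fin K → ℝ)
    (r : ℝ) (l l' : Fin K) : (∑ k, matSqrt R₀ l k * matSqrt R₀ l' k) + r ^ 2 * (u l * u l') =
      (R₀ + r ^ 2 • Matrix.vecMulVec u u) l l' := by
  rw [sum_matSqrt_mul hR₀]
  simp [Matrix.vecMulVec_apply]

/-- The free energy has variance O(n) and its mean slope is O(n), so the window δ costs n/δ² + n²δ.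
The relation nδ³ = 1 equates the two terms. Starting at x = s/2 keeps the gain above √(s/2), whence
the factor 1/√s. -/
theorem lintegral_line_overlapVar_le (hp : 1 ≤ p) (hn : 1 ≤ n) {B : ℝ} (hB : 0 ≤ B) {t : ℝ}
    (ht : t ∈ Set.Icc (0 : ℝ) 1) {R₀ : Matrix (Fin K) (Fin K) ℝ} (hR₀ : R₀.PosSemidef) {M : ℝ}
    (hM : ∀ l, R₀ l l ≤ M) {u : Fin K → ℝ} (hu : ∑ l, |u l| ≤ 2) {s δ : ℝ} (hs : 0 < s)
    (hs1 : s ≤ 1) (hδ : 0 < δ) (hδ1 : δ ≤ 1) (hnδ : n * δ ^ 3 = 1) :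
    ∫⁻ x in Set.Icc (s / 2) (s / 2 + 1), ENNReal.ofReal
      (overlapVar P n p B t u (R₀ + x • Matrix.vecMulVec u u)) ≤
      ENNReal.ofReal (4 / √s * (lineConst K p B (√M) * (n ^ 2 * δ))) := by
  set a := √(s / 2) with ha
  set b := √(s / 2 + 1) with hb
  have ha0 : 0 < a := Real.sqrt_pos.2 (by linarith)
  have hab : a ≤ b := Real.sqrt_le_sqrt (by linarith)
  have hb2 : b ≤ 2 := by
    rw [hb, Real.sqrt_le_left (by norm_num)]; linarith
  have ea : a ^ 2 = s / 2 := Real.sq_sqrt (by linarith)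
  have eb : b ^ 2 = s / 2 + 1 := Real.sq_sqrt (by linarith)
  -- Gains stay in [-3, 3], since the upper end b is at most 2 and δ ≤ 1.
  have h := lintegral_variance_overlap_le (μ := Measure.pi fun _ : Fin n => P)
    (bddMeas_baseChan (n := n) (p := p) hB t (matSqrt R₀)) (bddMeas_rowForm hB u)
    (fun x j => abs_rowForm_le hB hu x j) (by linarith) ha0 hab hδ (ρ := 3) (by linarith)
    (by linarith) (V := freeEnergyConst K p B (√M) * n) fun r hr =>
      variance_freeEnergy_line_le hp hn P hB ht (abs_matSqrt_le hR₀ hM) (Real.sqrt_nonneg _) hu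
        (abs_le.2 hr)
  rw [show Set.Icc (s / 2) (s / 2 + 1) = Set.Icc (a ^ 2) (b ^ 2) by rw [ea, eb], lintegral_Icc_eq_lintegral_sq ha0 hab]
  have e : ∀ r : ℝ, overlapVar P n p B t u (R₀ + r ^ 2 • Matrix.vecMulVec u u) = _ := fun r =>
    overlapVar_eq hB t (posSemidef_add_smul hR₀ u (sq_nonneg r)) (sum_matSqrt_add hR₀ u r) u
  simp only [e]
  refine h.trans (ENNReal.ofReal_le_ofReal ?_)
  have hs0 : 0 < √s := Real.sqrt_pos.2 hs
  have hCF := freeEnergyConst_nonneg (K := K) (p := p) (B := B) (σ := √M)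
  have h1 : 2 / a ≤ 4 / √s := by
    rw [div_le_div_iff₀ ha0 hs0]
    have : √s ≤ 2 * a := by
      rw [Real.sqrt_le_left (by positivity), mul_pow, ea]; linarith
    linarith
  have h2 : (n : ℝ) / δ ^ 2 = n ^ 2 * δ := by
    rw [div_eq_iff (by positivity)]
    linear_combination (-(n : ℝ)) * hnδ
  have h3 : 18 * (freeEnergyConst K p B (√M) * n) / δ ^ 2 * (b - a) +
      16 * (Fintype.card (Fin n) * (6 * 3 * (2 * B) ^ 2 + 2 * B)) ^ 2 * δ ≤
      lineConst K p B (√M) * (n ^ 2 * δ) := by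
    have e1 : 18 * (freeEnergyConst K p B (√M) * n) / δ ^ 2 =
        18 * freeEnergyConst K p B (√M) * (n ^ 2 * δ) := by
      rw [← h2]; ring
    rw [e1, Fintype.card_fin]
    have h4 : 18 * freeEnergyConst K p B (√M) * (n ^ 2 * δ) * (b - a) ≤
        18 * freeEnergyConst K p B (√M) * (n ^ 2 * δ) * 2 :=
      mul_le_mul_of_nonneg_left (by linarith) (by positivity)
    refine (add_le_add_left h4 _).trans (le_of_eq ?_)
    unfold lineConst
    ring
  have h5 : 0 ≤ 18 * (freeEnergyConst K p B (√M) * n) / δ ^ 2 * (b - a) +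
      16 * (Fintype.card (Fin n) * (6 * 3 * (2 * B) ^ 2 + 2 * B)) ^ 2 * δ := by
    have := sub_nonneg.2 hab
    positivity
  exact mul_le_mul h1 h3 h5 (by positivity)

theorem lintegral_line_covSq_le {B : ℝ} (hB : 0 ≤ B) (t : ℝ)
    {R₀ : Matrix (Fin K) (Fin K) ℝ} (hR₀ : R₀.PosSemidef) {u : Fin K → ℝ} (hu : ∑ l, |u l| ≤ 2)
    {s : ℝ} (hs : 0 < s) :
    ∫⁻ x in Set.Icc (s / 2) (s / 2 + 1), ENNReal.ofReal
      (covSq P n p B t u (R₀ + x • Matrix.vecMulVec u u)) ≤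
      ENNReal.ofReal (2 * (n * (2 * B) ^ 2)) := by
  have ha0 : 0 < √(s / 2) := Real.sqrt_pos.2 (by linarith)
  have hab : √(s / 2) ≤ √(s / 2 + 1) := Real.sqrt_le_sqrt (by linarith)
  have ea : √(s / 2) ^ 2 = s / 2 := Real.sq_sqrt (by linarith)
  have eb : √(s / 2 + 1) ^ 2 = s / 2 + 1 := Real.sq_sqrt (by linarith)
  have h := lintegral_lineCov_sq_le (μ := Measure.pi fun _ : Fin n => P)
    (bddMeas_baseChan (n := n) (p := p) hB t (matSqrt R₀)) (bddMeas_rowForm hB u)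
    (fun x j => abs_rowForm_le hB hu x j) (by linarith) ha0 hab
  rw [Fintype.card_fin] at h
  rw [show Set.Icc (s / 2) (s / 2 + 1) = Set.Icc (√(s / 2) ^ 2) (√(s / 2 + 1) ^ 2) by rw [ea, eb],
    lintegral_Icc_eq_lintegral_sq ha0 hab]
  have e : ∀ r : ℝ, covSq P n p B t u (R₀ + r ^ 2 • Matrix.vecMulVec u u) = _ := fun r =>
    covSq_eq hB t (posSemidef_add_smul hR₀ u (sq_nonneg r)) (sum_matSqrt_add hR₀ u r) u
  simp only [e]
  exact h

end Line

end TensorOverlap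

namespace TensorOverlap

/-! ### From lines to regions of symmetric matrices. -/

section Region

variable {K : ℕ}

theorem symOfUpper_comm (v : UpperIndex K → ℝ) (l l' : Fin K) :
    symOfUpper v l l' = symOfUpper v l' l := by
  simp only [symOfUpper, Matrix.of_apply, min_comm, max_comm]

theorem symOfUpper_add (v w : UpperIndex K → ℝ) :
    symOfUpper (v + w) = symOfUpper v + symOfUpper w := rfl

theorem symOfUpper_smul (c : ℝ) (w : UpperIndex K → ℝ) :
    symOfUpper (c • w) = c • symOfUpper w := rfl

theorem continuous_symOfUpper : Continuous (symOfUpper (K := K)) :=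
  continuous_pi fun _ => continuous_pi fun _ => continuous_apply _

theorem quadForm_eq (R : Matrix (Fin K) (Fin K) ℝ) (y : Fin K → ℝ) :
    y ⬝ᵥ R.mulVec y = ∑ l, ∑ l', y l * y l' * R l l' := by
  simp only [dotProduct, Matrix.mulVec, Finset.mul_sum]
  exact Finset.sum_congr rfl fun l _ => Finset.sum_congr rfl fun l' _ => by ring

/-- The coordinates of the rank one matrix `u uᵀ`. -/
def upperSq (u : Fin K → ℝ) (q : UpperIndex K) : ℝ := u q.1.1 * u q.1.2

theorem symOfUpper_upperSq (u : Fin K → ℝ) : symOfUpper (upperSq u) = Matrix.vecMulVec u u := by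
  ext l l'
  simp only [symOfUpper, upperSq, Matrix.of_apply, Matrix.vecMulVec_apply]
  rcases le_total l l' with h | h
  · rw [min_eq_left h, max_eq_right h]
  · rw [min_eq_right h, max_eq_left h, mul_comm]

/-- The coordinates of the symmetric matrices that are at least `2 s` and have entries bounded by
`M`. -/
def region (K : ℕ) (s M : ℝ) : Set (UpperIndex K → ℝ) :=
  {v | (∀ y : Fin K → ℝ, 2 * s * ∑ l, y l ^ 2 ≤ y ⬝ᵥ (symOfUpper v).mulVec y) ∧ ∀ q, |v q| ≤ M}

theorem isClosed_region (s M : ℝ) : IsClosed (region K s M) := by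
  have h : region K s M = (⋂ y : Fin K → ℝ,
      {v | 2 * s * ∑ l, y l ^ 2 ≤ ∑ l, ∑ l', y l * y l' * symOfUpper v l l'}) ∩
      ⋂ q, {v | |v q| ≤ M} := by
    ext v
    simp [region, quadForm_eq]
  rw [h]
  refine (isClosed_iInter fun y => isClosed_le continuous_const ?_).inter
    (isClosed_iInter fun q => isClosed_le (by fun_prop) continuous_const)
  refine continuous_finsetSum _ fun l _ => continuous_finsetSum _ fun l' _ =>
    continuous_const.mul ?_
  exact continuous_apply _

/-- Since Σ u_l² ≤ (Σ |u_l|)² ≤ 4, the matrix (s/2) u uᵀ is at most 2s·I. This fixes the level 2s in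
the region and leaves room for a gain bounded away from 0. -/
theorem posSemidef_sub_of_mem_region {s M : ℝ} {v : UpperIndex K → ℝ} (hv : v ∈ region K s M)
    (hs : 0 ≤ s) {u : Fin K → ℝ} (hu : ∑ l, |u l| ≤ 2) :
    (symOfUpper v - (s / 2) • Matrix.vecMulVec u u).PosSemidef := by
  refine Matrix.PosSemidef.of_dotProduct_mulVec_nonneg ?_ fun y => ?_
  · ext l l'
    simp only [Matrix.conjTranspose_apply, star_trivial, Matrix.sub_apply, Matrix.smul_apply,
      Matrix.vecMulVec_apply]
    rw [symOfUpper_comm, mul_comm (u l')]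
  · have h1 := hv.1 y
    have e : (Matrix.vecMulVec u u).mulVec y = (u ⬝ᵥ y) • u := by
      ext l
      simp only [Matrix.mulVec, dotProduct, Matrix.vecMulVec_apply, Pi.smul_apply, smul_eq_mul,
        Finset.sum_mul]
      exact Finset.sum_congr rfl fun l' _ => by ring
    rw [star_trivial, Matrix.sub_mulVec, Matrix.smul_mulVec, e, dotProduct_sub, dotProduct_smul,
      dotProduct_smul, dotProduct_comm y u, smul_eq_mul, smul_eq_mul]
    have h2 : (u ⬝ᵥ y) * (u ⬝ᵥ y) ≤ 4 * ∑ l, y l ^ 2 := by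
      have h3 : (∑ l, u l * y l) ^ 2 ≤ (∑ l, u l ^ 2) * ∑ l, y l ^ 2 :=
        Finset.sum_mul_sq_le_sq_mul_sq _ _ _
      have h4 : ∑ l, u l ^ 2 ≤ 4 := by
        have h5 : ∑ l, |u l| ^ 2 ≤ (∑ l, |u l|) ^ 2 :=
          Finset.sum_sq_le_sq_sum_of_nonneg fun l _ => abs_nonneg _
        simp only [sq_abs] at h5
        have h6 : 0 ≤ ∑ l, |u l| := Finset.sum_nonneg fun l _ => abs_nonneg _
        nlinarith
      have h5 : 0 ≤ ∑ l, y l ^ 2 := Finset.sum_nonneg fun l _ => sq_nonneg _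
      have : (u ⬝ᵥ y) * (u ⬝ᵥ y) = (∑ l, u l * y l) ^ 2 := by rw [pow_two]; rfl
      rw [this]
      exact h3.trans (mul_le_mul_of_nonneg_right h4 h5)
    have := mul_le_mul_of_nonneg_left h2 hs
    nlinarith

theorem posSemidef_of_mem_region {s M : ℝ} {v : UpperIndex K → ℝ} (hv : v ∈ region K s M)
    (hs : 0 ≤ s) : (symOfUpper v).PosSemidef := by
  simpa using posSemidef_sub_of_mem_region hv hs (u := 0) (by simp)

theorem symOfUpper_diag_le {s M : ℝ} {v : UpperIndex K → ℝ} (hv : v ∈ region K s M) (l : Fin K) :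
    symOfUpper v l l ≤ M := (le_abs_self _).trans (hv.2 _)

/-- A box that contains all points from which the region can be reached in unit time. -/
def box (K : ℕ) (M : ℝ) : Set (UpperIndex K → ℝ) := Set.univ.pi fun _ => Set.Icc (-(M + 4)) (M + 4)

theorem mem_box {s M : ℝ} {v : UpperIndex K → ℝ} {u : Fin K → ℝ} (hu : ∑ l, |u l| ≤ 2) {τ : ℝ}
    (hτ : τ ∈ Set.Icc (0 : ℝ) 1) (h : v + τ • upperSq u ∈ region K s M) : v ∈ box K M := by
  intro q _
  have h1 := h.2 q
  have hul : ∀ l, |u l| ≤ 2 := fun l =>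
    (Finset.single_le_sum (f := fun l => |u l|) (fun l _ => abs_nonneg _)
      (Finset.mem_univ l)).trans hu
  have h2 : |τ * upperSq u q| ≤ 4 := by
    rw [abs_mul, upperSq, abs_mul, abs_of_nonneg hτ.1]
    have h3 := mul_le_mul (hul q.1.1) (hul q.1.2) (abs_nonneg _) (by norm_num)
    have h4 := mul_le_mul hτ.2 h3 (by positivity) (by norm_num)
    linarith
  have e : v q = (v + τ • upperSq u) q - τ * upperSq u q := by simp
  refine abs_le.1 ?_
  rw [e]
  exact (abs_sub _ _).trans (add_le_add h1 h2)

theorem volume_box_lt_top (M : ℝ) : volume (box K M) < ⊤ :=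
  (isCompact_univ_pi fun _ => isCompact_Icc).measure_lt_top

theorem region_subset_box (s M : ℝ) : region K s M ⊆ box K M := fun v hv =>
  mem_box (u := 0) (τ := 0) (by simp) (by simp) (by simpa using hv)

theorem measurable_indicator_region {s M : ℝ} (hs : 0 ≤ s) {φ : Matrix (Fin K) (Fin K) ℝ → ℝ}
    (hφ : ContinuousOn φ {R | R.PosSemidef}) :
    Measurable ((region K s M).indicator fun v => ENNReal.ofReal (φ (symOfUpper v))) := by
  classical
  have h1 : ContinuousOn (fun v => ENNReal.ofReal (φ (symOfUpper v))) (region K s M) :=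
    ENNReal.continuous_ofReal.comp_continuousOn (hφ.comp continuous_symOfUpper.continuousOn
      fun v hv => posSemidef_of_mem_region hv hs)
  have := h1.measurable_piecewise (g := 0) continuousOn_const
    (isClosed_region s M).measurableSet
  rwa [Set.piecewise_eq_indicator] at this

/-- Bound of an integral along the segments in the direction `u uᵀ`, from the bounds along segments
that start from positive semidefinite matrices. -/
theorem lintegral_indicator_line_le {s M : ℝ} (hs : 0 ≤ s) {u : Fin K → ℝ} (hu : ∑ l, |u l| ≤ 2)
    {φ : Matrix (Fin K) (Fin K) ℝ → ℝ} {A : ENNReal}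
    (hA : ∀ R₀ : Matrix (Fin K) (Fin K) ℝ, R₀.PosSemidef → (∀ l, R₀ l l ≤ M) →
      ∫⁻ x in Set.Icc (s / 2) (s / 2 + 1), ENNReal.ofReal (φ (R₀ + x • Matrix.vecMulVec u u)) ≤ A)
    (v : UpperIndex K → ℝ) :
    ∫⁻ τ in Set.Icc (0 : ℝ) 1, (region K s M).indicator
      (fun v => ENNReal.ofReal (φ (symOfUpper v))) (v + τ • upperSq u) ≤ A := by
  set T := {τ ∈ Set.Icc (0 : ℝ) 1 | v + τ • upperSq u ∈ region K s M} with hT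
  by_cases hne : T.Nonempty
  swap
  · refine le_trans (le_of_eq ?_) (zero_le (a := A))
    rw [← lintegral_zero (μ := volume.restrict (Set.Icc (0 : ℝ) 1))]
    refine setLIntegral_congr_fun measurableSet_Icc fun τ hτ => ?_
    exact Set.indicator_of_notMem (fun h => hne ⟨τ, hτ, h⟩) _
  have hcl : IsClosed T := isClosed_Icc.inter ((isClosed_region s M).preimage (by fun_prop))
  have hcomp : IsCompact T := isCompact_Icc.of_isClosed_subset hcl fun τ hτ => hτ.1
  -- The first time at which the segment meets the region. Moving back from there by (s/2) u uᵀ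
  -- gives a positive semidefinite base point, and all later times correspond to parameters in [s/2,
  -- s/2 + 1].
  set τ₁ := sInf T with hτ₁
  have hmem : τ₁ ∈ T := hcomp.sInf_mem hne
  have hle : ∀ τ ∈ T, τ₁ ≤ τ := fun τ hτ => csInf_le hcomp.bddBelow hτ
  set R₀ := symOfUpper (v + τ₁ • upperSq u) - (s / 2) • Matrix.vecMulVec u u with hR₀
  have hpsd : R₀.PosSemidef := posSemidef_sub_of_mem_region hmem.2 hs hu
  have hdiag : ∀ l, R₀ l l ≤ M := fun l => by
    have h1 := symOfUpper_diag_le hmem.2 l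
    have h2 : 0 ≤ s / 2 * (u l * u l) := mul_nonneg (by linarith) (mul_self_nonneg _)
    simp only [hR₀, Matrix.sub_apply, Matrix.smul_apply, Matrix.vecMulVec_apply, smul_eq_mul]
    linarith
  have hkey : ∀ τ, symOfUpper (v + τ • upperSq u) =
      R₀ + (τ + (s / 2 - τ₁)) • Matrix.vecMulVec u u := by
    intro τ
    rw [hR₀]
    simp only [symOfUpper_add, symOfUpper_smul, symOfUpper_upperSq]
    ext l l'
    simp only [Matrix.add_apply, Matrix.sub_apply, Matrix.smul_apply, smul_eq_mul]
    ring
  set F : ℝ → ENNReal := (Set.Icc (s / 2) (s / 2 + 1)).indicator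
    fun x => ENNReal.ofReal (φ (R₀ + x • Matrix.vecMulVec u u)) with hF
  calc ∫⁻ τ in Set.Icc (0 : ℝ) 1, (region K s M).indicator
        (fun v => ENNReal.ofReal (φ (symOfUpper v))) (v + τ • upperSq u)
      ≤ ∫⁻ τ in Set.Icc (0 : ℝ) 1, F (τ + (s / 2 - τ₁)) := by
        refine setLIntegral_mono' measurableSet_Icc fun τ hτ => ?_
        by_cases h : v + τ • upperSq u ∈ region K s M
        · have h1 := hle τ ⟨hτ, h⟩
          have h2 := hmem.1.1
          rw [Set.indicator_of_mem h, hF, Set.indicator_of_mem, hkey]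
          constructor
          · linarith
          · linarith [hτ.2]
        · rw [Set.indicator_of_notMem h]
          exact zero_le
    _ ≤ ∫⁻ τ, F (τ + (s / 2 - τ₁)) := setLIntegral_le_lintegral _ _
    _ = ∫⁻ x, F x := lintegral_add_right_eq_self F _
    _ ≤ A := by
        rw [hF, lintegral_indicator measurableSet_Icc]
        exact hA R₀ hpsd hdiag

/-- An integral over the region is bounded by the integrals along segments in one direction. -/
theorem lintegral_region_le {s M : ℝ} (hs : 0 ≤ s) {u : Fin K → ℝ} (hu : ∑ l, |u l| ≤ 2)
    {φ : Matrix (Fin K) (Fin K) ℝ → ℝ} (hφ : ContinuousOn φ {R | R.PosSemidef}) {A : ENNReal}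
    (hA : ∀ R₀ : Matrix (Fin K) (Fin K) ℝ, R₀.PosSemidef → (∀ l, R₀ l l ≤ M) →
      ∫⁻ x in Set.Icc (s / 2) (s / 2 + 1), ENNReal.ofReal (φ (R₀ + x • Matrix.vecMulVec u u)) ≤ A) :
    ∫⁻ v in region K s M, ENNReal.ofReal (φ (symOfUpper v)) ≤ A * volume (box K M) := by
  set G := (region K s M).indicator fun v => ENNReal.ofReal (φ (symOfUpper v)) with hG
  have hGm : Measurable G := measurable_indicator_region hs hφ
  have hmeas : Measurable (Function.uncurry fun (τ : ℝ) (v : UpperIndex K → ℝ) =>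
      G (v + τ • upperSq u)) := hGm.comp (by fun_prop)
  rw [← lintegral_indicator (isClosed_region s M).measurableSet]
  -- By translation invariance the integral is an average over translates by τ u uᵀ. Tonelli exposes
  -- the integrals along segments, which vanish for starting points outside the box.
  calc ∫⁻ v, G v = ∫⁻ τ in Set.Icc (0 : ℝ) 1, ∫⁻ v, G (v + τ • upperSq u) := by
        simp only [lintegral_add_right_eq_self G]
        simp
    _ = ∫⁻ v, ∫⁻ τ in Set.Icc (0 : ℝ) 1, G (v + τ • upperSq u) :=
        lintegral_lintegral_swap hmeas.aemeasurable
    _ ≤ ∫⁻ v, (box K M).indicator (fun _ => A) v := by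
        refine lintegral_mono fun v => ?_
        by_cases hv : v ∈ box K M
        · rw [Set.indicator_of_mem hv]
          exact lintegral_indicator_line_le hs hu hA v
        · rw [Set.indicator_of_notMem hv]
          refine le_of_eq ?_
          rw [← lintegral_zero (μ := volume.restrict (Set.Icc (0 : ℝ) 1))]
          refine setLIntegral_congr_fun measurableSet_Icc fun τ hτ => ?_
          exact Set.indicator_of_notMem (fun h => hv (mem_box hu hτ h)) _
    _ = A * volume (box K M) := by
        rw [lintegral_indicator_const]
        exact (isCompact_univ_pi fun _ => isCompact_Icc).isClosed.measurableSet

end Region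

end TensorOverlap

namespace TensorOverlap

/-! ### The convex hull of the path values lies in the region. -/

section Hull

variable {n K p : ℕ} {P : Measure (Fin K → ℝ)} [IsProbabilityMeasure P]

/-- The positive semidefinite matrices that are at least `2 s` and have entries bounded by `M`. -/
def matrixRegion (K : ℕ) (s M : ℝ) : Set (Matrix (Fin K) (Fin K) ℝ) :=
  {R | (∀ y : Fin K → ℝ, 2 * s * ∑ l, y l ^ 2 ≤ ∑ l, ∑ l', y l * y l' * R l l') ∧
    ∀ l l', |R l l'| ≤ M}

theorem convex_matrixRegion (s M : ℝ) : Convex ℝ (matrixRegion K s M) := by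
  intro R hR R' hR' a b ha hb hab
  refine ⟨fun y => ?_, fun l l' => ?_⟩
  · have h1 := mul_le_mul_of_nonneg_left (hR.1 y) ha
    have h2 := mul_le_mul_of_nonneg_left (hR'.1 y) hb
    have e : ∑ l, ∑ l', y l * y l' * (a • R + b • R') l l' =
        a * ∑ l, ∑ l', y l * y l' * R l l' + b * ∑ l, ∑ l', y l * y l' * R' l l' := by
      simp only [Finset.mul_sum, ← Finset.sum_add_distrib, Matrix.add_apply, Matrix.smul_apply,
        smul_eq_mul]
      exact Finset.sum_congr rfl fun l _ => Finset.sum_congr rfl fun l' _ => by ring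
    rw [e]
    calc 2 * s * ∑ l, y l ^ 2 = (a + b) * (2 * s * ∑ l, y l ^ 2) := by rw [hab, one_mul]
      _ ≤ _ := by rw [add_mul]; exact add_le_add h1 h2
  · have h1 := mul_le_mul_of_nonneg_left (hR.2 l l') ha
    have h2 := mul_le_mul_of_nonneg_left (hR'.2 l l') hb
    simp only [Matrix.add_apply, Matrix.smul_apply, smul_eq_mul]
    refine (abs_add_le _ _).trans ?_
    rw [abs_mul, abs_mul, abs_of_nonneg ha, abs_of_nonneg hb]
    calc a * |R l l'| + b * |R' l l'| ≤ a * M + b * M := add_le_add h1 h2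
      _ = M := by rw [← add_mul, hab, one_mul]

theorem preimage_matrixRegion_subset (s M : ℝ) :
    symOfUpper ⁻¹' matrixRegion K s M ⊆ region K s M := by
  intro v hv
  refine ⟨fun y => ?_, fun q => ?_⟩
  · rw [quadForm_eq]
    exact hv.1 y
  · have h := hv.2 q.1.1 q.1.2
    simpa only [symOfUpper, Matrix.of_apply, min_eq_left q.2, max_eq_right q.2] using h

/-- Diagonal dominance: an off-diagonal pair costs at most s(y_l² + y_l'²), and the diagonal
entries, at least 2Ks, outweigh the K - 1 others by 2s. -/
theorem two_mul_sq_le_of_mem_perturbations {s : ℝ} {ε : Matrix (Fin K) (Fin K) ℝ}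
    (hε : ε ∈ perturbations K s) (y : Fin K → ℝ) :
    2 * s * ∑ l, y l ^ 2 ≤ ∑ l, ∑ l', y l * y l' * ε l l' := by
  have hterm : ∀ l l', (if l = l' then (2 * K * s + 2 * s) * y l ^ 2 else 0) ≤
      y l * y l' * ε l l' + s * (y l ^ 2 + y l' ^ 2) := by
    intro l l'
    split_ifs with h
    · subst h
      have := mul_le_mul_of_nonneg_left (hε.2 l).1 (sq_nonneg (y l))
      nlinarith
    · obtain ⟨h1, h2⟩ := (hε.1 l l' h).2
      have h3 : |y l * y l' * ε l l'| ≤ |y l * y l'| * (2 * s) := by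
        rw [abs_mul]
        refine mul_le_mul_of_nonneg_left (abs_le.2 ⟨?_, h2⟩) (abs_nonneg _)
        linarith
      have h4 : |y l * y l'| * 2 ≤ y l ^ 2 + y l' ^ 2 := by
        rw [abs_mul, ← sq_abs (y l), ← sq_abs (y l')]
        nlinarith [sq_nonneg (|y l| - |y l'|)]
      have hs : 0 ≤ s := by linarith
      have h5 := mul_le_mul_of_nonneg_left h4 hs
      have h6 := (abs_le.1 h3).1
      linarith
  have hsum := Finset.sum_le_sum fun l (_ : l ∈ (Finset.univ : Finset (Fin K))) =>
    Finset.sum_le_sum fun l' (_ : l' ∈ (Finset.univ : Finset (Fin K))) => hterm l l'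
  simp only [Finset.sum_ite_eq, Finset.mem_univ, if_true, Finset.sum_add_distrib,
    ← Finset.mul_sum, Finset.sum_const, Finset.card_univ, Fintype.card_fin, nsmul_eq_mul] at hsum
  linarith

theorem abs_le_of_mem_perturbations {s : ℝ} (hs : 0 ≤ s) (hs1 : s ≤ 1)
    {ε : Matrix (Fin K) (Fin K) ℝ} (hε : ε ∈ perturbations K s) (l l' : Fin K) :
    |ε l l'| ≤ 2 * K + 2 := by
  have hK : (0 : ℝ) ≤ K := Nat.cast_nonneg K
  by_cases h : l = l'
  · subst h
    obtain ⟨h1, h2⟩ := hε.2 l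
    have h3 : 0 ≤ 2 * K * s := by positivity
    have h4 : (2 * K + 1) * s ≤ (2 * K + 1) * 1 := mul_le_mul_of_nonneg_left hs1 (by positivity)
    exact abs_le.2 ⟨by linarith, by linarith⟩
  · obtain ⟨h1, h2⟩ := (hε.1 l l' h).2
    exact abs_le.2 ⟨by linarith, by linarith⟩

/-- Schur product theorem. The power 0, which occurs for p = 1, is the all-ones matrix and has rank
at most one. -/
theorem posSemidef_hadamard_pow {R : Matrix (Fin K) (Fin K) ℝ} (hR : R.PosSemidef) (m : ℕ) :
    (Matrix.of fun l l' => R l l' ^ m).PosSemidef := by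
  induction m with
  | zero =>
    have h := Matrix.posSemidef_vecMulVec_self_star (fun _ : Fin K => (1 : ℝ))
    convert h using 1
    ext l l'
    simp [Matrix.vecMulVec_apply]
  | succ m ih =>
    have e : (Matrix.of fun l l' => R l l' ^ (m + 1)) =
        (Matrix.of fun l l' => R l l' ^ m).hadamard R := by
      ext l l'
      simp [pow_succ]
    rw [e]
    exact ih.hadamard hR

/-- The values of the interpolation paths lie in a convex region of positive definite matrices. -/
theorem pathValues_subset (hn : 1 ≤ n) {B : ℝ} (hB : 0 ≤ B) (hP : ∀ᵐ x ∂P, ‖x‖ ≤ B) {s : ℝ}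
    (hs : 0 ≤ s) (hs1 : s ≤ 1) {t : ℝ} (ht : t ∈ Set.Icc (0 : ℝ) 1) :
    pathValues P n p s t ⊆ matrixRegion K s (2 * K + 2 + (B ^ 2) ^ (p - 1)) := by
  rintro R ⟨ε, hε, ρ, ⟨hρ0, hρ⟩, rfl⟩
  have h0 : (0 : ℝ) ∈ Set.Icc (0 : ℝ) 1 := ⟨le_rfl, zero_le_one⟩
  refine ⟨fun y => ?_, fun l l' => ?_⟩
  · have hder : ∀ u ∈ Set.Icc (0 : ℝ) 1, HasDerivWithinAt
        (fun u => ∑ l, ∑ l', y l * y l' * ρ u l l')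
        (∑ l, ∑ l', y l * y l' * meanOverlap P n p u (ρ u) l l' ^ (p - 1)) (Set.Icc 0 1) u :=
      fun u hu => HasDerivWithinAt.fun_sum fun l _ => HasDerivWithinAt.fun_sum fun l' _ =>
        ((hρ u hu).2 l l').const_mul _
    have hnn : ∀ u ∈ Set.Icc (0 : ℝ) 1,
        0 ≤ ∑ l, ∑ l', y l * y l' * meanOverlap P n p u (ρ u) l l' ^ (p - 1) := by
      intro u hu
      have h := (posSemidef_hadamard_pow (posSemidef_meanOverlap (n := n) (p := p) hB hP hu.2
        (hρ u hu).1) (p - 1)).dotProduct_mulVec_nonneg y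
      rwa [star_trivial, quadForm_eq] at h
    have hmono := monotoneOn_of_hasDerivWithinAt_nonneg (convex_Icc (0 : ℝ) 1)
      (fun u hu => (hder u hu).continuousWithinAt)
      (fun u hu => (hder u (interior_subset hu)).mono interior_subset)
      (fun u hu => hnn u (interior_subset hu))
    have h1 := hmono h0 ht ht.1
    simp only [hρ0] at h1
    exact (two_mul_sq_le_of_mem_perturbations hε y).trans h1
  · have hb : ∀ u ∈ Set.Icc (0 : ℝ) 1,
        ‖meanOverlap P n p u (ρ u) l l' ^ (p - 1)‖ ≤ (B ^ 2) ^ (p - 1) := by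
      intro u hu
      rw [norm_pow]
      exact pow_le_pow_left₀ (norm_nonneg _) (abs_meanOverlap_le hB hP hu.2 hn (hρ u hu).1 l l') _
    have h1 := (convex_Icc (0 : ℝ) 1).norm_image_sub_le_of_norm_hasDerivWithin_le
      (fun u hu => (hρ u hu).2 l l') hb h0 ht
    rw [hρ0, sub_zero, Real.norm_eq_abs, Real.norm_eq_abs, abs_of_nonneg ht.1] at h1
    have h2 := abs_le_of_mem_perturbations hs hs1 hε l l'
    have h3 : (B ^ 2) ^ (p - 1) * t ≤ (B ^ 2) ^ (p - 1) * 1 :=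
      mul_le_mul_of_nonneg_left ht.2 (by positivity)
    have e : ρ t l l' = ε l l' + (ρ t l l' - ε l l') := by ring
    rw [e]
    refine (abs_add_le _ _).trans ?_
    linarith

theorem preimage_convexHull_subset (hn : 1 ≤ n) {B : ℝ} (hB : 0 ≤ B) (hP : ∀ᵐ x ∂P, ‖x‖ ≤ B)
    {s : ℝ} (hs : 0 ≤ s) (hs1 : s ≤ 1) {t : ℝ} (ht : t ∈ Set.Icc (0 : ℝ) 1) :
    symOfUpper ⁻¹' convexHull ℝ (pathValues P n p s t) ⊆
      region K s (2 * K + 2 + (B ^ 2) ^ (p - 1)) :=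
  (Set.preimage_mono (convexHull_min (pathValues_subset hn hB hP hs hs1 ht)
    (convex_matrixRegion _ _))).trans (preimage_matrixRegion_subset _ _)

end Hull

/-! ### Integration over the region and choice of parameters. -/

section Concentration

variable {n K p : ℕ} {P : Measure (Fin K → ℝ)} [IsProbabilityMeasure P]

theorem sum_abs_single (l : Fin K) : ∑ k, |(Pi.single l 1 : Fin K → ℝ) k| = 1 := by
  simp [Pi.single_apply, apply_ite abs]

theorem sum_abs_single_le (l : Fin K) : ∑ k, |(Pi.single l 1 : Fin K → ℝ) k| ≤ 2 := by
  rw [sum_abs_single]; norm_num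

theorem sum_abs_single_add_le (l l' : Fin K) :
    ∑ k, |(Pi.single l 1 + Pi.single l' 1 : Fin K → ℝ) k| ≤ 2 := by
  refine (Finset.sum_le_sum fun k _ => abs_add_le _ _).trans ?_
  rw [Finset.sum_add_distrib, sum_abs_single, sum_abs_single]
  norm_num

theorem setIntegral_region_le {s M : ℝ} (hs : 0 ≤ s) {φ : Matrix (Fin K) (Fin K) ℝ → ℝ}
    (hφ : ContinuousOn φ {R | R.PosSemidef}) (hφ0 : ∀ R, 0 ≤ φ R) {A : ℝ} (hA0 : 0 ≤ A)
    {u : Fin K → ℝ} (hu : ∑ l, |u l| ≤ 2)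
    (hA : ∀ R₀ : Matrix (Fin K) (Fin K) ℝ, R₀.PosSemidef → (∀ l, R₀ l l ≤ M) →
      ∫⁻ x in Set.Icc (s / 2) (s / 2 + 1), ENNReal.ofReal (φ (R₀ + x • Matrix.vecMulVec u u)) ≤
        ENNReal.ofReal A) :
    ∫ v in region K s M, φ (symOfUpper v) ≤ A * volume.real (box K M) := by
  have h := lintegral_region_le hs hu hφ hA
  have hc : ContinuousOn (fun v => φ (symOfUpper v)) (region K s M) :=
    hφ.comp continuous_symOfUpper.continuousOn fun v hv => posSemidef_of_mem_region hv hs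
  rw [integral_eq_lintegral_of_nonneg_ae (Filter.Eventually.of_forall fun v => hφ0 _)
    (hc.aestronglyMeasurable (isClosed_region s M).measurableSet)]
  refine (ENNReal.toReal_mono (ENNReal.mul_ne_top ENNReal.ofReal_ne_top
    (volume_box_lt_top M).ne) h).trans (le_of_eq ?_)
  rw [ENNReal.toReal_mul, ENNReal.toReal_ofReal hA0]
  rfl

theorem integrableOn_region {s M : ℝ} (hs : 0 ≤ s) {φ : Matrix (Fin K) (Fin K) ℝ → ℝ}
    (hφ : ContinuousOn φ {R | R.PosSemidef}) :
    IntegrableOn (fun v => φ (symOfUpper v)) (region K s M) := by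
  have hc : ContinuousOn (fun v => φ (symOfUpper v)) (region K s M) :=
    hφ.comp continuous_symOfUpper.continuousOn fun v hv => posSemidef_of_mem_region hv hs
  exact hc.integrableOn_compact ((isCompact_univ_pi fun _ => isCompact_Icc).of_isClosed_subset
    (isClosed_region s M) (region_subset_box s M))

omit [IsProbabilityMeasure P] in
theorem overlapVar_nonneg (B t : ℝ) (v : Fin K → ℝ) (R : Matrix (Fin K) (Fin K) ℝ) :
    0 ≤ overlapVar P n p B t v R := variance_nonneg _ _

omit [IsProbabilityMeasure P] in
theorem covSq_nonneg (B t : ℝ) (v : Fin K → ℝ) (R : Matrix (Fin K) (Fin K) ℝ) :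
    0 ≤ covSq P n p B t v R :=
  Finset.sum_nonneg fun _ _ => Finset.sum_nonneg fun _ _ => integral_nonneg fun _ => sq_nonneg _

/-- The overlap concentrates on average over the region. -/
theorem setIntegral_overlapFluctuation_le (hp : 1 ≤ p) (hn : 1 ≤ n) {B : ℝ} (hB : 0 ≤ B)
    (hP : ∀ᵐ x ∂P, ‖x‖ ≤ B) {t : ℝ} (ht : t ∈ Set.Icc (0 : ℝ) 1) {s δ : ℝ} (hs : 0 < s)
    (hs1 : s ≤ 1) (hδ : 0 < δ) (hδ1 : δ ≤ 1) (hnδ : n * δ ^ 3 = 1) (M : ℝ) :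
    ∫ v in region K s M, overlapFluctuation P n p t (symOfUpper v) ≤
      K ^ 2 * (volume.real (box K M) *
        (9 * lineConst K p B (√M) + B ^ 2 + 8 * B ^ 4)) * (δ / √s) := by
  have hn0 : (0 : ℝ) < n := by exact_mod_cast hn
  have hs0 : 0 < √s := Real.sqrt_pos.2 hs
  have hL := lineConst_nonneg (K := K) (p := p) (B := B) (σ := √M)
  set W := volume.real (box K M) with hW
  have hW0 : 0 ≤ W := measureReal_nonneg
  have hV : ∀ u : Fin K → ℝ, ∑ l, |u l| ≤ 2 →
      ∫ v in region K s M, overlapVar P n p B t u (symOfUpper v) ≤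
        4 / √s * (lineConst K p B (√M) * (n ^ 2 * δ)) * W := fun u hu =>
    setIntegral_region_le hs.le (continuousOn_overlapVar hB t u) (overlapVar_nonneg B t u)
      (by positivity) hu fun R₀ h1 h2 =>
        lintegral_line_overlapVar_le hp hn hB ht h1 h2 hu hs hs1 hδ hδ1 hnδ
  have hT : ∀ u : Fin K → ℝ, ∑ l, |u l| ≤ 2 →
      ∫ v in region K s M, covSq P n p B t u (symOfUpper v) ≤ 2 * (n * (2 * B) ^ 2) * W :=
    fun u hu => setIntegral_region_le hs.le (continuousOn_covSq hB t u) (covSq_nonneg B t u)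
      (by positivity) hu fun R₀ h1 _ => lintegral_line_covSq_le hB t h1 hu hs
  have iV := fun u : Fin K → ℝ => integrableOn_region (M := M) hs.le
    (continuousOn_overlapVar (P := P) (n := n) (p := p) hB t u)
  have iT := fun u : Fin K → ℝ => integrableOn_region (M := M) hs.le
    (continuousOn_covSq (P := P) (n := n) (p := p) hB t u)
  have iF := integrableOn_region (M := M) hs.le
    (continuousOn_overlapFluctuation (n := n) (p := p) hB hP ht.2)
  have hfin : volume (region K s M) < ⊤ :=
    (measure_mono (region_subset_box s M)).trans_lt (volume_box_lt_top M)
  have iC : ∀ c : ℝ, IntegrableOn (fun _ : UpperIndex K → ℝ => c) (region K s M) := fun c =>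
    integrableOn_const hfin.ne
  -- The splitting parameter η is taken equal to δ.
  set ψ : Fin K → Fin K → (UpperIndex K → ℝ) → ℝ := fun l l' v => 3 / (4 * (n : ℝ) ^ 2) *
      (overlapVar P n p B t (Pi.single l 1 + Pi.single l' 1) (symOfUpper v) +
        overlapVar P n p B t (Pi.single l 1) (symOfUpper v) +
        overlapVar P n p B t (Pi.single l' 1) (symOfUpper v)) +
      (B ^ 2 * δ + B ^ 2 / (2 * δ * (n : ℝ) ^ 2) *
        (covSq P n p B t (Pi.single l 1) (symOfUpper v) +
          covSq P n p B t (Pi.single l' 1) (symOfUpper v))) with hψ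
  have iψ : ∀ l l', IntegrableOn (ψ l l') (region K s M) := fun l l' =>
    ((((iV _).add (iV _)).add (iV _)).const_mul _).add
      ((iC _).add (((iT _).add (iT _)).const_mul _))
  have hle : ∫ v in region K s M, overlapFluctuation P n p t (symOfUpper v) ≤
      ∫ v in region K s M, ∑ l, ∑ l', ψ l l' v := by
    refine setIntegral_mono_on iF (integrable_finsetSum _ fun l _ =>
      integrable_finsetSum _ fun l' _ => iψ l l') (isClosed_region s M).measurableSet
      fun v hv => ?_
    exact overlapFluctuation_le hB hP ht.2 hn hδ (posSemidef_of_mem_region hv hs.le)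
  have hψle : ∀ l l', ∫ v in region K s M, ψ l l' v ≤
      W * (9 * lineConst K p B (√M) + B ^ 2 + 8 * B ^ 4) * (δ / √s) := by
    intro l l'
    have e : ∫ v in region K s M, ψ l l' v = 3 / (4 * (n : ℝ) ^ 2) *
        ((∫ v in region K s M,
            overlapVar P n p B t (Pi.single l 1 + Pi.single l' 1) (symOfUpper v)) +
          (∫ v in region K s M, overlapVar P n p B t (Pi.single l 1) (symOfUpper v)) +
          ∫ v in region K s M, overlapVar P n p B t (Pi.single l' 1) (symOfUpper v)) +
        (B ^ 2 * δ * volume.real (region K s M) + B ^ 2 / (2 * δ * (n : ℝ) ^ 2) *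
          ((∫ v in region K s M, covSq P n p B t (Pi.single l 1) (symOfUpper v)) +
            ∫ v in region K s M, covSq P n p B t (Pi.single l' 1) (symOfUpper v))) := by
      have i1 : IntegrableOn (fun v => overlapVar P n p B t (Pi.single l 1 + Pi.single l' 1)
          (symOfUpper v) + overlapVar P n p B t (Pi.single l 1) (symOfUpper v))
          (region K s M) := (iV _).add (iV _)
      have i2 : IntegrableOn (fun v => overlapVar P n p B t (Pi.single l 1 + Pi.single l' 1)
          (symOfUpper v) + overlapVar P n p B t (Pi.single l 1) (symOfUpper v) +
          overlapVar P n p B t (Pi.single l' 1) (symOfUpper v)) (region K s M) := i1.add (iV _)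
      have i3 : IntegrableOn (fun v => covSq P n p B t (Pi.single l 1) (symOfUpper v) +
          covSq P n p B t (Pi.single l' 1) (symOfUpper v)) (region K s M) := (iT _).add (iT _)
      have i4 : IntegrableOn (fun v => B ^ 2 * δ + B ^ 2 / (2 * δ * (n : ℝ) ^ 2) *
          (covSq P n p B t (Pi.single l 1) (symOfUpper v) +
          covSq P n p B t (Pi.single l' 1) (symOfUpper v))) (region K s M) :=
        (iC _).add (i3.const_mul _)
      simp only [hψ]
      rw [integral_add (i2.const_mul _) i4, integral_const_mul, integral_add i1 (iV _),
        integral_add (iV _) (iV _), integral_add (iC _) (i3.const_mul _), setIntegral_const,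
        integral_const_mul, integral_add (iT _) (iT _), smul_eq_mul,
        mul_comm (volume.real (region K s M))]
    rw [e]
    have hvol : volume.real (region K s M) ≤ W :=
      ENNReal.toReal_mono (volume_box_lt_top M).ne (measure_mono (region_subset_box s M))
    have b1 := hV _ (sum_abs_single_add_le l l')
    have b2 := hV _ (sum_abs_single_le l)
    have b3 := hV _ (sum_abs_single_le l')
    have b4 := hT _ (sum_abs_single_le l)
    have b5 := hT _ (sum_abs_single_le l')
    have c1 : 3 / (4 * (n : ℝ) ^ 2) *
        ((∫ v in region K s M,
            overlapVar P n p B t (Pi.single l 1 + Pi.single l' 1) (symOfUpper v)) +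
          (∫ v in region K s M, overlapVar P n p B t (Pi.single l 1) (symOfUpper v)) +
          ∫ v in region K s M, overlapVar P n p B t (Pi.single l' 1) (symOfUpper v)) ≤
        W * (9 * lineConst K p B (√M)) * (δ / √s) := by
      refine (mul_le_mul_of_nonneg_left (add_le_add (add_le_add b1 b2) b3)
        (by positivity)).trans (le_of_eq ?_)
      field_simp
      ring
    have hone : 1 ≤ 1 / √s := by
      rw [le_div_iff₀ hs0, one_mul, Real.sqrt_le_left zero_le_one]
      linarith
    have hδs : δ ≤ δ / √s := by
      have := mul_le_mul_of_nonneg_left hone hδ.le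
      rw [mul_one] at this
      exact this.trans (le_of_eq (by ring))
    have c2 : B ^ 2 * δ * volume.real (region K s M) ≤ W * B ^ 2 * (δ / √s) := by
      calc B ^ 2 * δ * volume.real (region K s M) ≤ B ^ 2 * δ * W :=
            mul_le_mul_of_nonneg_left hvol (by positivity)
        _ = W * B ^ 2 * δ := by ring
        _ ≤ _ := mul_le_mul_of_nonneg_left hδs (by positivity)
    have c3 : B ^ 2 / (2 * δ * (n : ℝ) ^ 2) *
          ((∫ v in region K s M, covSq P n p B t (Pi.single l 1) (symOfUpper v)) +
            ∫ v in region K s M, covSq P n p B t (Pi.single l' 1) (symOfUpper v)) ≤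
        W * (8 * B ^ 4) * (δ / √s) := by
      -- The sum of squared covariances is O(n), so after division by δn² it is of order 1/(nδ) =
      -- δ², below the main term δ.
      have hinv : 1 / (n * δ) = δ ^ 2 := by
        rw [div_eq_iff (by positivity)]
        linear_combination -hnδ
      calc _ ≤ B ^ 2 / (2 * δ * (n : ℝ) ^ 2) *
            (2 * (n * (2 * B) ^ 2) * W + 2 * (n * (2 * B) ^ 2) * W) :=
            mul_le_mul_of_nonneg_left (add_le_add b4 b5) (by positivity)
        _ = W * (8 * B ^ 4) * (1 / (n * δ)) := by field_simp; ring
        _ = W * (8 * B ^ 4) * δ ^ 2 := by rw [hinv]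
        _ ≤ W * (8 * B ^ 4) * δ := by
            refine mul_le_mul_of_nonneg_left ?_ (by positivity)
            nlinarith
        _ ≤ _ := mul_le_mul_of_nonneg_left hδs (by positivity)
    calc _ ≤ W * (9 * lineConst K p B (√M)) * (δ / √s) + (W * B ^ 2 * (δ / √s) +
          W * (8 * B ^ 4) * (δ / √s)) := add_le_add c1 (add_le_add c2 c3)
      _ = _ := by ring
  refine hle.trans ?_
  rw [integral_finsetSum _ fun l _ => integrable_finsetSum _ fun l' _ => iψ l l']
  refine (Finset.sum_le_sum (g := fun _ => ∑ _l' : Fin K,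
    W * (9 * lineConst K p B (√M) + B ^ 2 + 8 * B ^ 4) * (δ / √s)) fun l _ => ?_).trans
    (le_of_eq ?_)
  · rw [integral_finsetSum _ fun l' _ => iψ l l']
    exact Finset.sum_le_sum fun l' _ => hψle l l'
  · simp only [Finset.sum_const, Finset.card_univ, Fintype.card_fin, nsmul_eq_mul]
    ring

/-- The rate obtained is stronger than the announced one; it is weakened using n ≥ 1 and s ≤ 1. -/
theorem rpow_div_sqrt_le {s : ℝ} (hs : 0 < s) (hs1 : s ≤ 1) (hn : 1 ≤ n) :
    (n : ℝ) ^ (-(1 / 3) : ℝ) / √s ≤ 1 / (s ^ (3 / 2 : ℝ) * (n : ℝ) ^ (1 / 6 : ℝ)) := by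
  have hn1 : (1 : ℝ) ≤ n := by exact_mod_cast hn
  have hn0 : (0 : ℝ) < n := by linarith
  rw [Real.rpow_neg hn0.le, Real.sqrt_eq_rpow, div_eq_mul_inv, ← mul_inv, ← one_div]
  refine one_div_le_one_div_of_le (by positivity) ?_
  rw [mul_comm]
  exact mul_le_mul (Real.rpow_le_rpow_of_exponent_le hn1 (by norm_num))
    (Real.rpow_le_rpow_of_exponent_ge hs hs1 (by norm_num)) (by positivity) (by positivity)

theorem natCast_mul_rpow_pow_three (hn : 1 ≤ n) : (n : ℝ) * ((n : ℝ) ^ (-(1 / 3) : ℝ)) ^ 3 = 1 := by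
  have hn0 : (0 : ℝ) < n := by exact_mod_cast hn
  rw [← Real.rpow_natCast, ← Real.rpow_mul hn0.le]
  norm_num
  rw [Real.rpow_neg_one, mul_inv_cancel₀ hn0.ne']

end Concentration

end TensorOverlap

theorem mainTheorem5 (K p : ℕ) (hp : 1 ≤ p)
    (P : MeasureTheory.Measure (Fin K → ℝ)) [MeasureTheory.IsProbabilityMeasure P]
    (hP : ∃ B : ℝ, ∀ᵐ x ∂P, ‖x‖ ≤ B) :
    ∃ C : ℝ, 0 < C ∧
      ∀ s : ℕ → ℝ, (∀ n, 1 ≤ n → 0 < s n ∧ s n < 1) → AntitoneOn s (Set.Ici 1) →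
        ∀ n : ℕ, 1 ≤ n → ∀ t ∈ Set.Icc (0 : ℝ) 1,
          MeasureTheory.IntegrableOn
            (fun v : TensorOverlap.UpperIndex K → ℝ =>
              TensorOverlap.overlapFluctuation P n p t (TensorOverlap.symOfUpper v))
            (TensorOverlap.symOfUpper ⁻¹'
              convexHull ℝ (TensorOverlap.pathValues P n p (s n) t)) ∧
          ∫ v in (TensorOverlap.symOfUpper ⁻¹'
              convexHull ℝ (TensorOverlap.pathValues P n p (s n) t)),
            TensorOverlap.overlapFluctuation P n p t (TensorOverlap.symOfUpper v) ≤
              C / (s n ^ (3 / 2 : ℝ) * (n : ℝ) ^ (1 / 6 : ℝ)) := by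
  obtain ⟨B', hB'⟩ := hP
  set B := max B' 0 with hBdef
  have hB : 0 ≤ B := le_max_right _ _
  have hPB : ∀ᵐ x ∂P, ‖x‖ ≤ B := hB'.mono fun x hx => hx.trans (le_max_left _ _)
  set M : ℝ := 2 * K + 2 + (B ^ 2) ^ (p - 1) with hM
  set A : ℝ := K ^ 2 * (volume.real (TensorOverlap.box K M) *
    (9 * TensorOverlap.lineConst K p B (√M) + B ^ 2 + 8 * B ^ 4)) with hA
  have hL := TensorOverlap.lineConst_nonneg (K := K) (p := p) (B := B) (σ := √M)
  have hA0 : 0 ≤ A := by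
    have : 0 ≤ volume.real (TensorOverlap.box K M) := measureReal_nonneg
    positivity
  -- A may vanish, for instance when K = 0, while the constant must be positive.
  refine ⟨A + 1, by linarith, fun s hs _ n hn t ht => ?_⟩
  obtain ⟨hs0, hs1⟩ := hs n hn
  have hsub := TensorOverlap.preimage_convexHull_subset (p := p) hn hB hPB hs0.le hs1.le ht
  have hint := TensorOverlap.integrableOn_region (M := M) hs0.le
    (TensorOverlap.continuousOn_overlapFluctuation (n := n) (p := p) hB hPB ht.2)
  refine ⟨hint.mono_set hsub, ?_⟩
  have hn1 : (1 : ℝ) ≤ n := by exact_mod_cast hn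
  have hδ : 0 < (n : ℝ) ^ (-(1 / 3) : ℝ) := by positivity
  have hδ1 : (n : ℝ) ^ (-(1 / 3) : ℝ) ≤ 1 := Real.rpow_le_one_of_one_le_of_nonpos hn1 (by norm_num)
  have hnn : 0 ≤ᵐ[volume.restrict (TensorOverlap.region K (s n) M)]
      fun v => TensorOverlap.overlapFluctuation P n p t (TensorOverlap.symOfUpper v) :=
    (ae_restrict_mem (TensorOverlap.isClosed_region _ _).measurableSet).mono fun v hv =>
      TensorOverlap.overlapFluctuation_nonneg hB hPB ht.2
        (TensorOverlap.posSemidef_of_mem_region hv hs0.le)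
  -- Nonnegativity on the region allows the hull to be enlarged to it, without measurability of the
  -- hull.
  refine (setIntegral_mono_set hint hnn (Filter.Eventually.of_forall hsub)).trans ?_
  refine (TensorOverlap.setIntegral_overlapFluctuation_le hp hn hB hPB ht hs0 hs1.le hδ hδ1
    (TensorOverlap.natCast_mul_rpow_pow_three hn) M).trans ?_
  refine (mul_le_mul_of_nonneg_left (TensorOverlap.rpow_div_sqrt_le hs0 hs1.le hn) hA0).trans ?_
  have hpos : 0 ≤ 1 / (s n ^ (3 / 2 : ℝ) * (n : ℝ) ^ (1 / 6 : ℝ)) := by positivity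
  rw [div_eq_mul_one_div (A + 1)]
  exact mul_le_mul_of_nonneg_right (by linarith) hpos
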